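/- **Setting.** Let $\mathcal G=(\mathcal V,\mathrm E)$ be a finite simple graph with vertices $\mathcal V=\{1,\dots,N\}$ in which every vertex has degree at most $\mathfrak d_0$, where $\mathfrak d_0\ge 1$, and let $\mathcal N_i$ be the set of neighbours of $i$. Let $|\phi_0\rangle\in\mathbb C^D\otimes\mathbb C^D$ be a unit vector and let $|\phi_1\rangle,\dots,|\phi_{D^2-1}\rangle$ complete it to an orthonormal basis. For every vertex $i$ let $A_i:(\mathbb C^D)^{\otimes|\mathcal N_i|}\to\mathbb C^d$ be an injective linear map, with Moore–Penrose pseudo-inverse $A_i^{-1}$. Let $S_i$ be the image of $A_i$, let $P_{S_i}$ be the orthogonal projector onto $S_i$, and put $P_{S_i}^\perp=I-P_{S_i}$. The injective PEPS $|\psi\rangle\in(\mathbb C^d)^{\otimes N}$ is the normalization of $\big(\bigotimes_i A_i\big)\bigotimes_{e\in\mathrm E}|\phi_0\rangle_e$, where each edge has a fixed, arbitrary orientation and $A_i$ acts on the virtual qudits of the edges at $i$. For an edge $e=(i,j)$ and $1\le\alpha\le D^2-1$ put $$L_{\alpha,e}=(A_i\otimes A_j)\,|\phi_0\rangle\langle\phi_\alpha|_e\,(A_i^{-1}\otimes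 A_j^{-1}),\qquad H_{\mathrm{eff},e}=\tfrac12\sum_\alpha L_{\alpha,e}^\dagger L_{\alpha,e}.$$ For $\Gamma>0$ let $\mathcal E_e$ be the two-site map with Kraus operators $K_{0,e}=(I-2\Gamma H_{\mathrm{eff},e})^{1/2}$ and $K_{\alpha,e}=\sqrt\Gamma\,L_{\alpha,e}$ for $1\le\alpha\le D^2-1$. For a vertex $i$ let $$\mathcal E_i(X)=P_{S_i}XP_{S_i}+\frac{P_{S_i}}{\dim S_i}\otimes\mathrm{Tr}_i\big(P_{S_i}^\perp X\big).$$ Let $\mathrm E=\mathrm E_1\sqcup\dots\sqcup\mathrm E_k$ with $k\ge1$ be a partition of the edges such that no two distinct edges of the same class share a vertex, and put $$\mathcal E=\Big(\frac1k\sum_{q=1}^k\ \prod_{e\in\mathrm E_q}\mathcal E_e\Big)\circ\prod_{i\in\mathcal V}\mathcal E_i .$$ The norm of a superoperator is $\|\mathcal F\|_{1\to1}=\sup_{\|X\|_1=1}\|\mathcal F(X)\|_1$, where $\|X\|_1=\mathrm{Tr}\sqrt{X^\dagger X}$. **Theorem.** There are thresholds $\delta_{\rm th}=\delta_{\rm th}(\mathfrak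 d_0)>0$, depending only on $\mathfrak d_0$, with $\delta_{\rm th}=\Theta(1/\mathfrak d_0)$ as $\mathfrak d_0\to\infty$, and absolute constants $0<a\le b$ and $C,\kappa,K>0$, such that the following holds for every $\mathfrak d_0\geq 1$, every $0<\delta\le\delta_{\rm th}(\mathfrak d_0)$ and every $\Gamma\in[a\delta,b\delta]$, and for all $N,d,D,k$, graphs, injective PEPS and edge partitions as above. If $\|A_i^\dagger A_i-I\|\le\delta$ in operator norm for all $i\in\mathcal V$, then: 1. $2\Gamma H_{\mathrm{eff},e}\preceq I$ for every edge $e$, so that $K_{0,e}$ is well defined. 2. For every integer $T\ge0$, $$\big\|\mathcal E^T-\mathrm{Tr}(\cdot)\,|\psi\rangle\langle\psi|\big\|_{1\to1}\le C\,N\,\mathfrak d_0\,e^{-\kappa\delta T/k}.$$ 3. For every $0<\varepsilon\le\frac12$ and every integer $T\ge 0$ with $T\ge K\,\frac{k}{\delta}\,\log(N\mathfrak d_0/\varepsilon)$, the left-hand side in 2 is at most $\varepsilon$ (with $\log 0:=0$ if $N=0$). When $k=O(\mathfrak d_0)$, which can always be arranged, the rate $\kappa\delta/k$ is bounded below by a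 positive number that depends only on $\delta$ and $\mathfrak d_0$, not on $N$. The bound in 2 is then $O(N\mathfrak d_0e^{-\Theta(T)})$, and $O(\log(N\mathfrak d_0/\varepsilon))$ steps suffice in 3. -/

import Mathlib

open Filter Asymptotics
open scoped ENNReal Matrix Kronecker ComplexOrder MatrixOrder

noncomputable section

namespace Dissipative

/-! ### Norms -/

/-- The operator norm (largest singular value) of a square complex matrix. -/
def opNorm {n : Type*} [Fintype n] [DecidableEq n] (M : Matrix n n ℂ) : ℝ :=
  ‖Matrix.toEuclideanCLM (n := n) (𝕜 := ℂ) M‖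

/-- The trace norm `Tr √(X† X)`. -/
def traceNorm {n : Type*} [Fintype n] [DecidableEq n] (X : Matrix n n ℂ) : ℝ :=
  (CFC.sqrt (Xᴴ * X)).trace.re

/-- The induced trace norm `sup {‖F X‖₁ : ‖X‖₁ = 1}` of a superoperator, as an extended
nonnegative real. -/
def norm11 {n : Type*} [Fintype n] [DecidableEq n]
    (F : Matrix n n ℂ →ₗ[ℂ] Matrix n n ℂ) : ℝ≥0∞ :=
  ⨆ X : {X : Matrix n n ℂ // traceNorm X = 1}, ENNReal.ofReal (traceNorm (F X.1))

/-! ### Pseudo-inverse and projector onto the image -/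

/-- `(A†A)⁻¹A†`, the Moore–Penrose pseudo-inverse of an injective matrix `A`. -/
def pinv {m n : Type*} [Fintype m] [Fintype n] [DecidableEq n]
    (A : Matrix m n ℂ) : Matrix n m ℂ :=
  (Aᴴ * A)⁻¹ * Aᴴ

/-- The orthogonal projector `A(A†A)⁻¹A†` onto the image of an injective matrix `A`. -/
def imProj {m n : Type*} [Fintype m] [Fintype n] [DecidableEq n]
    (A : Matrix m n ℂ) : Matrix m m ℂ :=
  A * pinv A

theorem pinv_mul_self {m n : Type*} [Fintype m] [Fintype n] [DecidableEq n]
    (A : Matrix m n ℂ) (hA : Function.Injective A.mulVec) : pinv A * A = 1 := by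
  have h : (Aᴴ * A).PosDef := Matrix.PosDef.conjTranspose_mul_self A hA
  rw [pinv, Matrix.mul_assoc]
  exact Matrix.nonsing_inv_mul _ ((Matrix.isUnit_iff_isUnit_det _).1 h.isUnit)

/-- `imProj A` is self-adjoint, idempotent, and its image is that of `A`. -/
theorem imProj_spec {m n : Type*} [Fintype m] [Fintype n] [DecidableEq n]
    (A : Matrix m n ℂ) (hA : Function.Injective A.mulVec) :
    (imProj A).IsHermitian ∧ imProj A * imProj A = imProj A ∧
      LinearMap.range (imProj A).mulVecLin = LinearMap.range A.mulVecLin := by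
  refine ⟨?_, ?_, ?_⟩
  · simp [Matrix.IsHermitian, imProj, pinv, Matrix.conjTranspose_mul,
      Matrix.conjTranspose_nonsing_inv, Matrix.mul_assoc]
  · rw [imProj, Matrix.mul_assoc, ← Matrix.mul_assoc (pinv A), pinv_mul_self A hA,
      Matrix.one_mul]
  · apply le_antisymm
    · rintro _ ⟨v, rfl⟩
      exact ⟨(pinv A).mulVec v, by simp [imProj]⟩
    · rintro _ ⟨v, rfl⟩
      refine ⟨A.mulVec v, ?_⟩
      simp only [Matrix.mulVecLin_apply, Matrix.mulVec_mulVec]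
      rw [imProj, Matrix.mul_assoc, pinv_mul_self A hA, Matrix.mul_one]

/-! ### The system of `N` qudits -/

/-- Labels of the product basis of `(ℂ^d)^{⊗N}`. -/
abbrev Conf (N d : ℕ) : Type := Fin N → Fin d

/-- Operators on `(ℂ^d)^{⊗N}`. -/
abbrev Op (N d : ℕ) : Type := Matrix (Conf N d) (Conf N d) ℂ

/-- Superoperators on `N` qudits; the product is composition. -/
abbrev SuperOp (N d : ℕ) : Type := Module.End ℂ (Op N d)

/-- The operator `M` on qudit `i`, tensored with the identity on all the others. -/
def siteOp {N d : ℕ} (i : Fin N) (M : Matrix (Fin d) (Fin d) ℂ) : Op N d :=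
  fun x y => if ∀ l, l ≠ i → x l = y l then M (x i) (y i) else 0

/-- The operator `M` on the qudits `i, j` (`i ≠ j`), tensored with the identity on all the
others. -/
def pairOp {N d : ℕ} (i j : Fin N) (M : Matrix (Fin d × Fin d) (Fin d × Fin d) ℂ) : Op N d :=
  fun x y => if ∀ l, l ≠ i → l ≠ j → x l = y l then M (x i, x j) (y i, y j) else 0

/-- `R ⊗ Tr_i(X)`: trace out qudit `i` and put the operator `R` in its place. -/
def replaceSite {N d : ℕ} (i : Fin N) (R : Matrix (Fin d) (Fin d) ℂ) : SuperOp N d where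
  toFun X := Matrix.of fun x y =>
    R (x i) (y i) * ∑ a : Fin d, X (Function.update x i a) (Function.update y i a)
  map_add' X Y := by
    ext x y
    simp [Finset.sum_add_distrib, mul_add]
  map_smul' r X := by
    ext x y
    simp [Finset.mul_sum, mul_left_comm]

/-! ### Projected entangled pair states -/

section PEPS

variable {N : ℕ} (G : SimpleGraph (Fin N)) [DecidableRel G.Adj] (d D : ℕ)

/-- Labels of the product basis of `(ℂ^D)^{⊗|N_i|}`, the virtual space at vertex `i`:
one qudit for every neighbour of `i`. -/
abbrev Virt (i : Fin N) : Type := G.neighborSet i → Fin D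

/-- The data specifying an injective PEPS on the graph `G` with physical dimension `d` and bond
dimension `D`, and the orthonormal complement of the bond state used in the jump operators. -/
structure InjectivePEPS where
  /-- Every edge is given as an ordered pair of its end points, since the bond state need
  not be symmetric under exchange of its two qudits. -/
  orient : G.edgeSet → G.Dart
  orient_edge : ∀ e, (orient e).edge = e.1
  /-- The bond state. -/
  φ₀ : EuclideanSpace ℂ (Fin D × Fin D)
  /-- States completing `φ₀` to an orthonormal basis of `ℂ^D ⊗ ℂ^D`. -/
  φ : Fin (D ^ 2 - 1) → EuclideanSpace ℂ (Fin D × Fin D)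
  norm_φ₀ : ‖φ₀‖ = 1
  orthonormal_φ : Orthonormal ℂ φ
  orthogonal_φ₀ : ∀ α, inner ℂ φ₀ (φ α) = 0
  /-- The tensors. -/
  A : ∀ i : Fin N, Matrix (Fin d) (Virt G D i) ℂ
  injective_A : ∀ i, Function.Injective (A i).mulVec

/-- A partition of the edges of `G` into `k` (possibly empty) classes such that two
distinct edges in the same class do not share a vertex. -/
structure EdgePartition {N : ℕ} (G : SimpleGraph (Fin N)) (k : ℕ) where
  cls : G.edgeSet → Fin k
  disjoint : ∀ e f : G.edgeSet, e ≠ f → cls e = cls f → ∀ v, ¬ (v ∈ e.1 ∧ v ∈ f.1)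

variable {G d D}

namespace InjectivePEPS

variable (P : InjectivePEPS G d D)

/-- First end point of an edge. -/
def src (e : G.edgeSet) : Fin N := (P.orient e).fst

/-- Second end point of an edge. -/
def tgt (e : G.edgeSet) : Fin N := (P.orient e).snd

/-- The virtual qudit of the edge `e` at its first end point. -/
def srcBond (e : G.edgeSet) : G.neighborSet (P.src e) := ⟨P.tgt e, (P.orient e).adj⟩

/-- The virtual qudit of the edge `e` at its second end point. -/
def tgtBond (e : G.edgeSet) : G.neighborSet (P.tgt e) := ⟨P.src e, (P.orient e).adj.symm⟩

/-- The vector `(⨂_i A_i) ⨂_e |φ₀⟩_e`, not normalized. -/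
def vec : Conf N d → ℂ := fun x =>
  ∑ v : (∀ i, Virt G D i),
    (∏ i, P.A i (x i) (v i)) *
      ∏ e : G.edgeSet, P.φ₀ (v (P.src e) (P.srcBond e), v (P.tgt e) (P.tgtBond e))

/-- The state `|ψ⟩⟨ψ|` of the PEPS, with `|ψ⟩` normalized. -/
def state : Op N d := (star P.vec ⬝ᵥ P.vec)⁻¹ • Matrix.vecMulVec P.vec (star P.vec)

/-- All tensors are isometric up to `δ`: `‖A_i† A_i - I‖ ≤ δ`. -/
def NearIsometric (δ : ℝ) : Prop := ∀ i, opNorm ((P.A i)ᴴ * P.A i - 1) ≤ δ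

/-- The projector `P_{S_i}` onto the image `S_i` of `A_i`. -/
def siteProj (i : Fin N) : Matrix (Fin d) (Fin d) ℂ := imProj (P.A i)

/-- The single-site channel
`E_i(X) = P_{S_i} X P_{S_i} + (P_{S_i} / dim S_i) ⊗ Tr_i (P_{S_i}^⊥ X)`. -/
def siteChannel (i : Fin N) : SuperOp N d :=
  LinearMap.mulLeftRight ℂ (siteOp i (P.siteProj i), siteOp i (P.siteProj i)) +
    replaceSite i (((P.A i).rank : ℂ)⁻¹ • P.siteProj i) ∘ₗ
      LinearMap.mulLeft ℂ (siteOp i (1 - P.siteProj i))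

/-- The operator `M` on the two virtual qudits of the edge `e`, tensored with the identity on the
other virtual qudits at the end points of `e`. -/
def bondOp (e : G.edgeSet) (M : Matrix (Fin D × Fin D) (Fin D × Fin D) ℂ) :
    Matrix (Virt G D (P.src e) × Virt G D (P.tgt e))
      (Virt G D (P.src e) × Virt G D (P.tgt e)) ℂ :=
  fun u w =>
    if (∀ b, b ≠ P.srcBond e → u.1 b = w.1 b) ∧ (∀ b, b ≠ P.tgtBond e → u.2 b = w.2 b) then
      M (u.1 (P.srcBond e), u.2 (P.tgtBond e)) (w.1 (P.srcBond e), w.2 (P.tgtBond e))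
    else 0

/-- The jump operator `(A_i ⊗ A_j) |φ₀⟩⟨φ_α|_e (A_i⁻¹ ⊗ A_j⁻¹)` of the edge `e = (i, j)`, as an
operator on the two qudits `i, j`. -/
def jump (e : G.edgeSet) (α : Fin (D ^ 2 - 1)) :
    Matrix (Fin d × Fin d) (Fin d × Fin d) ℂ :=
  (P.A (P.src e) ⊗ₖ P.A (P.tgt e)) *
    P.bondOp e (Matrix.vecMulVec (P.φ₀ : Fin D × Fin D → ℂ) (star (P.φ α : Fin D × Fin D → ℂ))) *
    (pinv (P.A (P.src e)) ⊗ₖ pinv (P.A (P.tgt e)))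

/-- The effective Hamiltonian `½ ∑_α L_α† L_α` of an edge. -/
def Heff (e : G.edgeSet) : Matrix (Fin d × Fin d) (Fin d × Fin d) ℂ :=
  (1 / 2 : ℂ) • ∑ α, (P.jump e α)ᴴ * P.jump e α

/-- The Kraus operator `K_{0,e} = (I - 2Γ H_eff)^{1/2}`. -/
def kraus₀ (Γ : ℝ) (e : G.edgeSet) : Matrix (Fin d × Fin d) (Fin d × Fin d) ℂ :=
  CFC.sqrt (1 - (2 * Γ : ℂ) • P.Heff e)

/-- The Kraus operators `K_{α,e} = √Γ L_{α,e}` for `α ≠ 0`. -/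
def kraus (Γ : ℝ) (e : G.edgeSet) (α : Fin (D ^ 2 - 1)) :
    Matrix (Fin d × Fin d) (Fin d × Fin d) ℂ :=
  (Real.sqrt Γ : ℂ) • P.jump e α

/-- The superoperator `X ↦ K X K†` of a two-site operator `K` acting on the ends of `e`. -/
def sandwich (e : G.edgeSet) (K : Matrix (Fin d × Fin d) (Fin d × Fin d) ℂ) : SuperOp N d :=
  LinearMap.mulLeftRight ℂ (pairOp (P.src e) (P.tgt e) K, (pairOp (P.src e) (P.tgt e) K)ᴴ)

/-- The two-site channel `E_e` with Kraus operators `K_{0,e}, …, K_{D²-1,e}`. -/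
def edgeChannel (Γ : ℝ) (e : G.edgeSet) : SuperOp N d :=
  P.sandwich e (P.kraus₀ Γ e) + ∑ α, P.sandwich e (P.kraus Γ e α)

/-- The product of the channels `E_e` over the edges `e` in class `q`. The order is
irrelevant, since these edges are pairwise disjoint and so the factors commute. -/
def classChannel (Γ : ℝ) {k : ℕ} (c : EdgePartition G k) (q : Fin k) : SuperOp N d :=
  (((Finset.univ.filter fun e : G.edgeSet => c.cls e = q).toList).map (P.edgeChannel Γ)).prod

/-- The channel `E = ((1/k) ∑_q E_{class q}) ∘ ∏_i E_i`. The single-site channels commute. -/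
def channel (Γ : ℝ) {k : ℕ} (c : EdgePartition G k) : SuperOp N d :=
  ((k : ℂ)⁻¹ • ∑ q, P.classChannel Γ c q) * ((List.finRange N).map P.siteChannel).prod

/-- The superoperator `X ↦ Tr(X) |ψ⟩⟨ψ|`. -/
def target : SuperOp N d := (Matrix.traceLinearMap (Conf N d) ℂ ℂ).smulRight P.state

/-- The distance `‖E^T - Tr(·)|ψ⟩⟨ψ|‖_{1→1}` after `T` steps. -/
def mixingError (Γ : ℝ) {k : ℕ} (c : EdgePartition G k) (T : ℕ) : ℝ≥0∞ :=
  norm11 (P.channel Γ c ^ T - P.target)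

end InjectivePEPS

end PEPS

end Dissipative

end

/-!
Write `A_i = V_i q_i` for the polar decomposition, with `V_i` an isometry and
`q_i = (A_i† A_i)^{1/2}`. The single-site channels map every operator into the image of the isometry
`W = ⨂ V_i` and leave operators supported there unchanged, and the edge channels commute with the
embedding `σ ↦ W σ W†` (`edgeChannel_lift`). From the first step on the dynamics therefore takes
place on the virtual space (`channel_pow_succ`), where the jumps of an edge `e = (i, j)` are
`q_i q_j |φ₀⟩⟨φ_α|_e q_i⁻¹ q_j⁻¹`. Near isometry says that all `q_i` are `O(δ)`-close to `1`; for
`q_i = 1` the edge channels would commute and each would cool its own bond only.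

The Lyapunov function is the expectation of `H = ∑ h_e` with the bond energies `h_e = p Q_e p`,
where `p = q_i⁻¹ q_j⁻¹` and `Q_e` is the projector onto the complement of `|φ₀⟩` on the bond `e`.

* The channel of `e` multiplies `h_e` by at most `1 - Γ/2`: the jumps contribute nothing, as
  `h_e L_α = 0`, and to first order in `Γ` the no-jump part contributes minus `Γ/2` times the
  anticommutator of `h_e` with the jump rate (`BondJumps.krausDual_bondEnergy_le`).
* The channel of a neighbouring edge `f` raises `h_e` by at most `O(δΓ + Γ²)(h_e + h_f)`. To first
  order in `Γ`, gain and loss cancel at `q = 1`, and the remainder is an off-diagonal block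
  `Q_f Z Q_e` with `‖Z‖ = O(δ)` (`AdjacentBonds.krausDual_bondEnergy_le`). This is where the precise
  form of `h_e` matters: a remainder of order `δΓ` alone, not proportional to the energies, would
  not let the energy decay to zero.
* The channels of all other edges do not change `h_e` (`krausDual_energy_of_not_touches`).

An edge has at most `2 d₀` neighbours and belongs to one of the `k` classes, so for `δ d₀` small and
`Γ` comparable to `δ` the expectation of `H` contracts by `1 - Γ/(4k)` in each step
(`Admissible.excitation_vChannel_le`). The energies of neighbouring bonds have a nearly nonnegative
anticommutator (`anticommutator_touches_ge`) and those of other bonds commute, whence `H² ≥ H/2`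
(`smul_sum_le_sum_mul_sum`). The kernel of `H` is the line of the PEPS vector
(`exists_eq_smul_vVec`), so `1 - |ψ⟩⟨ψ| ≤ 2 H` (`one_sub_lineProj_vVec_le`) and the infidelity of
a state with `|ψ⟩` decays exponentially (`Admissible.infidelity_le`).

By Cauchy–Schwarz an infidelity `s²` gives the trace distance `O(s)`
(`norm_trace_mul_sub_lineProj_le`), and a general operator of trace norm `1` is reduced to positive
ones by polar decomposition and polarization (`norm11_le_of_posSemidef`).
-/

noncomputable section

set_option linter.unusedSectionVars false

namespace Dissipative

/-! ### Operator inequalities for one and two bonds -/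

section Defs

variable {A : Type*} [Ring A] [StarRing A] {κ : Type*} [Fintype κ]

/-- The map `x ↦ ∑ α, J_α† x J_α`. -/
def jumpDual (J : κ → A) (x : A) : A := ∑ α, star (J α) * x * J α

/-- The relations between the jumps `J_α = |φ₀⟩⟨φ_α|` of a bond and the projector
`Q = ∑_α |φ_α⟩⟨φ_α|`. -/
structure BondJumps (J : κ → A) (Q : A) : Prop where
  isSelfAdjoint : IsSelfAdjoint Q
  idem : Q * Q = Q
  sum_star_mul : ∑ α, star (J α) * J α = Q
  proj_mul (α : κ) : Q * J α = 0
  mul_proj (α : κ) : J α * Q = J α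

/-- The deformed jumps `q J_α p`. -/
def conjJump (q p : A) (J : κ → A) (α : κ) : A := q * J α * p

/-- The total jump rate `∑_α L_α† L_α` of the deformed jumps `L_α = q J_α p`. -/
def jumpRate (q p : A) (J : κ → A) : A :=
  ∑ α, star (conjJump q p J α) * conjJump q p J α

/-- The energy `p Q p` of a bond. For invertible `p` its kernel is that of `Q p`, the common kernel
of the deformed jumps. -/
def bondEnergy (p Q : A) : A := p * Q * p

end Defs

section CStar

variable {A : Type*} [CStarAlgebra A] [PartialOrder A] [StarOrderedRing A]

theorem smul_le_smul_real {r : ℝ} (hr : 0 ≤ r) {a b : A} (h : a ≤ b) : r • a ≤ r • b :=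
  smul_le_smul_of_nonneg_left h hr

theorem smul_le_smul_coeff {r s : ℝ} (hrs : r ≤ s) {a : A} (h : 0 ≤ a) : r • a ≤ s • a :=
  smul_le_smul_of_nonneg_right hrs h

theorem star_mul_add_star_mul_le (x y : A) :
    star x * y + star y * x ≤ star x * x + star y * y := by
  have h := star_mul_self_nonneg (x - y)
  have e : star (x - y) * (x - y) = star x * x + star y * y - (star x * y + star y * x) := by
    rw [star_sub]; noncomm_ring
  rw [e] at h
  exact sub_nonneg.1 h

theorem star_conj {P : A} (hP : IsSelfAdjoint P) (x : A) : star (P * x * P) = P * star x * P := by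
  rw [star_mul, star_mul, hP.star_eq, mul_assoc]

theorem abs_le_of_norm_le {a : A} {r : ℝ} (ha : IsSelfAdjoint a) (h : ‖a‖ ≤ r) :
    a ≤ r • (1 : A) ∧ -(r • (1 : A)) ≤ a := by
  have h1 := IsSelfAdjoint.le_algebraMap_norm_self ha
  have h2 := IsSelfAdjoint.neg_algebraMap_norm_le_self ha
  rw [Algebra.algebraMap_eq_smul_one] at h1 h2
  have h3 : ‖a‖ • (1 : A) ≤ r • (1 : A) := smul_le_smul_coeff h zero_le_one
  exact ⟨h1.trans h3, (neg_le_neg h3).trans h2⟩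

theorem norm_le_of_abs_le {a : A} {r : ℝ} (ha : IsSelfAdjoint a) (hr : 0 ≤ r)
    (h1 : a ≤ r • (1 : A)) (h2 : -(r • (1 : A)) ≤ a) : ‖a‖ ≤ r := by
  rcases subsingleton_or_nontrivial A with hA | hA
  · rw [Subsingleton.elim a 0, norm_zero]; exact hr
  rw [← Algebra.algebraMap_eq_smul_one] at h1 h2
  rw [← map_neg] at h2
  rw [le_algebraMap_iff_spectrum_le] at h1
  rw [algebraMap_le_iff_le_spectrum] at h2
  rcases CStarAlgebra.norm_or_neg_norm_mem_spectrum (ha := ha) with h | h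
  · exact h1 _ h
  · have := h2 _ h; linarith

theorem star_mul_self_le_smul {Z : A} {ε : ℝ} (hZ : ‖Z‖ ≤ ε) :
    star Z * Z ≤ (ε ^ 2) • (1 : A) := by
  have h := CStarAlgebra.star_mul_le_algebraMap_norm_sq (a := Z)
  rw [Algebra.algebraMap_eq_smul_one] at h
  exact h.trans (smul_le_smul_coeff (by gcongr) zero_le_one)

/-- Arithmetic–geometric mean bound for an off-diagonal block `a Z b`. -/
theorem cross_le {a b Z : A} {ε : ℝ} (hε : 0 < ε) (hZ : ‖Z‖ ≤ ε) (ha : IsSelfAdjoint a)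
    (hb : IsSelfAdjoint b) :
    a * Z * b + b * star Z * a ≤ ε • (a * a + b * b) := by
  have h := star_mul_add_star_mul_le (Real.sqrt ε • a) ((Real.sqrt ε)⁻¹ • (Z * b))
  have hs : Real.sqrt ε ≠ 0 := (Real.sqrt_pos.2 hε).ne'
  have hss : Real.sqrt ε * Real.sqrt ε = ε := Real.mul_self_sqrt hε.le
  simp only [star_smul, star_mul, ha.star_eq, hb.star_eq, star_trivial, smul_mul_assoc,
    mul_smul_comm, smul_smul, mul_inv_cancel₀ hs, inv_mul_cancel₀ hs, one_smul, hss] at h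
  rw [← mul_inv, hss] at h
  have h2 : b * star Z * (Z * b) ≤ (ε ^ 2) • (b * b) := by
    have := hb.conjugate_le_conjugate (star_mul_self_le_smul hZ)
    simpa [mul_assoc] using this
  have h3 : ε⁻¹ • (b * star Z * (Z * b)) ≤ ε • (b * b) := by
    refine (smul_le_smul_real (inv_nonneg.2 hε.le) h2).trans (le_of_eq ?_)
    rw [smul_smul]; congr 1; field_simp
  rw [smul_add]
  calc a * Z * b + b * star Z * a = a * (Z * b) + b * star Z * a := by rw [mul_assoc]
    _ ≤ _ := h
    _ ≤ _ := by gcongr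

theorem neg_cross_le {a b Z : A} {ε : ℝ} (hε : 0 < ε) (hZ : ‖Z‖ ≤ ε) (ha : IsSelfAdjoint a)
    (hb : IsSelfAdjoint b) :
    -(ε • (a * a + b * b)) ≤ a * Z * b + b * star Z * a := by
  have h := cross_le (Z := -Z) hε (by rwa [norm_neg]) ha hb
  rw [neg_le]
  refine le_trans (le_of_eq ?_) h
  rw [star_neg]; noncomm_ring

theorem mul_self_le_smul {a : A} {c : ℝ} (ha : 0 ≤ a) (h : a ≤ c • (1 : A)) :
    a * a ≤ c • a := by
  have h1 : CFC.sqrt a * a * CFC.sqrt a ≤ CFC.sqrt a * (c • (1 : A)) * CFC.sqrt a :=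
    (IsSelfAdjoint.of_nonneg (CFC.sqrt_nonneg a)).conjugate_le_conjugate h
  have e := CFC.sqrt_mul_sqrt_self a
  have e1 : CFC.sqrt a * a * CFC.sqrt a = a * a := by
    calc CFC.sqrt a * a * CFC.sqrt a
        = CFC.sqrt a * (CFC.sqrt a * CFC.sqrt a) * CFC.sqrt a := by rw [e]
      _ = (CFC.sqrt a * CFC.sqrt a) * (CFC.sqrt a * CFC.sqrt a) := by simp only [mul_assoc]
      _ = a * a := by rw [e]
  rw [e1, mul_smul_comm, mul_one, smul_mul_assoc, e] at h1
  exact h1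

/-- Second-order expansion of the no-jump part `k h k` of a channel, where `k = √(1 - Γ n)`. The
error is bounded by `h` and `n` themselves rather than by a multiple of `1`. -/
theorem no_jump_le {h n k : A} {Γ : ℝ} (hΓ : 0 < Γ) (h0 : 0 ≤ h) (h2 : h ≤ (2 : ℝ) • (1 : A))
    (n0 : 0 ≤ n) (n2 : n ≤ (2 : ℝ) • (1 : A)) (k0 : 0 ≤ k) (kk : k * k = 1 - Γ • n) :
    k * h * k ≤ h - (Γ / 2) • (n * h + h * n) + Γ ^ 2 • ((2 : ℝ) • h + (6 : ℝ) • n) := by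
  have hk : IsSelfAdjoint k := .of_nonneg k0
  have hh : IsSelfAdjoint h := .of_nonneg h0
  set b : A := 1 - k with hb
  have bsa : IsSelfAdjoint b := (IsSelfAdjoint.one A).sub hk
  have hn : Γ • n = 1 - k * k := by rw [kk]; abel
  have hbb : b * b ≤ (2 * Γ ^ 2) • n := by
    -- With `b = 1 - k` one has `Γ n = b (1 + k) = (1 + k) b`, whence `b² ≤ (Γ n)²`.
    have e : (Γ • n) * (Γ • n) = b * b + b * (2 • k + k * k) * b := by
      rw [hn, hb]; noncomm_ring
    have p : 0 ≤ b * (2 • k + k * k) * b := by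
      apply bsa.conjugate_nonneg
      exact add_nonneg (nsmul_nonneg k0 _) hk.mul_self_nonneg
    calc b * b ≤ (Γ • n) * (Γ • n) := by rw [e]; exact le_add_of_nonneg_right p
      _ = Γ ^ 2 • (n * n) := by rw [smul_mul_smul_comm, sq]
      _ ≤ Γ ^ 2 • ((2 : ℝ) • n) := smul_le_smul_real (by positivity) (mul_self_le_smul n0 n2)
      _ = _ := by rw [smul_smul, mul_comm]
  have hbhb : ∀ {x : A}, x ≤ (2 : ℝ) • (1 : A) → b * x * b ≤ (2 : ℝ) • (b * b) := by
    intro x hx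
    have := bsa.conjugate_le_conjugate hx
    simpa using this
  -- `R` is the remainder of the expansion `k = 1 - Γ n / 2 - R`.
  set R : A := 1 - (Γ / 2) • n - k with hR
  have hRb : R = (1 / 2 : ℝ) • (b * b) := by
    have : (Γ / 2) • n = (1 / 2 : ℝ) • (1 - k * k) := by
      rw [← hn, smul_smul]; congr 1; ring
    have e : b * b = 1 - (2 : ℝ) • k + k * k := by rw [hb, two_smul]; noncomm_ring
    rw [hR, this, e]
    module
  have Rsa : IsSelfAdjoint R := by
    rw [hRb]; exact IsSelfAdjoint.smul (by simp [IsSelfAdjoint]) bsa.mul_self_nonneg.isSelfAdjoint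
  have hRR : R * R ≤ (2 * Γ ^ 4) • n := by
    have e : R * R = (1 / 4 : ℝ) • (b * (b * b) * b) := by
      rw [hRb, smul_mul_smul_comm, ← mul_assoc, ← mul_assoc]; norm_num
    have h1 : b * (b * b) * b ≤ (2 * Γ ^ 2) • (b * n * b) := by
      have := bsa.conjugate_le_conjugate hbb
      simpa using this
    rw [e]
    calc (1 / 4 : ℝ) • (b * (b * b) * b)
        ≤ (1 / 4 : ℝ) • ((2 * Γ ^ 2) • ((2 : ℝ) • ((2 * Γ ^ 2) • n))) := by
          refine smul_le_smul_real (by norm_num) (h1.trans ?_)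
          refine smul_le_smul_real (by positivity) ((hbhb n2).trans ?_)
          exact smul_le_smul_real (by norm_num) hbb
      _ = _ := by simp only [smul_smul]; congr 1; ring
  have hRh : -(R * h + h * R) ≤ (2 * Γ ^ 2) • n + (2 * Γ ^ 2) • h := by
    have h1 := star_mul_add_star_mul_le (-(Γ⁻¹ • R)) (Γ • h)
    simp only [star_neg, star_smul, star_trivial, Rsa.star_eq, hh.star_eq, neg_mul, mul_neg,
      smul_mul_smul_comm, inv_mul_cancel₀ hΓ.ne', mul_inv_cancel₀ hΓ.ne', one_smul, neg_neg] at h1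
    have h3 : h * h ≤ (2 : ℝ) • h := mul_self_le_smul h0 h2
    calc -(R * h + h * R) = -(R * h) + -(h * R) := by rw [neg_add]
      _ ≤ _ := h1
      _ ≤ (Γ⁻¹ * Γ⁻¹) • ((2 * Γ ^ 4) • n) + (Γ * Γ) • ((2 : ℝ) • h) :=
        add_le_add (smul_le_smul_real (by positivity) hRR)
          (smul_le_smul_real (by positivity) h3)
      _ = _ := by
        simp only [smul_smul]; congr 2 <;> field_simp
  have hbhb' : b * h * b ≤ (4 * Γ ^ 2) • n := by
    refine (hbhb h2).trans ((smul_le_smul_real (by norm_num) hbb).trans (le_of_eq ?_))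
    rw [smul_smul]; congr 1; ring
  have e : k * h * k = h - (((Γ / 2) • n) * h + h * ((Γ / 2) • n)) + (-(R * h + h * R)) +
      b * h * b := by
    rw [hR, hb]; noncomm_ring
  rw [e, smul_mul_assoc, mul_smul_comm, ← smul_add]
  calc _ ≤ h - (Γ / 2) • (n * h + h * n) + ((2 * Γ ^ 2) • n + (2 * Γ ^ 2) • h) +
        (4 * Γ ^ 2) • n := by gcongr
    _ = _ := by module

variable {κ : Type*} [Fintype κ]

theorem jumpDual_mono (J : κ → A) {x y : A} (h : x ≤ y) : jumpDual J x ≤ jumpDual J y :=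
  Finset.sum_le_sum fun α _ => star_left_conjugate_le_conjugate h (J α)

theorem jumpDual_sub (J : κ → A) (x y : A) :
    jumpDual J (x - y) = jumpDual J x - jumpDual J y := by
  simp [jumpDual, mul_sub, sub_mul, Finset.sum_sub_distrib]

theorem jumpDual_neg (J : κ → A) (x : A) : jumpDual J (-x) = -jumpDual J x := by
  simp [jumpDual]

theorem jumpDual_smul (J : κ → A) (r : ℝ) (x : A) : jumpDual J (r • x) = r • jumpDual J x := by
  simp [jumpDual, Finset.smul_sum]

theorem jumpDual_star (J : κ → A) (x : A) : star (jumpDual J x) = jumpDual J (star x) := by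
  simp [jumpDual, mul_assoc]

theorem norm_jumpDual_le {J : κ → A} (hJ : jumpDual J 1 ≤ 1) {x : A} (hx : IsSelfAdjoint x)
    {r : ℝ} (h : ‖x‖ ≤ r) : ‖jumpDual J x‖ ≤ r := by
  have hr : 0 ≤ r := (norm_nonneg x).trans h
  obtain ⟨h1, h2⟩ := abs_le_of_norm_le hx h
  have h3 : r • jumpDual J 1 ≤ r • (1 : A) := smul_le_smul_real hr hJ
  apply norm_le_of_abs_le _ hr
  · refine (jumpDual_mono J h1).trans ?_
    rwa [jumpDual_smul]
  · refine le_trans ?_ (jumpDual_mono J h2)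
    rw [jumpDual_neg, jumpDual_smul]
    exact neg_le_neg h3
  · rw [IsSelfAdjoint, jumpDual_star, hx.star_eq]

theorem projection_le_one {Q : A} (hQ : IsSelfAdjoint Q) (hQQ : Q * Q = Q) : Q ≤ 1 := by
  have h : 0 ≤ star (1 - Q) * (1 - Q) := star_mul_self_nonneg _
  have e : star (1 - Q) * (1 - Q) = 1 - Q := by
    rw [star_sub, star_one, hQ.star_eq, mul_sub, sub_mul, sub_mul, hQQ]; simp
  rw [e] at h
  exact sub_nonneg.1 h

theorem projection_nonneg {Q : A} (hQ : IsSelfAdjoint Q) (hQQ : Q * Q = Q) : 0 ≤ Q := by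
  rw [← hQQ]; exact hQ.mul_self_nonneg

/-- `q` is self-adjoint with inverse `p`, and the squares of both are within `ε` of `1`. -/
structure NearOne (q p : A) (ε : ℝ) : Prop where
  left_sa : IsSelfAdjoint q
  right_sa : IsSelfAdjoint p
  mul_inv : q * p = 1
  inv_mul : p * q = 1
  norm_sq_sub_one : ‖q * q - 1‖ ≤ ε
  norm_inv_sq_sub_one : ‖p * p - 1‖ ≤ ε

namespace NearOne

variable {q p q' p' : A} {ε : ℝ}

theorem inv_sq_le (h : NearOne q p ε) : p * p ≤ (1 + ε) • (1 : A) := by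
  have h1 := (abs_le_of_norm_le
    (h.right_sa.mul_self_nonneg.isSelfAdjoint.sub (IsSelfAdjoint.one A))
    h.norm_inv_sq_sub_one).1
  rw [add_smul, one_smul, add_comm]
  exact sub_le_iff_le_add.1 h1

theorem le_inv_sq (h : NearOne q p ε) : (1 - ε) • (1 : A) ≤ p * p := by
  have h1 := (abs_le_of_norm_le
    (h.right_sa.mul_self_nonneg.isSelfAdjoint.sub (IsSelfAdjoint.one A))
    h.norm_inv_sq_sub_one).2
  rw [sub_smul, one_smul]
  have := add_le_add_left h1 1
  simpa [sub_eq_add_neg, add_comm] using this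

theorem symm (h : NearOne q p ε) : NearOne p q ε :=
  ⟨h.right_sa, h.left_sa, h.inv_mul, h.mul_inv, h.norm_inv_sq_sub_one, h.norm_sq_sub_one⟩

theorem norm_sq_le [Nontrivial A] (h : NearOne q p ε) : ‖q * q‖ ≤ 1 + ε := by
  have := norm_le_norm_add_norm_sub' (q * q) 1
  have h1 := h.norm_sq_sub_one
  rw [CStarRing.norm_one] at this
  linarith

theorem mul [Nontrivial A] (h : NearOne q p ε) (h' : NearOne q' p' ε) (hε : ε ≤ 1)
    (hq : Commute q q') (hp : Commute p p') :
    NearOne (q * q') (p * p') (3 * ε) := by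
  have key : ∀ {a b : A}, Commute a b → ‖a * a - 1‖ ≤ ε → ‖b * b - 1‖ ≤ ε →
      ‖a * a‖ ≤ 1 + ε → ‖a * b * (a * b) - 1‖ ≤ 3 * ε := by
    intro a b hab ha hb ha'
    have e : a * b * (a * b) - 1 = (a * a) * (b * b - 1) + (a * a - 1) := by
      rw [hab.symm.mul_mul_mul_comm]; noncomm_ring
    have hε0 : 0 ≤ ε := (norm_nonneg _).trans ha
    calc ‖a * b * (a * b) - 1‖ ≤ ‖a * a‖ * ‖b * b - 1‖ + ‖a * a - 1‖ := by
          rw [e]; exact (norm_add_le _ _).trans (by gcongr; exact norm_mul_le _ _)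
      _ ≤ (1 + ε) * ε + ε := by gcongr
      _ ≤ 3 * ε := by nlinarith
  refine ⟨?_, ?_, ?_, ?_, ?_, ?_⟩
  · exact (IsSelfAdjoint.commute_iff h.left_sa h'.left_sa).1 hq
  · exact (IsSelfAdjoint.commute_iff h.right_sa h'.right_sa).1 hp
  · rw [hp.eq, mul_assoc, ← mul_assoc q', h'.mul_inv, one_mul, h.mul_inv]
  · rw [hq.eq, mul_assoc, ← mul_assoc p', h'.inv_mul, one_mul, h.inv_mul]
  · exact key hq h.norm_sq_sub_one h'.norm_sq_sub_one h.norm_sq_le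
  · exact key hp h.norm_inv_sq_sub_one h'.norm_inv_sq_sub_one h.symm.norm_sq_le

end NearOne

/-- The action on observables of the channel with Kraus operators `k` and `√Γ L_α`. -/
def krausDual (Γ : ℝ) (k : A) (L : κ → A) (x : A) : A := k * x * k + Γ • jumpDual L x

namespace BondJumps

variable {J : κ → A} {Q q p : A} {ε Γ : ℝ}

theorem jumpDual_one (B : BondJumps J Q) : jumpDual J 1 = Q := by
  simp [jumpDual, B.sum_star_mul]

theorem jumpDual_one_le (B : BondJumps J Q) : jumpDual J 1 ≤ 1 := by
  rw [B.jumpDual_one]; exact projection_le_one B.isSelfAdjoint B.idem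

theorem proj_mul_star (B : BondJumps J Q) (α : κ) : Q * star (J α) = star (J α) := by
  have := congrArg star (B.mul_proj α)
  rwa [star_mul, B.isSelfAdjoint.star_eq] at this

theorem proj_mul_jumpDual (B : BondJumps J Q) (x : A) : Q * jumpDual J x = jumpDual J x := by
  simp only [jumpDual, Finset.mul_sum, ← mul_assoc, B.proj_mul_star]

theorem jumpDual_mul_proj (B : BondJumps J Q) (x : A) : jumpDual J x * Q = jumpDual J x := by
  simp only [jumpDual, Finset.sum_mul, mul_assoc, B.mul_proj]

theorem jumpRate_eq (N : NearOne q p ε) : jumpRate q p J = p * jumpDual J (q * q) * p := by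
  simp only [jumpRate, conjJump, jumpDual, Finset.mul_sum, Finset.sum_mul, star_mul,
    N.left_sa.star_eq, N.right_sa.star_eq, mul_assoc]

theorem bondEnergy_nonneg (B : BondJumps J Q) (N : NearOne q p ε) : 0 ≤ bondEnergy p Q :=
  N.right_sa.conjugate_nonneg (projection_nonneg B.isSelfAdjoint B.idem)

theorem jumpRate_nonneg : 0 ≤ jumpRate q p J :=
  Finset.sum_nonneg fun _ _ => star_mul_self_nonneg _

theorem bondEnergy_le (B : BondJumps J Q) (N : NearOne q p ε) :
    bondEnergy p Q ≤ (1 + ε) • (1 : A) := by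
  have := N.right_sa.conjugate_le_conjugate (projection_le_one B.isSelfAdjoint B.idem)
  rw [mul_one] at this
  exact this.trans N.inv_sq_le

theorem jumpRate_le (B : BondJumps J Q) (N : NearOne q p ε) :
    jumpRate q p J ≤ (1 + ε) • bondEnergy p Q := by
  rw [jumpRate_eq N, bondEnergy]
  have h := N.right_sa.conjugate_le_conjugate (jumpDual_mono J N.symm.inv_sq_le)
  rwa [jumpDual_smul, B.jumpDual_one, mul_smul_comm, smul_mul_assoc] at h

theorem bondEnergy_le_two (B : BondJumps J Q) (N : NearOne q p ε) (hε : ε ≤ 1 / 4) :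
    bondEnergy p Q ≤ (2 : ℝ) • (1 : A) :=
  (B.bondEnergy_le N).trans (smul_le_smul_coeff (by linarith) zero_le_one)

theorem jumpRate_le_two (B : BondJumps J Q) (N : NearOne q p ε) (hε0 : 0 ≤ ε) (hε : ε ≤ 1 / 4) :
    jumpRate q p J ≤ (2 : ℝ) • (1 : A) := by
  refine (B.jumpRate_le N).trans
    ((smul_le_smul_real (by linarith) (B.bondEnergy_le N)).trans ?_)
  rw [smul_smul]
  exact smul_le_smul_coeff (by nlinarith) zero_le_one

theorem jumpDual_conjJump_bondEnergy (B : BondJumps J Q) (N : NearOne q p ε) :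
    jumpDual (conjJump q p J) (bondEnergy p Q) = 0 := by
  refine Finset.sum_eq_zero fun α _ => ?_
  have : bondEnergy p Q * conjJump q p J α = 0 := by
    calc p * Q * p * (q * J α * p) = p * (Q * ((p * q) * J α)) * p := by noncomm_ring
      _ = 0 := by rw [N.inv_mul, one_mul, B.proj_mul, mul_zero, zero_mul]
  rw [mul_assoc, this, mul_zero]

theorem le_bondEnergy_sq (B : BondJumps J Q) (N : NearOne q p ε) :
    (1 - ε) • bondEnergy p Q ≤ bondEnergy p Q * bondEnergy p Q := by
  have h := B.isSelfAdjoint.conjugate_le_conjugate N.le_inv_sq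
  have h' := N.right_sa.conjugate_le_conjugate h
  rw [mul_smul_comm, smul_mul_assoc, mul_one, B.idem, mul_smul_comm, smul_mul_assoc] at h'
  refine h'.trans (le_of_eq ?_)
  simp only [bondEnergy, mul_assoc]

/-- The anticommutator of the energy with the jump rate is `p (2 Q + Q Y Q + Q Y† Q) p` with `‖Y‖ ≤
3 ε`; the factors `Q` around `Y` make the error a multiple of the energy. -/
theorem le_anticommutator (B : BondJumps J Q) (N : NearOne q p ε) (hε0 : 0 < ε) (hε : ε ≤ 1 / 4) :
    (2 - 6 * ε) • bondEnergy p Q ≤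
      jumpRate q p J * bondEnergy p Q + bondEnergy p Q * jumpRate q p J := by
  have hqq : IsSelfAdjoint (q * q - 1) :=
    N.left_sa.mul_self_nonneg.isSelfAdjoint.sub (IsSelfAdjoint.one A)
  set T := jumpDual J (q * q - 1) with hT
  have hΘ : jumpDual J (q * q) = Q + T := by rw [hT, jumpDual_sub, B.jumpDual_one]; abel
  have hTn : ‖T‖ ≤ ε := norm_jumpDual_le B.jumpDual_one_le hqq N.norm_sq_sub_one
  have QT : Q * T = T := B.proj_mul_jumpDual _
  have TQ : T * Q = T := B.jumpDual_mul_proj _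
  have Tsa : star T = T := by rw [hT, jumpDual_star, hqq.star_eq]
  have hpp : star (p * p) = p * p := by rw [star_mul, N.right_sa.star_eq]
  -- The jump rate is `p (Q + T) p`, so that its product with `p Q p` is `p (Q + Q Y Q) p`.
  set Y := (p * p - 1) + T * (p * p) with hY
  have hYn : ‖Y‖ ≤ 3 * ε := by
    have h1 : ‖T * (p * p)‖ ≤ ε * (1 + ε) := by
      have : T * (p * p) = T * (p * p - 1) + T := by noncomm_ring
      rw [this]
      calc _ ≤ ‖T‖ * ‖p * p - 1‖ + ‖T‖ := (norm_add_le _ _).trans (by gcongr; exact norm_mul_le _ _)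
        _ ≤ ε * ε + ε := by gcongr; exact N.norm_inv_sq_sub_one
        _ = _ := by ring
    have := norm_add_le (p * p - 1) (T * (p * p))
    have := N.norm_inv_sq_sub_one
    nlinarith
  have h := neg_cross_le (by positivity) hYn B.isSelfAdjoint B.isSelfAdjoint
  have hp := N.right_sa.conjugate_le_conjugate h
  have e1 : jumpRate q p J * bondEnergy p Q = p * (Q + Q * Y * Q) * p := by
    rw [jumpRate_eq N, hΘ, bondEnergy, hY]
    have : p * (Q + T) * p * (p * Q * p) = p * (Q * (p * p) * Q + T * (p * p) * Q) * p := by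
      noncomm_ring
    rw [this]
    congr 2
    have : Q * (p * p - 1 + T * (p * p)) * Q = Q * (p * p) * Q - Q * Q + Q * T * (p * p) * Q := by
      noncomm_ring
    rw [this, B.idem, QT]; abel
  have e2 : bondEnergy p Q * jumpRate q p J = p * (Q + Q * star Y * Q) * p := by
    have := congrArg star e1
    have hn : star (jumpRate q p J) = jumpRate q p J :=
      (jumpRate_nonneg (q := q) (p := p) (J := J)).isSelfAdjoint.star_eq
    simpa only [star_mul, star_add, N.right_sa.star_eq, B.isSelfAdjoint.star_eq,
      (B.bondEnergy_nonneg N).isSelfAdjoint.star_eq, hn, mul_assoc] using this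
  have e3 : jumpRate q p J * bondEnergy p Q + bondEnergy p Q * jumpRate q p J
      = (2 : ℝ) • bondEnergy p Q + p * (Q * Y * Q + Q * star Y * Q) * p := by
    rw [e1, e2, bondEnergy, two_smul]; noncomm_ring
  rw [e3]
  have e4 : p * -((3 * ε) • (Q * Q + Q * Q)) * p = -((6 * ε) • bondEnergy p Q) := by
    rw [B.idem, ← two_smul ℝ Q, smul_smul, mul_neg, neg_mul, mul_smul_comm, smul_mul_assoc,
      bondEnergy]
    congr 2; ring
  rw [e4] at hp
  calc (2 - 6 * ε) • bondEnergy p Q = (2 : ℝ) • bondEnergy p Q + -((6 * ε) • bondEnergy p Q) := by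
        module
    _ ≤ _ := by gcongr

/-- A bond channel lowers the energy of its own bond: the jumps contribute nothing, and the
anticommutator with the jump rate in the no-jump part is at least `2 - 6 ε` times the energy. -/
theorem krausDual_bondEnergy_le (B : BondJumps J Q) (N : NearOne q p ε) (hε0 : 0 < ε)
    (hε : ε ≤ 1 / 12) (hΓ : 0 < Γ) (hΓ' : Γ ≤ 1 / 40) {k : A} (k0 : 0 ≤ k)
    (kk : k * k = 1 - Γ • jumpRate q p J) :
    krausDual Γ k (conjJump q p J) (bondEnergy p Q) ≤ (1 - Γ / 2) • bondEnergy p Q := by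
  have h0 := B.bondEnergy_nonneg N
  have h1 := no_jump_le hΓ h0 (B.bondEnergy_le_two N (by linarith)) jumpRate_nonneg
    (B.jumpRate_le_two N hε0.le (by linarith)) k0 kk
  have h2 := B.le_anticommutator N hε0 (by linarith)
  have h3 := B.jumpRate_le N
  rw [krausDual, B.jumpDual_conjJump_bondEnergy N, smul_zero, add_zero]
  set h := bondEnergy p Q
  set n := jumpRate q p J
  calc k * h * k ≤ h - (Γ / 2) • (n * h + h * n) + Γ ^ 2 • ((2 : ℝ) • h + (6 : ℝ) • n) := h1
    _ ≤ h - (Γ / 2) • ((2 - 6 * ε) • h) + Γ ^ 2 • ((2 : ℝ) • h + (6 : ℝ) • ((1 + ε) • h)) := by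
        have a1 := smul_le_smul_real (r := Γ / 2) (by positivity) h2
        have a2 := smul_le_smul_real (r := (6 : ℝ)) (by positivity) h3
        have a3 := smul_le_smul_real (r := Γ ^ 2) (by positivity)
          (add_le_add_right a2 ((2 : ℝ) • h))
        exact add_le_add (sub_le_sub_left a1 _) a3
    _ = (1 - Γ + 3 * ε * Γ + Γ ^ 2 * (8 + 6 * ε)) • h := by module
    _ ≤ (1 - Γ / 2) • h := smul_le_smul_coeff (by nlinarith) h0

end BondJumps

/-- Two distinct bonds `e = (i, j)` and `f = (j, l)` with the common end point `j`. The jumps of `f`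
are `J`, with projector `Q`; the projector of `e` is `Q'`. -/
structure AdjacentBonds (J : κ → A) (Q Q' qi pi qj pj ql pl : A) (ε : ℝ) : Prop where
  jumps : BondJumps J Q
  proj_sa : IsSelfAdjoint Q'
  proj_idem : Q' * Q' = Q'
  site_i : NearOne qi pi ε
  site_j : NearOne qj pj ε
  site_l : NearOne ql pl ε
  comm_pi_pj : Commute pi pj
  comm_pi_pl : Commute pi pl
  comm_pj_pl : Commute pj pl
  comm_pi_qj : Commute pi qj
  comm_pi_ql : Commute pi ql
  comm_qj_ql : Commute qj ql
  comm_jump_pi (α : κ) : Commute (J α) pi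
  comm_jump_proj (α : κ) : Commute (J α) Q'
  comm_proj_pl : Commute Q' pl
  comm_proj_ql : Commute Q' ql

namespace AdjacentBonds

variable {J : κ → A} {Q Q' qi pi qj pj ql pl : A} {ε Γ : ℝ}

theorem star_jump_comm_of_sa {J : κ → A} {x : A} (hx : IsSelfAdjoint x)
    (h : ∀ α, Commute (J α) x) (α : κ) : Commute (star (J α)) x := by
  have := (h α).star_star
  rwa [hx.star_eq] at this

theorem comm_proj_pi (S : AdjacentBonds J Q Q' qi pi qj pj ql pl ε) : Commute Q pi := by
  rw [← S.jumps.sum_star_mul]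
  exact Commute.sum_left _ _ _ fun α _ =>
    (star_jump_comm_of_sa S.site_i.right_sa S.comm_jump_pi α).mul_left (S.comm_jump_pi α)

theorem comm_proj_proj (S : AdjacentBonds J Q Q' qi pi qj pj ql pl ε) : Commute Q Q' := by
  rw [← S.jumps.sum_star_mul]
  exact Commute.sum_left _ _ _ fun α _ =>
    (star_jump_comm_of_sa S.proj_sa S.comm_jump_proj α).mul_left (S.comm_jump_proj α)

theorem comm_jumpDual {x y : A} (hy : IsSelfAdjoint y) (hJ : ∀ α, Commute (J α) y)
    (hxy : Commute x y) : Commute (jumpDual J x) y :=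
  Commute.sum_left _ _ _ fun α _ =>
    ((star_jump_comm_of_sa hy hJ α).mul_left hxy).mul_left (hJ α)

/-- The energy of `e`, conjugated also with the factor `pl` that does not belong to `e`. -/
theorem conj_proj_left_le (S : AdjacentBonds J Q Q' qi pi qj pj ql pl ε) :
    (pi * pj * pl) * Q' * (pi * pj * pl) ≤ (1 + ε) • bondEnergy (pi * pj) Q' := by
  have sa : IsSelfAdjoint (pi * pj) :=
    (IsSelfAdjoint.commute_iff S.site_i.right_sa S.site_j.right_sa).1 S.comm_pi_pj
  have h := sa.conjugate_le_conjugate (S.proj_sa.conjugate_le_conjugate S.site_l.inv_sq_le)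
  rw [mul_smul_comm, mul_one, smul_mul_assoc, S.proj_idem, mul_smul_comm, smul_mul_assoc] at h
  refine le_trans (le_of_eq ?_) h
  have c : Commute pl (pi * pj) := S.comm_pi_pl.symm.mul_right S.comm_pj_pl.symm
  calc (pi * pj * pl) * Q' * (pi * pj * pl)
      = (pi * pj) * (pl * (Q' * Q')) * (pl * (pi * pj)) := by
        rw [S.proj_idem, c.eq]; noncomm_ring
    _ = (pi * pj) * (pl * Q' * (Q' * pl)) * (pi * pj) := by noncomm_ring
    _ = (pi * pj) * (Q' * (pl * pl) * Q') * (pi * pj) := by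
      rw [← S.comm_proj_pl.eq]; nth_rw 2 [S.comm_proj_pl.eq]; noncomm_ring

/-- The energy of `f`, conjugated also with the factor `pi` that does not belong to `f`. -/
theorem conj_proj_right_le (S : AdjacentBonds J Q Q' qi pi qj pj ql pl ε) :
    (pi * pj * pl) * Q * (pi * pj * pl) ≤ (1 + ε) • bondEnergy (pj * pl) Q := by
  have sa : IsSelfAdjoint (pj * pl) :=
    (IsSelfAdjoint.commute_iff S.site_j.right_sa S.site_l.right_sa).1 S.comm_pj_pl
  have h := sa.conjugate_le_conjugate
    (S.jumps.isSelfAdjoint.conjugate_le_conjugate S.site_i.inv_sq_le)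
  rw [mul_smul_comm, mul_one, smul_mul_assoc, S.jumps.idem, mul_smul_comm, smul_mul_assoc] at h
  refine le_trans (le_of_eq ?_) h
  have c : Commute pi (pj * pl) := S.comm_pi_pj.mul_right S.comm_pi_pl
  calc (pi * pj * pl) * Q * (pi * pj * pl)
      = (pi * (pj * pl)) * (Q * Q) * (pi * (pj * pl)) := by
        rw [S.jumps.idem]; noncomm_ring
    _ = ((pj * pl) * pi) * (Q * Q) * (pi * (pj * pl)) := by rw [c.eq]
    _ = (pj * pl) * (pi * Q * (Q * pi)) * (pj * pl) := by noncomm_ring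
    _ = (pj * pl) * (Q * (pi * pi) * Q) * (pj * pl) := by
      rw [← S.comm_proj_pi.eq]; nth_rw 2 [S.comm_proj_pi.eq]; noncomm_ring

theorem isSelfAdjoint_prod (S : AdjacentBonds J Q Q' qi pi qj pj ql pl ε) :
    IsSelfAdjoint (pi * pj * pl) := by
  have sa : IsSelfAdjoint (pi * pj) :=
    (IsSelfAdjoint.commute_iff S.site_i.right_sa S.site_j.right_sa).1 S.comm_pi_pj
  exact (IsSelfAdjoint.commute_iff sa S.site_l.right_sa).1
    (S.comm_pi_pl.mul_left S.comm_pj_pl)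

/-- The gain of the bond `e` from the jumps of `f`. The factor `qj` of the jumps is cancelled by the
factor `pj` of the energy of `e`. -/
theorem jumpDual_conjJump_bondEnergy (S : AdjacentBonds J Q Q' qi pi qj pj ql pl ε) :
    jumpDual (conjJump (qj * ql) (pj * pl) J) (bondEnergy (pi * pj) Q') =
      (pi * pj * pl) * (jumpDual J (ql * ql) * Q') * (pi * pj * pl) := by
  have sa : IsSelfAdjoint (pi * pj) :=
    (IsSelfAdjoint.commute_iff S.site_i.right_sa S.site_j.right_sa).1 S.comm_pi_pj
  have hx : ∀ α, Q' * (pi * pj) * conjJump (qj * ql) (pj * pl) J α =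
      ql * J α * Q' * (pi * pj * pl) := by
    intro α
    calc Q' * (pi * pj) * (qj * ql * J α * (pj * pl))
        = Q' * (pi * ((pj * qj) * ql)) * J α * (pj * pl) := by noncomm_ring
      _ = Q' * ql * (pi * J α) * (pj * pl) := by
        rw [S.site_j.inv_mul, one_mul, S.comm_pi_ql.eq]; noncomm_ring
      _ = ql * (Q' * J α) * pi * (pj * pl) := by
        rw [S.comm_proj_ql.eq, ← (S.comm_jump_pi α).eq]; noncomm_ring
      _ = _ := by rw [← (S.comm_jump_proj α).eq]; noncomm_ring
  have hE : bondEnergy (pi * pj) Q' = star (Q' * (pi * pj)) * (Q' * (pi * pj)) := by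
    rw [star_mul, sa.star_eq, S.proj_sa.star_eq, bondEnergy]
    calc pi * pj * Q' * (pi * pj) = pi * pj * (Q' * Q') * (pi * pj) := by rw [S.proj_idem]
      _ = _ := by noncomm_ring
  have hterm : ∀ α, star (conjJump (qj * ql) (pj * pl) J α) * bondEnergy (pi * pj) Q' *
      conjJump (qj * ql) (pj * pl) J α =
      (pi * pj * pl) * (star (J α) * (ql * ql) * J α * Q') * (pi * pj * pl) := by
    intro α
    calc _ = star (Q' * (pi * pj) * conjJump (qj * ql) (pj * pl) J α) *
          (Q' * (pi * pj) * conjJump (qj * ql) (pj * pl) J α) := by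
          rw [hE, star_mul (Q' * (pi * pj))]; noncomm_ring
      _ = (pi * pj * pl) * (Q' * (star (J α) * (ql * ql) * J α) * Q') * (pi * pj * pl) := by
          rw [hx, star_mul (ql * J α * Q'), S.isSelfAdjoint_prod.star_eq, star_mul, star_mul,
            S.proj_sa.star_eq, S.site_l.left_sa.star_eq]
          noncomm_ring
      _ = _ := by
          have c : Commute (star (J α) * (ql * ql) * J α) Q' :=
            ((star_jump_comm_of_sa S.proj_sa S.comm_jump_proj α).mul_left
              (S.comm_proj_ql.symm.mul_left S.comm_proj_ql.symm)).mul_left (S.comm_jump_proj α)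
          rw [← c.eq, mul_assoc _ Q' Q', S.proj_idem]
  rw [jumpDual, Finset.sum_congr rfl fun α _ => hterm α, jumpDual, Finset.sum_mul, Finset.mul_sum,
    Finset.sum_mul]

/-- One half of the loss of the bond `e` from the jump rate of `f`, in the same form as the gain. -/
theorem jumpRate_mul_bondEnergy [Nontrivial A] (S : AdjacentBonds J Q Q' qi pi qj pj ql pl ε)
    (hε : ε ≤ 1) :
    jumpRate (qj * ql) (pj * pl) J * bondEnergy (pi * pj) Q' =
      (pi * pj * pl) * (jumpDual J (qj * ql * (qj * ql)) * (pj * pj) * Q') * (pi * pj * pl) := by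
  rw [BondJumps.jumpRate_eq (S.site_j.mul S.site_l hε S.comm_qj_ql S.comm_pj_pl), bondEnergy]
  set Θ := jumpDual J (qj * ql * (qj * ql))
  have c1 : Commute Θ pi := comm_jumpDual S.site_i.right_sa S.comm_jump_pi
    ((S.comm_pi_qj.symm.mul_left S.comm_pi_ql.symm).mul_left
      (S.comm_pi_qj.symm.mul_left S.comm_pi_ql.symm))
  have c2 : Commute pi (pj * pl) := S.comm_pi_pj.mul_right S.comm_pi_pl
  have c3 : Commute pl (pi * pj) := S.comm_pi_pl.symm.mul_right S.comm_pj_pl.symm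
  calc pj * pl * Θ * (pj * pl) * (pi * pj * Q' * (pi * pj))
      = pj * pl * Θ * ((pj * pl) * pi) * (pj * Q' * (pi * pj)) := by noncomm_ring
    _ = pj * pl * (Θ * pi) * (pj * (pl * pj) * Q' * (pi * pj)) := by rw [← c2.eq]; noncomm_ring
    _ = (pj * pl * pi) * Θ * (pj * pj * (pl * Q') * (pi * pj)) := by
      rw [c1.eq, ← S.comm_pj_pl.eq]; noncomm_ring
    _ = (pi * (pj * pl)) * Θ * (pj * pj * Q' * (pl * (pi * pj))) := by
      rw [← c2.eq, ← S.comm_proj_pl.eq]; noncomm_ring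
    _ = _ := by rw [c3.eq]; noncomm_ring

theorem bondEnergy_nonneg (S : AdjacentBonds J Q Q' qi pi qj pj ql pl ε) :
    0 ≤ bondEnergy (pi * pj) Q' :=
  ((IsSelfAdjoint.commute_iff S.site_i.right_sa S.site_j.right_sa).1
    S.comm_pi_pj).conjugate_nonneg (projection_nonneg S.proj_sa S.proj_idem)

theorem bondEnergy_le_two (S : AdjacentBonds J Q Q' qi pi qj pj ql pl ε) (hε : ε ≤ 1 / 4) :
    bondEnergy (pi * pj) Q' ≤ (2 : ℝ) • (1 : A) := by
  have hε0 : 0 ≤ ε := (norm_nonneg _).trans S.site_i.norm_sq_sub_one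
  have sa : IsSelfAdjoint (pi * pj) :=
    (IsSelfAdjoint.commute_iff S.site_i.right_sa S.site_j.right_sa).1 S.comm_pi_pj
  have h1 := sa.conjugate_le_conjugate (projection_le_one S.proj_sa S.proj_idem)
  have h2 := S.site_i.right_sa.conjugate_le_conjugate S.site_j.inv_sq_le
  have e : pi * pj * 1 * (pi * pj) = pi * (pj * pj) * pi := by
    rw [mul_one]; nth_rw 2 [S.comm_pi_pj.eq]; noncomm_ring
  rw [e] at h1
  rw [mul_smul_comm, mul_one, smul_mul_assoc] at h2
  refine h1.trans (h2.trans ((smul_le_smul_real (by linarith) S.site_i.inv_sq_le).trans ?_))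
  rw [smul_smul]
  exact smul_le_smul_coeff (by nlinarith) zero_le_one

/-- To first order in `Γ`, the energy given by the jumps of `f` to the bond `e` cancels against the
loss from its decay; what is left over is an off-diagonal block `Q Z Q'` with `‖Z‖ ≤ 3 ε`. -/
theorem first_order_le [Nontrivial A] (S : AdjacentBonds J Q Q' qi pi qj pj ql pl ε)
    (hε0 : 0 < ε) (hε : ε ≤ 1 / 12) :
    (2 : ℝ) • jumpDual (conjJump (qj * ql) (pj * pl) J) (bondEnergy (pi * pj) Q') -
      (jumpRate (qj * ql) (pj * pl) J * bondEnergy (pi * pj) Q' +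
        bondEnergy (pi * pj) Q' * jumpRate (qj * ql) (pj * pl) J) ≤
      (4 * ε) • (bondEnergy (pi * pj) Q' + bondEnergy (pj * pl) Q) := by
  have hε1 : ε ≤ 1 := by linarith
  have Nf : NearOne (qj * ql) (pj * pl) (3 * ε) :=
    S.site_j.mul S.site_l hε1 S.comm_qj_ql S.comm_pj_pl
  have qsa := Nf.left_sa
  have b1 := S.conj_proj_left_le
  have b2 := S.conj_proj_right_le
  have e1 := S.jumpDual_conjJump_bondEnergy
  have e2 := S.jumpRate_mul_bondEnergy hε1
  have Psa := S.isSelfAdjoint_prod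
  have h0 := S.bondEnergy_nonneg
  have hf0 := S.jumps.bondEnergy_nonneg Nf
  set P := pi * pj * pl with hP
  set Θ := jumpDual J (qj * ql * (qj * ql)) with hΘ
  set Θl := jumpDual J (ql * ql) with hΘl
  set Z := Θl - Θ * (pj * pj) with hZ
  have hpp : star (pj * pj) = pj * pj := by rw [star_mul, S.site_j.right_sa.star_eq]
  have Θsa : star Θ = Θ := by rw [hΘ, jumpDual_star, star_mul, qsa.star_eq]
  have Θlsa : star Θl = Θl := by rw [hΘl, jumpDual_star, star_mul, S.site_l.left_sa.star_eq]
  have e3 : bondEnergy (pi * pj) Q' * jumpRate (qj * ql) (pj * pl) J =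
      P * (Q' * (pj * pj) * Θ) * P := by
    have := congrArg star e2
    have hn : star (jumpRate (qj * ql) (pj * pl) J) = jumpRate (qj * ql) (pj * pl) J :=
      (BondJumps.jumpRate_nonneg (q := qj * ql) (p := pj * pl) (J := J)).isSelfAdjoint.star_eq
    rw [star_mul, hn, h0.isSelfAdjoint.star_eq, star_conj Psa, star_mul, star_mul, hpp,
      S.proj_sa.star_eq, Θsa] at this
    rw [this]; noncomm_ring
  have cΘl : Commute Θl Q' := comm_jumpDual S.proj_sa S.comm_jump_proj
    (S.comm_proj_ql.symm.mul_left S.comm_proj_ql.symm)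
  have QZ : Q * Z = Z := by
    rw [hZ, mul_sub, ← mul_assoc, S.jumps.proj_mul_jumpDual, S.jumps.proj_mul_jumpDual]
  have ZQ : star Z * Q = star Z := by
    have := congrArg star QZ
    rwa [star_mul, S.jumps.isSelfAdjoint.star_eq] at this
  have e4 : (2 : ℝ) • jumpDual (conjJump (qj * ql) (pj * pl) J) (bondEnergy (pi * pj) Q') -
      (jumpRate (qj * ql) (pj * pl) J * bondEnergy (pi * pj) Q' +
        bondEnergy (pi * pj) Q' * jumpRate (qj * ql) (pj * pl) J) =
      P * (Q * Z * Q' + Q' * star Z * Q) * P := by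
    have a1 : Q' * star Z * Q = Q' * star Z := by rw [mul_assoc, ZQ]
    rw [QZ, a1, e1, e2, e3, hZ, star_sub, star_mul, hpp, Θsa, Θlsa, two_smul]
    nth_rw 2 [cΘl.eq]
    noncomm_ring
  have hZn : ‖Z‖ ≤ 3 * ε := by
    have hqq : IsSelfAdjoint (qj * ql * (qj * ql)) := by
      rw [IsSelfAdjoint, star_mul, qsa.star_eq]
    have hll : IsSelfAdjoint (ql * ql) := by rw [IsSelfAdjoint, star_mul, S.site_l.left_sa.star_eq]
    -- `Z` compares `ql²` with `(qj ql)² pj²`, which agree for `qj = pj = 1`.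
    have hx : ‖ql * ql - qj * ql * (qj * ql)‖ ≤ ε * (1 + ε) := by
      have : ql * ql - qj * ql * (qj * ql) = -((qj * qj - 1) * (ql * ql)) := by
        rw [S.comm_qj_ql.symm.mul_mul_mul_comm]; noncomm_ring
      rw [this, norm_neg]
      refine (norm_mul_le _ _).trans ?_
      gcongr
      · exact S.site_j.norm_sq_sub_one
      · exact S.site_l.norm_sq_le
    have t1 : ‖Θl - Θ‖ ≤ ε * (1 + ε) := by
      rw [hΘl, hΘ, ← jumpDual_sub]
      exact norm_jumpDual_le S.jumps.jumpDual_one_le (hll.sub hqq) hx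
    have t2 : ‖Θ‖ ≤ 1 + 3 * ε := norm_jumpDual_le S.jumps.jumpDual_one_le hqq Nf.norm_sq_le
    have : Z = (Θl - Θ) - Θ * (pj * pj - 1) := by rw [hZ]; noncomm_ring
    rw [this]
    calc _ ≤ ‖Θl - Θ‖ + ‖Θ‖ * ‖pj * pj - 1‖ :=
          (norm_sub_le _ _).trans (by gcongr; exact norm_mul_le _ _)
      _ ≤ ε * (1 + ε) + (1 + 3 * ε) * ε := by gcongr; exact S.site_j.norm_inv_sq_sub_one
      _ ≤ 3 * ε := by nlinarith
  have h1 := Psa.conjugate_le_conjugate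
    (cross_le (by positivity) hZn S.jumps.isSelfAdjoint S.proj_sa)
  rw [e4]
  refine h1.trans ?_
  rw [S.jumps.idem, S.proj_idem]
  calc P * ((3 * ε) • (Q + Q')) * P = (3 * ε) • (P * Q * P + P * Q' * P) := by
        rw [mul_smul_comm, smul_mul_assoc, mul_add, add_mul]
    _ ≤ (3 * ε) • ((1 + ε) • bondEnergy (pj * pl) Q + (1 + ε) • bondEnergy (pi * pj) Q') :=
        smul_le_smul_real (by positivity) (add_le_add b2 b1)
    _ = (3 * ε * (1 + ε)) • (bondEnergy (pi * pj) Q' + bondEnergy (pj * pl) Q) := by module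
    _ ≤ _ := smul_le_smul_coeff (by nlinarith) (add_nonneg h0 hf0)

/-- A bond channel raises the energy of a neighbouring bond only to the order `ε Γ + Γ²`, and only
by as much energy as the two bonds already have. -/
theorem krausDual_bondEnergy_le [Nontrivial A] (S : AdjacentBonds J Q Q' qi pi qj pj ql pl ε)
    (hε0 : 0 < ε) (hε : ε ≤ 1 / 12) (hΓ : 0 < Γ) {k : A} (k0 : 0 ≤ k)
    (kk : k * k = 1 - Γ • jumpRate (qj * ql) (pj * pl) J) :
    krausDual Γ k (conjJump (qj * ql) (pj * pl) J) (bondEnergy (pi * pj) Q') ≤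
      bondEnergy (pi * pj) Q' + (2 * ε * Γ + 12 * Γ ^ 2) •
        (bondEnergy (pi * pj) Q' + bondEnergy (pj * pl) Q) := by
  have hε1 : ε ≤ 1 := by linarith
  have Nf : NearOne (qj * ql) (pj * pl) (3 * ε) :=
    S.site_j.mul S.site_l hε1 S.comm_qj_ql S.comm_pj_pl
  have h0 := S.bondEnergy_nonneg
  have h1 := no_jump_le hΓ h0 (S.bondEnergy_le_two (by linarith)) BondJumps.jumpRate_nonneg
    (S.jumps.jumpRate_le_two Nf (by linarith) (by linarith)) k0 kk
  have h2 := S.first_order_le hε0 hε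
  have h3 := (S.jumps.jumpRate_le Nf).trans
    (smul_le_smul_coeff (s := 2) (by linarith) (S.jumps.bondEnergy_nonneg Nf))
  have hf0 := S.jumps.bondEnergy_nonneg Nf
  rw [krausDual]
  set D := jumpDual (conjJump (qj * ql) (pj * pl) J) (bondEnergy (pi * pj) Q')
  set n := jumpRate (qj * ql) (pj * pl) J
  set h := bondEnergy (pi * pj) Q'
  set hf := bondEnergy (pj * pl) Q
  calc k * h * k + Γ • D
      ≤ h - (Γ / 2) • (n * h + h * n) + Γ ^ 2 • ((2 : ℝ) • h + (6 : ℝ) • n) + Γ • D := by gcongr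
    _ = h + (Γ / 2) • ((2 : ℝ) • D - (n * h + h * n)) + Γ ^ 2 • ((2 : ℝ) • h + (6 : ℝ) • n) := by
        module
    _ ≤ h + (Γ / 2) • ((4 * ε) • (h + hf)) +
          Γ ^ 2 • ((2 : ℝ) • h + (6 : ℝ) • ((2 : ℝ) • hf)) := by
        have a1 := smul_le_smul_real (r := Γ / 2) (by positivity) h2
        have a2 := smul_le_smul_real (r := (6 : ℝ)) (by positivity) h3
        have a3 := smul_le_smul_real (r := Γ ^ 2) (by positivity)
          (add_le_add_right a2 ((2 : ℝ) • h))
        exact add_le_add (add_le_add_right a1 _) a3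
    _ ≤ h + (Γ / 2) • ((4 * ε) • (h + hf)) +
          Γ ^ 2 • ((12 : ℝ) • h + (6 : ℝ) • ((2 : ℝ) • hf)) := by
        have a1 := smul_le_smul_coeff (r := 2) (s := 12) (by norm_num) h0
        have a3 := smul_le_smul_real (r := Γ ^ 2) (by positivity)
          (add_le_add_left a1 ((6 : ℝ) • ((2 : ℝ) • hf)))
        exact add_le_add_right a3 _
    _ = _ := by module

/-- The energies of two neighbouring bonds anticommute to a nearly nonnegative operator. -/
theorem le_anticommutator (S : AdjacentBonds J Q Q' qi pi qj pj ql pl ε)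
    (hε0 : 0 < ε) (hε : ε ≤ 1 / 12) :
    -((2 * ε) • (bondEnergy (pi * pj) Q' + bondEnergy (pj * pl) Q)) ≤
      bondEnergy (pi * pj) Q' * bondEnergy (pj * pl) Q +
        bondEnergy (pj * pl) Q * bondEnergy (pi * pj) Q' := by
  set P := pi * pj * pl with hP
  have Psa : IsSelfAdjoint P := S.isSelfAdjoint_prod
  have c1 : Commute pi (pj * pl) := S.comm_pi_pj.mul_right S.comm_pi_pl
  have c3 : Commute pl (pi * pj) := S.comm_pi_pl.symm.mul_right S.comm_pj_pl.symm
  have sa : IsSelfAdjoint (pi * pj) :=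
    (IsSelfAdjoint.commute_iff S.site_i.right_sa S.site_j.right_sa).1 S.comm_pi_pj
  have saf : IsSelfAdjoint (pj * pl) :=
    (IsSelfAdjoint.commute_iff S.site_j.right_sa S.site_l.right_sa).1 S.comm_pj_pl
  have QQ := S.comm_proj_proj
  have e1 : bondEnergy (pj * pl) Q * bondEnergy (pi * pj) Q' =
      P * (Q * (pj * pj) * Q') * P := by
    calc pj * pl * Q * (pj * pl) * (pi * pj * Q' * (pi * pj))
        = pj * pl * Q * ((pj * pl) * pi) * (pj * Q' * (pi * pj)) := by noncomm_ring
      _ = pj * pl * (Q * pi) * (pj * (pl * pj) * Q' * (pi * pj)) := by rw [← c1.eq]; noncomm_ring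
      _ = (pj * pl * pi) * Q * (pj * pj * (pl * Q') * (pi * pj)) := by
        rw [S.comm_proj_pi.eq, ← S.comm_pj_pl.eq]; noncomm_ring
      _ = (pi * (pj * pl)) * Q * (pj * pj * Q' * (pl * (pi * pj))) := by
        rw [← c1.eq, ← S.comm_proj_pl.eq]; noncomm_ring
      _ = _ := by rw [c3.eq, hP]; noncomm_ring
  have e2 : bondEnergy (pi * pj) Q' * bondEnergy (pj * pl) Q =
      P * (Q' * (pj * pj) * Q) * P := by
    have hpp : star (pj * pj) = pj * pj := by rw [star_mul, S.site_j.right_sa.star_eq]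
    have := congrArg star e1
    rw [star_mul, star_conj Psa, star_mul, star_mul, hpp, S.proj_sa.star_eq,
      S.jumps.isSelfAdjoint.star_eq] at this
    have a1 : star (bondEnergy (pi * pj) Q') = bondEnergy (pi * pj) Q' :=
      S.bondEnergy_nonneg.isSelfAdjoint.star_eq
    have a2 : star (bondEnergy (pj * pl) Q) = bondEnergy (pj * pl) Q := by
      rw [bondEnergy, star_conj saf, S.jumps.isSelfAdjoint.star_eq]
    rw [a1, a2] at this
    rw [this]; noncomm_ring
  have h1 := neg_cross_le hε0 S.site_j.norm_inv_sq_sub_one S.jumps.isSelfAdjoint S.proj_sa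
  have hpp : star (pj * pj - 1) = pj * pj - 1 := by
    rw [star_sub, star_mul, S.site_j.right_sa.star_eq, star_one]
  rw [hpp, S.jumps.idem, S.proj_idem] at h1
  have h2 := Psa.conjugate_le_conjugate h1
  have h3 : 0 ≤ P * (Q * Q') * P := by
    apply Psa.conjugate_nonneg
    have : Q * Q' = star (Q * Q') * (Q * Q') := by
      rw [star_mul, S.jumps.isSelfAdjoint.star_eq, S.proj_sa.star_eq]
      calc Q * Q' = (Q * Q') * Q' := by rw [mul_assoc, S.proj_idem]
        _ = Q' * (Q * Q) * Q' := by rw [QQ.eq, S.jumps.idem]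
        _ = _ := by noncomm_ring
    rw [this]
    exact star_mul_self_nonneg _
  have e3 : bondEnergy (pi * pj) Q' * bondEnergy (pj * pl) Q +
        bondEnergy (pj * pl) Q * bondEnergy (pi * pj) Q' =
      P * (Q * (pj * pj - 1) * Q' + Q' * (pj * pj - 1) * Q) * P + (2 : ℝ) • (P * (Q * Q') * P) := by
    rw [e1, e2, two_smul]
    nth_rw 2 [QQ.eq]
    noncomm_ring
  rw [e3]
  have h4 : ε • (P * Q * P + P * Q' * P) ≤
      (2 * ε) • (bondEnergy (pi * pj) Q' + bondEnergy (pj * pl) Q) := by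
    have b1 := S.conj_proj_left_le
    have b2 := S.conj_proj_right_le
    calc ε • (P * Q * P + P * Q' * P) ≤ ε • ((1 + ε) • bondEnergy (pj * pl) Q +
          (1 + ε) • bondEnergy (pi * pj) Q') := smul_le_smul_real hε0.le (add_le_add b2 b1)
      _ = (ε * (1 + ε)) • (bondEnergy (pi * pj) Q' + bondEnergy (pj * pl) Q) := by module
      _ ≤ _ := smul_le_smul_coeff (by nlinarith) (add_nonneg S.bondEnergy_nonneg
          (saf.conjugate_nonneg (projection_nonneg S.jumps.isSelfAdjoint S.jumps.idem)))
  calc _ ≤ -(ε • (P * Q * P + P * Q' * P)) := neg_le_neg h4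
    _ = P * -(ε • (Q + Q')) * P := by
        rw [mul_neg, neg_mul, mul_smul_comm, smul_mul_assoc, mul_add, add_mul]
    _ ≤ _ := h2
    _ ≤ _ := le_add_of_nonneg_right (smul_nonneg (by norm_num) h3)

end AdjacentBonds

end CStar

/-! ### Local operators on tensor products -/

section Kron

variable {m n : Type*} [Fintype m] [DecidableEq m] [Fintype n] [DecidableEq n]

/-- Induction on an operator on a tensor product of two factors: product operators suffice. -/
theorem kronecker_induction {p : Matrix (m × n) (m × n) ℂ → Prop}
    (hadd : ∀ M N, p M → p N → p (M + N)) (hsmul : ∀ (c : ℂ) M, p M → p (c • M))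
    (hkron : ∀ X Y, p (X ⊗ₖ Y)) (M : Matrix (m × n) (m × n) ℂ) : p M := by
  induction M using Matrix.induction_on' with
  | h_zero => simpa using hsmul 0 _ (hkron 0 0)
  | h_add M N hM hN => exact hadd M N hM hN
  | h_std_basis i j x =>
    have : Matrix.single i j x =
        x • (Matrix.single i.1 j.1 (1 : ℂ) ⊗ₖ Matrix.single i.2 j.2 (1 : ℂ)) := by
      rw [Matrix.single_kronecker_single, Matrix.smul_single]
      simp
    rw [this]
    exact hsmul _ _ (hkron _ _)

variable {R : Type*} [Ring R] [Algebra ℂ R] [StarRing R] [StarModule ℂ R]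

/-- A linear map on operators on a tensor product that restricts to `X ⊗ Y ↦ φ X * χ Y` for two
commuting representations `φ`, `χ` is itself a representation. -/
def kronHom (T : Matrix (m × n) (m × n) ℂ →ₗ[ℂ] R) (φ : Matrix m m ℂ →⋆ₐ[ℂ] R)
    (χ : Matrix n n ℂ →⋆ₐ[ℂ] R) (hT : ∀ X Y, T (X ⊗ₖ Y) = φ X * χ Y)
    (hc : ∀ X Y, Commute (φ X) (χ Y)) : Matrix (m × n) (m × n) ℂ →⋆ₐ[ℂ] R where
  toFun := T
  map_one' := by
    rw [← Matrix.one_kronecker_one, hT, map_one, map_one, one_mul]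
  map_mul' M N := by
    induction M using kronecker_induction with
    | hadd M M' h h' => rw [add_mul, map_add, h, h', map_add, add_mul]
    | hsmul c M h => rw [smul_mul_assoc, map_smul, h, map_smul, smul_mul_assoc]
    | hkron X Y =>
      induction N using kronecker_induction with
      | hadd M M' h h' => rw [mul_add, map_add, h, h', map_add, mul_add]
      | hsmul c M h => rw [mul_smul_comm, map_smul, h, map_smul, mul_smul_comm]
      | hkron X' Y' =>
        rw [← Matrix.mul_kronecker_mul, hT, hT, hT, map_mul, map_mul,
          (hc X' Y).symm.mul_mul_mul_comm]
  map_zero' := map_zero T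
  map_add' := map_add T
  commutes' r := by
    rw [Algebra.algebraMap_eq_smul_one, map_smul, ← Matrix.one_kronecker_one, hT, map_one, map_one,
      one_mul, Algebra.algebraMap_eq_smul_one]
  map_star' M := by
    induction M using kronecker_induction with
    | hadd M M' h h' => rw [star_add, map_add, h, h', map_add, star_add]
    | hsmul c M h => rw [star_smul, map_smul, h, map_smul, star_smul]
    | hkron X Y =>
      rw [Matrix.star_eq_conjTranspose, Matrix.conjTranspose_kronecker, hT, hT, star_mul,
        ← map_star, ← map_star, (hc _ _).eq]
      rfl

theorem kronHom_apply (T : Matrix (m × n) (m × n) ℂ →ₗ[ℂ] R) (φ : Matrix m m ℂ →⋆ₐ[ℂ] R)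
    (χ : Matrix n n ℂ →⋆ₐ[ℂ] R) (hT : ∀ X Y, T (X ⊗ₖ Y) = φ X * χ Y)
    (hc : ∀ X Y, Commute (φ X) (χ Y)) (M : Matrix (m × n) (m × n) ℂ) :
    kronHom T φ χ hT hc M = T M := rfl

end Kron

section Tensor

variable {ι : Type*} [Fintype ι] [DecidableEq ι] {α β γ : ι → Type*}
  [∀ i, Fintype (α i)] [∀ i, DecidableEq (α i)] [∀ i, Fintype (β i)] [∀ i, DecidableEq (β i)]
  [∀ i, Fintype (γ i)] [∀ i, DecidableEq (γ i)]

/-- The tensor product of one matrix for every site. -/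
def tensorAll (M : ∀ i, Matrix (α i) (β i) ℂ) : Matrix (∀ i, α i) (∀ i, β i) ℂ :=
  fun x y => ∏ i, M i (x i) (y i)

theorem tensorAll_mul (M : ∀ i, Matrix (α i) (β i) ℂ) (M' : ∀ i, Matrix (β i) (γ i) ℂ) :
    tensorAll M * tensorAll M' = tensorAll fun i => M i * M' i := by
  ext x y
  simp only [Matrix.mul_apply, tensorAll, ← Finset.prod_mul_distrib]
  rw [Fintype.prod_sum]

theorem tensorAll_one : tensorAll (fun i => (1 : Matrix (α i) (α i) ℂ)) = 1 := by
  ext x y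
  simp only [tensorAll, Matrix.one_apply]
  rw [Finset.prod_ite_zero]
  simp [funext_iff]

theorem tensorAll_conjTranspose (M : ∀ i, Matrix (α i) (β i) ℂ) :
    (tensorAll M)ᴴ = tensorAll fun i => (M i)ᴴ := by
  ext x y
  simp [tensorAll, Matrix.conjTranspose_apply]

theorem prod_mulSingle_apply (i : ι) (M : Matrix (α i) (α i) ℂ) (x y : ∀ i, α i) :
    tensorAll (Pi.mulSingle i M : ∀ l, Matrix (α l) (α l) ℂ) x y =
      if ∀ l, l ≠ i → x l = y l then M (x i) (y i) else 0 := by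
  have h : ∀ l ∈ Finset.univ.erase i, (Pi.mulSingle i M : ∀ l, Matrix (α l) (α l) ℂ) l (x l) (y l) =
      if x l = y l then 1 else 0 := by
    intro l hl
    rw [Pi.mulSingle_eq_of_ne (Finset.ne_of_mem_erase hl), Matrix.one_apply]
  rw [tensorAll, ← Finset.mul_prod_erase _ _ (Finset.mem_univ i), Finset.prod_congr rfl h,
    Finset.prod_ite_zero]
  simp

/-- The operator `M` on the factor `i`, tensored with the identity on all others. -/
def site (i : ι) : Matrix (α i) (α i) ℂ →⋆ₐ[ℂ] Matrix (∀ i, α i) (∀ i, α i) ℂ where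
  toFun M := tensorAll (Pi.mulSingle i M : ∀ l, Matrix (α l) (α l) ℂ)
  map_one' := by rw [Pi.mulSingle_one]; exact tensorAll_one
  map_mul' M N := by
    rw [tensorAll_mul, Pi.mulSingle_mul]; rfl
  map_zero' := by ext x y; rw [prod_mulSingle_apply]; simp
  map_add' M N := by
    ext x y
    simp only [prod_mulSingle_apply, Matrix.add_apply]
    split_ifs <;> simp
  commutes' r := by
    rw [Algebra.algebraMap_eq_smul_one, Algebra.algebraMap_eq_smul_one, ← tensorAll_one,
      ← Pi.one_def, ← Pi.mulSingle_one i]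
    ext x y
    simp only [prod_mulSingle_apply, Matrix.smul_apply]
    split_ifs <;> simp
  map_star' M := by
    rw [Matrix.star_eq_conjTranspose, Matrix.star_eq_conjTranspose, tensorAll_conjTranspose]
    congr 1
    funext l
    rcases eq_or_ne l i with rfl | h
    · simp
    · simp [Pi.mulSingle_eq_of_ne h]

theorem site_eq_tensorAll (i : ι) (M : Matrix (α i) (α i) ℂ) :
    site i M = tensorAll (Pi.mulSingle i M : ∀ l, Matrix (α l) (α l) ℂ) := rfl

theorem site_apply (i : ι) (M : Matrix (α i) (α i) ℂ) (x y : ∀ i, α i) :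
    site i M x y = if ∀ l, l ≠ i → x l = y l then M (x i) (y i) else 0 :=
  prod_mulSingle_apply i M x y

theorem site_commute {i j : ι} (h : i ≠ j) (M : Matrix (α i) (α i) ℂ) (N : Matrix (α j) (α j) ℂ) :
    Commute (site i M) (site j N) := by
  have := Pi.mulSingle_commute (f := fun l => Matrix (α l) (α l) ℂ) h M N
  rw [Commute, SemiconjBy, site_eq_tensorAll, site_eq_tensorAll, tensorAll_mul, tensorAll_mul]
  congr 1

theorem site_mul_tensorAll {V : ∀ i, Matrix (α i) (β i) ℂ} {i : ι} {X : Matrix (α i) (α i) ℂ}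
    {Y : Matrix (β i) (β i) ℂ} (h : X * V i = V i * Y) :
    site i X * tensorAll V = tensorAll V * site i Y := by
  rw [site_eq_tensorAll, site_eq_tensorAll, tensorAll_mul, tensorAll_mul]
  congr 1
  funext l
  rcases eq_or_ne l i with rfl | hl
  · simpa using h
  · simp [Pi.mulSingle_eq_of_ne hl]

theorem site_mul_site_apply {i j : ι} (h : i ≠ j) (M : Matrix (α i) (α i) ℂ)
    (N : Matrix (α j) (α j) ℂ) (x y : ∀ i, α i) :
    (site i M * site j N) x y =
      if ∀ l, l ≠ i → l ≠ j → x l = y l then M (x i) (y i) * N (x j) (y j) else 0 := by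
  have hji : j ∈ Finset.univ.erase i := Finset.mem_erase.2 ⟨h.symm, Finset.mem_univ _⟩
  rw [site_eq_tensorAll, site_eq_tensorAll, tensorAll_mul, tensorAll,
    ← Finset.mul_prod_erase _ _ (Finset.mem_univ i), ← Finset.mul_prod_erase _ _ hji]
  have hl : ∀ l ∈ (Finset.univ.erase i).erase j,
      ((Pi.mulSingle i M : ∀ l, Matrix (α l) (α l) ℂ) l *
        (Pi.mulSingle j N : ∀ l, Matrix (α l) (α l) ℂ) l) (x l) (y l) =
      if x l = y l then 1 else 0 := by
    intro l hl
    rw [Pi.mulSingle_eq_of_ne (Finset.ne_of_mem_erase hl),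
      Pi.mulSingle_eq_of_ne (Finset.ne_of_mem_erase (Finset.mem_of_mem_erase hl)), one_mul,
      Matrix.one_apply]
  rw [Finset.prod_congr rfl hl, Finset.prod_ite_zero, Pi.mulSingle_eq_same, Pi.mulSingle_eq_same,
    Pi.mulSingle_eq_of_ne h, Pi.mulSingle_eq_of_ne h.symm, mul_one, one_mul]
  have : (∀ l ∈ (Finset.univ.erase i).erase j, x l = y l) ↔ ∀ l, l ≠ i → l ≠ j → x l = y l := by
    constructor
    · intro h l hi hj; exact h l (by simp [hi, hj])
    · intro h l hl; simp at hl; exact h l hl.2 hl.1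
  simp only [this]
  split_ifs <;> simp

/-- The operator `M` on the factors `i ≠ j`, tensored with the identity on all others. -/
def pairLin (i j : ι) :
    Matrix (α i × α j) (α i × α j) ℂ →ₗ[ℂ] Matrix (∀ i, α i) (∀ i, α i) ℂ where
  toFun M := Matrix.of fun x y =>
    if ∀ l, l ≠ i → l ≠ j → x l = y l then M (x i, x j) (y i, y j) else 0
  map_add' M N := by
    ext x y
    simp only [Matrix.add_apply, Matrix.of_apply]
    split_ifs <;> simp
  map_smul' c M := by
    ext x y
    simp only [Matrix.smul_apply, Matrix.of_apply, RingHom.id_apply]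
    split_ifs <;> simp

theorem pairLin_kronecker {i j : ι} (h : i ≠ j) (X : Matrix (α i) (α i) ℂ)
    (Y : Matrix (α j) (α j) ℂ) : pairLin i j (X ⊗ₖ Y) = site i X * site j Y := by
  ext x y
  rw [site_mul_site_apply h]
  rfl

/-- `pairLin` as a representation of the operators on two different factors. -/
def pair {i j : ι} (h : i ≠ j) :
    Matrix (α i × α j) (α i × α j) ℂ →⋆ₐ[ℂ] Matrix (∀ i, α i) (∀ i, α i) ℂ :=
  kronHom (pairLin i j) (site i) (site j) (pairLin_kronecker h) fun X Y => site_commute h X Y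

theorem pair_kronecker {i j : ι} (h : i ≠ j) (X : Matrix (α i) (α i) ℂ)
    (Y : Matrix (α j) (α j) ℂ) : pair h (X ⊗ₖ Y) = site i X * site j Y :=
  pairLin_kronecker h X Y

theorem commute_pair {i j : ι} (h : i ≠ j) {c : Matrix (∀ i, α i) (∀ i, α i) ℂ}
    (hi : ∀ X, Commute (site i X) c) (hj : ∀ Y, Commute (site j Y) c)
    (M : Matrix (α i × α j) (α i × α j) ℂ) : Commute (pair h M) c := by
  induction M using kronecker_induction with
  | hadd M M' h h' => rw [map_add]; exact h.add_left h'
  | hsmul c M h => rw [map_smul]; exact h.smul_left c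
  | hkron X Y => rw [pair_kronecker]; exact (hi X).mul_left (hj Y)

theorem pair_commute_site {i j l : ι} (h : i ≠ j) (hi : i ≠ l) (hj : j ≠ l)
    (M : Matrix (α i × α j) (α i × α j) ℂ) (X : Matrix (α l) (α l) ℂ) :
    Commute (pair h M) (site l X) :=
  commute_pair h (fun _ => site_commute hi _ _) (fun _ => site_commute hj _ _) M

theorem pair_commute_pair {i j i' j' : ι} (h : i ≠ j) (h' : i' ≠ j') (h1 : i ≠ i') (h2 : i ≠ j')
    (h3 : j ≠ i') (h4 : j ≠ j') (M : Matrix (α i × α j) (α i × α j) ℂ)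
    (N : Matrix (α i' × α j') (α i' × α j') ℂ) : Commute (pair h M) (pair h' N) :=
  commute_pair h (fun _ => (pair_commute_site h' h1.symm h2.symm _ _).symm)
    (fun _ => (pair_commute_site h' h3.symm h4.symm _ _).symm) M

/-- A tensor product of isometries `V_i` intertwines the two-site operators `X` and `V X V†`. -/
theorem pair_mul_tensorAll {V : ∀ i, Matrix (α i) (β i) ℂ} {i j : ι} (h : i ≠ j)
    (hi : (V i)ᴴ * V i = 1) (hj : (V j)ᴴ * V j = 1) (M : Matrix (β i × β j) (β i × β j) ℂ) :
    pair h ((V i ⊗ₖ V j) * M * (V i ⊗ₖ V j)ᴴ) * tensorAll V = tensorAll V * pair h M := by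
  induction M using kronecker_induction with
  | hadd M M' h h' =>
    rw [Matrix.mul_add, Matrix.add_mul, map_add, map_add, Matrix.add_mul, Matrix.mul_add, h, h']
  | hsmul c M h =>
    rw [Matrix.mul_smul, Matrix.smul_mul, map_smul, map_smul, Matrix.smul_mul, Matrix.mul_smul, h]
  | hkron X Y =>
    rw [Matrix.conjTranspose_kronecker, ← Matrix.mul_kronecker_mul, ← Matrix.mul_kronecker_mul,
      pair_kronecker, pair_kronecker, Matrix.mul_assoc, site_mul_tensorAll (Y := Y),
      ← Matrix.mul_assoc, site_mul_tensorAll (Y := X), Matrix.mul_assoc]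
    · rw [Matrix.mul_assoc, hi, Matrix.mul_one]
    · rw [Matrix.mul_assoc, hj, Matrix.mul_one]

end Tensor

/-! ### The virtual picture of an injective PEPS -/

section KronSide

variable {m n : Type*} [Fintype m] [DecidableEq m] [Fintype n] [DecidableEq n]

/-- `X ↦ X ⊗ 1`. -/
def kronLeft : Matrix m m ℂ →⋆ₐ[ℂ] Matrix (m × n) (m × n) ℂ where
  toFun X := X ⊗ₖ 1
  map_one' := Matrix.one_kronecker_one
  map_mul' X Y := by rw [← Matrix.mul_kronecker_mul, one_mul]
  map_zero' := Matrix.zero_kronecker _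
  map_add' X Y := Matrix.add_kronecker _ _ _
  commutes' r := by
    rw [Algebra.algebraMap_eq_smul_one, Algebra.algebraMap_eq_smul_one, Matrix.smul_kronecker,
      Matrix.one_kronecker_one]
  map_star' X := by
    rw [Matrix.star_eq_conjTranspose, Matrix.star_eq_conjTranspose, Matrix.conjTranspose_kronecker,
      Matrix.conjTranspose_one]

/-- `Y ↦ 1 ⊗ Y`. -/
def kronRight : Matrix n n ℂ →⋆ₐ[ℂ] Matrix (m × n) (m × n) ℂ where
  toFun X := 1 ⊗ₖ X
  map_one' := Matrix.one_kronecker_one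
  map_mul' X Y := by rw [← Matrix.mul_kronecker_mul, one_mul]
  map_zero' := Matrix.kronecker_zero _
  map_add' X Y := Matrix.kronecker_add _ _ _
  commutes' r := by
    rw [Algebra.algebraMap_eq_smul_one, Algebra.algebraMap_eq_smul_one, Matrix.kronecker_smul,
      Matrix.one_kronecker_one]
  map_star' X := by
    rw [Matrix.star_eq_conjTranspose, Matrix.star_eq_conjTranspose, Matrix.conjTranspose_kronecker,
      Matrix.conjTranspose_one]

theorem kronLeft_mul_kronRight (X : Matrix m m ℂ) (Y : Matrix n n ℂ) :
    kronLeft X * kronRight Y = X ⊗ₖ Y := by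
  change (X ⊗ₖ 1) * (1 ⊗ₖ Y) = _
  rw [← Matrix.mul_kronecker_mul, one_mul, mul_one]

theorem kronLeft_commute_kronRight (X : Matrix m m ℂ) (Y : Matrix n n ℂ) :
    Commute (kronLeft X) (kronRight Y) := by
  change (X ⊗ₖ 1) * (1 ⊗ₖ Y) = (1 ⊗ₖ Y) * (X ⊗ₖ 1)
  rw [← Matrix.mul_kronecker_mul, ← Matrix.mul_kronecker_mul, one_mul, mul_one, one_mul, mul_one]

end KronSide

/-- The entrywise operator `siteOp` is the representation `site`. -/
theorem siteOp_eq_site {N d : ℕ} (i : Fin N) (M : Matrix (Fin d) (Fin d) ℂ) :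
    siteOp i M = site (α := fun _ => Fin d) i M := by
  ext x y
  rw [site_apply, siteOp]
  split_ifs <;> rfl

theorem pairOp_eq_pair {N d : ℕ} {i j : Fin N} (h : i ≠ j)
    (M : Matrix (Fin d × Fin d) (Fin d × Fin d) ℂ) :
    pairOp i j M = pair (α := fun _ => Fin d) h M := by
  ext x y
  rw [pairOp, pair, kronHom_apply]
  simp only [pairLin, LinearMap.coe_mk, AddHom.coe_mk, Matrix.of_apply]

namespace InjectivePEPS

variable {N : ℕ} {G : SimpleGraph (Fin N)} [DecidableRel G.Adj] {d D : ℕ}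
  (P : InjectivePEPS G d D)

/-- Labels of the product basis of the virtual space, the tensor product of the virtual spaces
at all vertices. -/
abbrev VConf (_ : InjectivePEPS G d D) : Type := ∀ i, Virt G D i

/-- Operators on the virtual space. -/
abbrev VOp (P : InjectivePEPS G d D) : Type := Matrix P.VConf P.VConf ℂ

theorem src_ne_tgt (e : G.edgeSet) : P.src e ≠ P.tgt e := (P.orient e).adj.ne

theorem nonempty_fin (P : InjectivePEPS G d D) : Nonempty (Fin D) := by
  by_contra h
  rw [not_nonempty_iff] at h
  have h1 := P.norm_φ₀
  rw [Subsingleton.elim P.φ₀ 0, norm_zero] at h1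
  exact zero_ne_one h1

/-! ### Polar decomposition of the tensors -/

/-- The positive part `(A_i† A_i)^{1/2}` of the polar decomposition of the tensor at `i`. -/
def root (i : Fin N) : Matrix (Virt G D i) (Virt G D i) ℂ := CFC.sqrt ((P.A i)ᴴ * P.A i)

/-- The inverse of `root`. -/
def rootInv (i : Fin N) : Matrix (Virt G D i) (Virt G D i) ℂ := (P.root i)⁻¹

/-- The isometric part of the polar decomposition of the tensor at `i`. -/
def iso (i : Fin N) : Matrix (Fin d) (Virt G D i) ℂ := P.A i * P.rootInv i

theorem gram_posDef (i : Fin N) : ((P.A i)ᴴ * P.A i).PosDef :=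
  Matrix.PosDef.conjTranspose_mul_self _ (P.injective_A i)

theorem root_mul_root (i : Fin N) : P.root i * P.root i = (P.A i)ᴴ * P.A i :=
  CFC.sqrt_mul_sqrt_self _ (Matrix.nonneg_iff_posSemidef.2 (P.gram_posDef i).posSemidef)

theorem root_isHermitian (i : Fin N) : (P.root i)ᴴ = P.root i :=
  (IsSelfAdjoint.of_nonneg (CFC.sqrt_nonneg _)).star_eq

theorem isUnit_root (i : Fin N) : IsUnit (P.root i) := by
  have h := (P.gram_posDef i).isUnit
  rw [← root_mul_root] at h
  exact (Commute.isUnit_mul_iff (Commute.refl _)).1 h |>.1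

theorem root_mul_rootInv (i : Fin N) : P.root i * P.rootInv i = 1 :=
  Matrix.mul_nonsing_inv _ ((Matrix.isUnit_iff_isUnit_det _).1 (P.isUnit_root i))

theorem rootInv_mul_root (i : Fin N) : P.rootInv i * P.root i = 1 :=
  Matrix.nonsing_inv_mul _ ((Matrix.isUnit_iff_isUnit_det _).1 (P.isUnit_root i))

theorem rootInv_isHermitian (i : Fin N) : (P.rootInv i)ᴴ = P.rootInv i := by
  rw [rootInv, Matrix.conjTranspose_nonsing_inv, root_isHermitian]

theorem rootInv_mul_rootInv (i : Fin N) : P.rootInv i * P.rootInv i = ((P.A i)ᴴ * P.A i)⁻¹ := by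
  rw [← root_mul_root, Matrix.mul_inv_rev]; rfl

theorem iso_conjTranspose_mul_iso (i : Fin N) : (P.iso i)ᴴ * P.iso i = 1 := by
  rw [iso, Matrix.conjTranspose_mul, rootInv_isHermitian, Matrix.mul_assoc,
    ← Matrix.mul_assoc (P.A i)ᴴ, ← root_mul_root, Matrix.mul_assoc, root_mul_rootInv,
    Matrix.mul_one, rootInv_mul_root]

theorem iso_mul_root (i : Fin N) : P.iso i * P.root i = P.A i := by
  rw [iso, Matrix.mul_assoc, rootInv_mul_root, Matrix.mul_one]

/-- `q⁻¹ V†` is the pseudo-inverse of `A = V q`. -/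
theorem pinv_A (i : Fin N) : pinv (P.A i) = P.rootInv i * (P.iso i)ᴴ := by
  rw [pinv, iso, Matrix.conjTranspose_mul, rootInv_isHermitian, ← Matrix.mul_assoc,
    rootInv_mul_rootInv]

theorem iso_mul_conjTranspose (i : Fin N) : P.iso i * (P.iso i)ᴴ = P.siteProj i := by
  rw [siteProj, imProj, pinv_A, ← Matrix.mul_assoc]; rfl

/-- The tensor product of the isometric parts of all tensors. -/
def globalIso : Matrix (Conf N d) P.VConf ℂ := tensorAll P.iso

theorem globalIso_conjTranspose_mul : P.globalIsoᴴ * P.globalIso = 1 := by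
  rw [globalIso, tensorAll_conjTranspose, tensorAll_mul]
  simp_rw [iso_conjTranspose_mul_iso]
  exact tensorAll_one

/-- The isometric parts of the tensors at the two ends of an edge. -/
def edgeIso (e : G.edgeSet) :
    Matrix (Fin d × Fin d) (Virt G D (P.src e) × Virt G D (P.tgt e)) ℂ :=
  P.iso (P.src e) ⊗ₖ P.iso (P.tgt e)

theorem edgeIso_conjTranspose_mul (e : G.edgeSet) : (P.edgeIso e)ᴴ * P.edgeIso e = 1 := by
  rw [edgeIso, Matrix.conjTranspose_kronecker, ← Matrix.mul_kronecker_mul,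
    iso_conjTranspose_mul_iso, iso_conjTranspose_mul_iso, Matrix.one_kronecker_one]

/-- The operators on the virtual spaces at the two ends of an edge, as operators on the virtual
space of all vertices. -/
def vpair (e : G.edgeSet) :
    Matrix (Virt G D (P.src e) × Virt G D (P.tgt e)) (Virt G D (P.src e) × Virt G D (P.tgt e)) ℂ
      →⋆ₐ[ℂ] P.VOp :=
  pair (P.src_ne_tgt e)

theorem pairOp_mul_globalIso (e : G.edgeSet)
    (M : Matrix (Virt G D (P.src e) × Virt G D (P.tgt e))
      (Virt G D (P.src e) × Virt G D (P.tgt e)) ℂ) :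
    pairOp (P.src e) (P.tgt e) (P.edgeIso e * M * (P.edgeIso e)ᴴ) * P.globalIso =
      P.globalIso * P.vpair e M := by
  rw [pairOp_eq_pair (P.src_ne_tgt e)]
  exact pair_mul_tensorAll (P.src_ne_tgt e) (P.iso_conjTranspose_mul_iso _)
    (P.iso_conjTranspose_mul_iso _) M

/-! ### Bonds -/

/-- `bondOp` as a representation. -/
def bondHom (e : G.edgeSet) :
    Matrix (Fin D × Fin D) (Fin D × Fin D) ℂ →⋆ₐ[ℂ]
      Matrix (Virt G D (P.src e) × Virt G D (P.tgt e))
        (Virt G D (P.src e) × Virt G D (P.tgt e)) ℂ :=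
  kronHom
    { toFun := P.bondOp e
      map_add' := fun M M' => by
        ext u w
        simp only [bondOp, Matrix.add_apply]
        split_ifs <;> simp
      map_smul' := fun c M => by
        ext u w
        simp only [bondOp, Matrix.smul_apply, RingHom.id_apply]
        split_ifs <;> simp }
    (kronLeft.comp (site (α := fun _ => Fin D) (P.srcBond e)))
    (kronRight.comp (site (α := fun _ => Fin D) (P.tgtBond e)))
    (fun X Y => by
      rw [StarAlgHom.comp_apply, StarAlgHom.comp_apply, kronLeft_mul_kronRight]
      ext u w
      simp only [LinearMap.coe_mk, AddHom.coe_mk, bondOp, Matrix.kroneckerMap_apply, site_apply]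
      split_ifs <;> simp_all)
    (fun X Y => kronLeft_commute_kronRight _ _)

theorem bondHom_apply (e : G.edgeSet) (M : Matrix (Fin D × Fin D) (Fin D × Fin D) ℂ) :
    P.bondHom e M = P.bondOp e M := rfl

theorem bondHom_kronecker (e : G.edgeSet) (X Y : Matrix (Fin D) (Fin D) ℂ) :
    P.bondHom e (X ⊗ₖ Y) =
      site (α := fun _ => Fin D) (P.srcBond e) X ⊗ₖ site (α := fun _ => Fin D) (P.tgtBond e) Y := by
  rw [bondHom_apply]
  ext u w
  simp only [bondOp, Matrix.kroneckerMap_apply, site_apply]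
  split_ifs <;> simp_all

/-- The operators on the two virtual qudits of an edge, represented on the virtual space. -/
def bond (e : G.edgeSet) : Matrix (Fin D × Fin D) (Fin D × Fin D) ℂ →⋆ₐ[ℂ] P.VOp :=
  (P.vpair e).comp (P.bondHom e)

/-- The operators on the virtual qudit `b` at the vertex `i`. -/
def qudit (i : Fin N) (b : G.neighborSet i) : Matrix (Fin D) (Fin D) ℂ →⋆ₐ[ℂ] P.VOp :=
  (site (α := fun i => Virt G D i) i).comp (site (α := fun _ => Fin D) b)

theorem qudit_apply (i : Fin N) (b : G.neighborSet i) (X : Matrix (Fin D) (Fin D) ℂ) :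
    P.qudit i b X = site (α := fun i => Virt G D i) i (site (α := fun _ => Fin D) b X) := rfl

theorem bond_kronecker (e : G.edgeSet) (X Y : Matrix (Fin D) (Fin D) ℂ) :
    P.bond e (X ⊗ₖ Y) = P.qudit _ (P.srcBond e) X * P.qudit _ (P.tgtBond e) Y := by
  rw [bond, StarAlgHom.comp_apply, bondHom_kronecker, vpair, pair_kronecker]
  rfl

theorem qudit_commute {i j : Fin N} {b : G.neighborSet i} {c : G.neighborSet j}
    (h : s(i, b.1) ≠ s(j, c.1)) (X Y : Matrix (Fin D) (Fin D) ℂ) :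
    Commute (P.qudit i b X) (P.qudit j c Y) := by
  rcases eq_or_ne i j with rfl | hij
  · have hbc : b ≠ c := by rintro rfl; exact h rfl
    have h1 := site_commute (α := fun _ => Fin D) hbc X Y
    rw [qudit_apply, qudit_apply]
    exact h1.map (site (α := fun i => Virt G D i) i)
  · rw [qudit_apply, qudit_apply]
    exact site_commute hij _ _

theorem srcBond_edge (e : G.edgeSet) : s(P.src e, (P.srcBond e).1) = e.1 := P.orient_edge e

theorem tgtBond_edge (e : G.edgeSet) : s(P.tgt e, (P.tgtBond e).1) = e.1 := by
  rw [← P.orient_edge e]; exact Sym2.eq_swap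

theorem commute_bond {e : G.edgeSet} {c : P.VOp} (hs : ∀ X, Commute (P.qudit _ (P.srcBond e) X) c)
    (ht : ∀ X, Commute (P.qudit _ (P.tgtBond e) X) c)
    (M : Matrix (Fin D × Fin D) (Fin D × Fin D) ℂ) : Commute (P.bond e M) c := by
  induction M using kronecker_induction with
  | hadd M M' h h' => rw [map_add]; exact h.add_left h'
  | hsmul c M h => rw [map_smul]; exact h.smul_left c
  | hkron X Y => rw [bond_kronecker]; exact (hs X).mul_left (ht Y)

theorem bond_commute_bond {e f : G.edgeSet} (h : e ≠ f)
    (M M' : Matrix (Fin D × Fin D) (Fin D × Fin D) ℂ) : Commute (P.bond e M) (P.bond f M') := by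
  have h' : e.1 ≠ f.1 := fun h1 => h (Subtype.ext h1)
  refine P.commute_bond (fun X => ?_) (fun X => ?_) M <;>
    refine (P.commute_bond (fun Y => ?_) (fun Y => ?_) M').symm <;>
    apply P.qudit_commute <;>
    simp only [srcBond_edge, tgtBond_edge] <;> exact h'.symm

theorem bond_commute_site {e : G.edgeSet} {l : Fin N} (hs : P.src e ≠ l) (ht : P.tgt e ≠ l)
    (M : Matrix (Fin D × Fin D) (Fin D × Fin D) ℂ) (X : Matrix (Virt G D l) (Virt G D l) ℂ) :
    Commute (P.bond e M) (site (α := fun i => Virt G D i) l X) :=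
  pair_commute_site (P.src_ne_tgt e) hs ht _ _

/-- The jump `|φ₀⟩⟨φ_α|` on a bond. -/
def bareJump (α : Fin (D ^ 2 - 1)) : Matrix (Fin D × Fin D) (Fin D × Fin D) ℂ :=
  Matrix.vecMulVec (P.φ₀ : Fin D × Fin D → ℂ) (star (P.φ α : Fin D × Fin D → ℂ))

/-- The projector `∑_α |φ_α⟩⟨φ_α|` onto the complement of the bond state. -/
def bareProj : Matrix (Fin D × Fin D) (Fin D × Fin D) ℂ :=
  ∑ α, Matrix.vecMulVec (P.φ α : Fin D × Fin D → ℂ) (star (P.φ α : Fin D × Fin D → ℂ))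

theorem star_φ₀_dotProduct : star (P.φ₀ : Fin D × Fin D → ℂ) ⬝ᵥ P.φ₀ = 1 := by
  have h := inner_self_eq_norm_sq_to_K (𝕜 := ℂ) P.φ₀
  rw [EuclideanSpace.inner_eq_star_dotProduct, P.norm_φ₀] at h
  rw [dotProduct_comm]
  simpa using h

theorem star_φ_dotProduct (α β : Fin (D ^ 2 - 1)) :
    star (P.φ α : Fin D × Fin D → ℂ) ⬝ᵥ P.φ β = if α = β then 1 else 0 := by
  have h := orthonormal_iff_ite.1 P.orthonormal_φ α β
  rw [EuclideanSpace.inner_eq_star_dotProduct] at h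
  rw [dotProduct_comm]
  exact h

theorem star_φ₀_dotProduct_φ (α : Fin (D ^ 2 - 1)) :
    star (P.φ₀ : Fin D × Fin D → ℂ) ⬝ᵥ P.φ α = 0 := by
  have h := P.orthogonal_φ₀ α
  rw [EuclideanSpace.inner_eq_star_dotProduct] at h
  rw [dotProduct_comm]
  exact h

theorem star_φ_dotProduct_φ₀ (α : Fin (D ^ 2 - 1)) :
    star (P.φ α : Fin D × Fin D → ℂ) ⬝ᵥ P.φ₀ = 0 := by
  rw [Matrix.star_dotProduct, star_φ₀_dotProduct_φ, star_zero]

/-- The bond states resolve the identity. -/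
theorem vecMulVec_add_bareProj :
    Matrix.vecMulVec (P.φ₀ : Fin D × Fin D → ℂ) (star (P.φ₀ : Fin D × Fin D → ℂ)) + P.bareProj =
      1 := by
  obtain ⟨x⟩ := P.nonempty_fin
  have hD : 0 < D := x.pos
  -- The columns of `F` are the bond states. They are orthonormal, and there are as many columns as
  -- rows.
  let F : Matrix (Fin D × Fin D) (Option (Fin (D ^ 2 - 1))) ℂ :=
    Matrix.of fun x a => Option.elim a (P.φ₀ x) fun α => P.φ α x
  have h1 : Fᴴ * F = 1 := by
    ext a b
    have := P.star_φ₀_dotProduct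
    have h2 := P.star_φ_dotProduct
    have h3 := P.star_φ₀_dotProduct_φ
    have h4 := P.star_φ_dotProduct_φ₀
    simp only [dotProduct, Pi.star_apply, RCLike.star_def] at this h2 h3 h4
    cases a <;> cases b <;>
      simp [F, Matrix.mul_apply, Matrix.one_apply, this, h2, h3, h4]
  have hcard : Fintype.card (Option (Fin (D ^ 2 - 1))) = Fintype.card (Fin D × Fin D) := by
    have : 0 < D ^ 2 := by positivity
    simp only [Fintype.card_option, Fintype.card_fin, Fintype.card_prod]
    rw [Nat.sub_add_cancel this, sq]
  have h2 : F * Fᴴ = 1 := (Matrix.mul_eq_one_comm_of_card_eq _ _ ℂ hcard).1 h1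
  rw [← h2]
  ext x y
  simp [F, Matrix.mul_apply, bareProj, Matrix.vecMulVec_apply, Matrix.sum_apply]

end InjectivePEPS

/-! ### Maps in Kraus form -/

section Kraus

variable {n : Type*} [Fintype n] [DecidableEq n] {κ : Type*} [Fintype κ]

/-- The map `X ↦ ∑ a, K_a X K_a†`. -/
def krausMap (K : κ → Matrix n n ℂ) : Module.End ℂ (Matrix n n ℂ) :=
  ∑ a, LinearMap.mulLeftRight ℂ (K a, (K a)ᴴ)

theorem krausMap_apply (K : κ → Matrix n n ℂ) (X : Matrix n n ℂ) :
    krausMap K X = ∑ a, K a * X * (K a)ᴴ := by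
  simp [krausMap, LinearMap.sum_apply, LinearMap.mulLeftRight_apply]

theorem krausMap_posSemidef (K : κ → Matrix n n ℂ) {X : Matrix n n ℂ} (hX : X.PosSemidef) :
    (krausMap K X).PosSemidef := by
  rw [krausMap_apply]
  exact Matrix.posSemidef_sum _ fun a _ => hX.mul_mul_conjTranspose_same (K a)

theorem trace_mul_krausMap (K : κ → Matrix n n ℂ) (a X : Matrix n n ℂ) :
    (a * krausMap K X).trace = ((∑ b, (K b)ᴴ * a * K b) * X).trace := by
  rw [krausMap_apply, Finset.mul_sum, Finset.sum_mul, Matrix.trace_sum, Matrix.trace_sum]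
  refine Finset.sum_congr rfl fun b _ => ?_
  rw [← Matrix.mul_assoc, ← Matrix.mul_assoc, Matrix.trace_mul_comm]
  simp only [Matrix.mul_assoc]

theorem trace_krausMap (K : κ → Matrix n n ℂ) (hK : ∑ b, (K b)ᴴ * K b = 1) (X : Matrix n n ℂ) :
    (krausMap K X).trace = X.trace := by
  have := trace_mul_krausMap K 1 X
  simpa [hK] using this

end Kraus

theorem BondJumps.map {A B : Type*} [Ring A] [StarRing A] [Algebra ℂ A] [Ring B] [StarRing B]
    [Algebra ℂ B] {κ : Type*} [Fintype κ] {J : κ → A} {Q : A} (h : BondJumps J Q)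
    (f : A →⋆ₐ[ℂ] B) : BondJumps (fun α => f (J α)) (f Q) where
  isSelfAdjoint := by rw [IsSelfAdjoint, ← map_star, h.isSelfAdjoint.star_eq]
  idem := by rw [← map_mul, h.idem]
  sum_star_mul := by
    simp only [← map_star, ← map_mul, ← map_sum]
    rw [h.sum_star_mul]
  proj_mul α := by rw [← map_mul, h.proj_mul, map_zero]
  mul_proj α := by rw [← map_mul, h.mul_proj]

namespace InjectivePEPS

variable {N : ℕ} {G : SimpleGraph (Fin N)} [DecidableRel G.Adj] {d D : ℕ}
  (P : InjectivePEPS G d D)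

/-! ### The channels in the virtual picture -/

theorem bareProj_mul_φ (α : Fin (D ^ 2 - 1)) :
    P.bareProj *ᵥ (P.φ α : Fin D × Fin D → ℂ) = P.φ α := by
  simp only [bareProj, Matrix.sum_mulVec, Matrix.vecMulVec_mulVec, star_φ_dotProduct]
  simp

theorem bareProj_mul_φ₀ : P.bareProj *ᵥ (P.φ₀ : Fin D × Fin D → ℂ) = 0 := by
  simp only [bareProj, Matrix.sum_mulVec, Matrix.vecMulVec_mulVec, star_φ_dotProduct_φ₀]
  simp

theorem bareProj_isHermitian : (P.bareProj)ᴴ = P.bareProj := by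
  simp [bareProj, Matrix.conjTranspose_sum, Matrix.conjTranspose_vecMulVec]

theorem bareJumps : BondJumps P.bareJump P.bareProj where
  isSelfAdjoint := P.bareProj_isHermitian
  idem := by
    conv_lhs => rhs; rw [bareProj]
    simp only [Finset.mul_sum, Matrix.mul_vecMulVec, bareProj_mul_φ]
    rfl
  sum_star_mul := by
    refine Finset.sum_congr rfl fun α _ => ?_
    rw [Matrix.star_eq_conjTranspose, bareJump, Matrix.conjTranspose_vecMulVec, star_star,
      Matrix.vecMulVec_mul_vecMulVec, star_φ₀_dotProduct, one_smul]
  proj_mul α := by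
    rw [bareJump, Matrix.mul_vecMulVec, bareProj_mul_φ₀, Matrix.zero_vecMulVec]
  mul_proj α := by
    have h : star (P.φ α : Fin D × Fin D → ℂ) ᵥ* P.bareProj = star (P.φ α : Fin D × Fin D → ℂ) := by
      have := congrArg star (P.bareProj_mul_φ α)
      rwa [Matrix.star_mulVec, bareProj_isHermitian] at this
    rw [bareJump, Matrix.vecMulVec_mul, h]

/-- The jump operator of an edge, transported to the virtual qudits at its ends by the polar
isometries. -/
def pairJump (e : G.edgeSet) (α : Fin (D ^ 2 - 1)) :
    Matrix (Virt G D (P.src e) × Virt G D (P.tgt e))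
      (Virt G D (P.src e) × Virt G D (P.tgt e)) ℂ :=
  conjJump (P.root (P.src e) ⊗ₖ P.root (P.tgt e)) (P.rootInv (P.src e) ⊗ₖ P.rootInv (P.tgt e))
    (fun α => P.bondHom e (P.bareJump α)) α

/-- The jump rate `∑ α, L_α† L_α = 2 H_eff` of an edge, in terms of `pairJump`. -/
def pairRate (e : G.edgeSet) :
    Matrix (Virt G D (P.src e) × Virt G D (P.tgt e))
      (Virt G D (P.src e) × Virt G D (P.tgt e)) ℂ :=
  jumpRate (P.root (P.src e) ⊗ₖ P.root (P.tgt e)) (P.rootInv (P.src e) ⊗ₖ P.rootInv (P.tgt e))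
    (fun α => P.bondHom e (P.bareJump α))

theorem pairRate_eq (e : G.edgeSet) :
    P.pairRate e = ∑ α, (P.pairJump e α)ᴴ * P.pairJump e α := rfl

theorem jump_eq (e : G.edgeSet) (α : Fin (D ^ 2 - 1)) :
    P.jump e α = P.edgeIso e * P.pairJump e α * (P.edgeIso e)ᴴ := by
  rw [jump, pinv_A, pinv_A, ← iso_mul_root, ← iso_mul_root, Matrix.mul_kronecker_mul,
    Matrix.mul_kronecker_mul, pairJump, conjJump, edgeIso, Matrix.conjTranspose_kronecker,
    ← bondHom_apply]
  simp only [Matrix.mul_assoc]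
  rfl

theorem two_mul_smul_Heff (Γ : ℝ) (e : G.edgeSet) :
    (2 * Γ : ℂ) • P.Heff e = P.edgeIso e * (Γ • P.pairRate e) * (P.edgeIso e)ᴴ := by
  have h : ∀ α, (P.jump e α)ᴴ * P.jump e α =
      P.edgeIso e * ((P.pairJump e α)ᴴ * P.pairJump e α) * (P.edgeIso e)ᴴ := by
    intro α
    rw [jump_eq, Matrix.conjTranspose_mul, Matrix.conjTranspose_mul,
      Matrix.conjTranspose_conjTranspose]
    calc _ = P.edgeIso e * ((P.pairJump e α)ᴴ * (((P.edgeIso e)ᴴ * P.edgeIso e) *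
          P.pairJump e α)) * (P.edgeIso e)ᴴ := by simp only [Matrix.mul_assoc]
      _ = _ := by rw [edgeIso_conjTranspose_mul, Matrix.one_mul]
  rw [Heff, Finset.sum_congr rfl fun α _ => h α, ← Matrix.sum_mul, ← Matrix.mul_sum,
    ← pairRate_eq, smul_smul, Matrix.mul_smul, Matrix.smul_mul]
  ext x y
  simp only [Matrix.smul_apply, smul_eq_mul, Complex.real_smul]
  ring

/-- The projector onto the complement of the image of `edgeIso`, on which the jumps of the edge
vanish. -/
theorem one_sub_edgeIso_posSemidef (e : G.edgeSet) :
    (1 - P.edgeIso e * (P.edgeIso e)ᴴ).PosSemidef := by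
  have h : (1 - P.edgeIso e * (P.edgeIso e)ᴴ)ᴴ * (1 - P.edgeIso e * (P.edgeIso e)ᴴ) =
      1 - P.edgeIso e * (P.edgeIso e)ᴴ := by
    have h1 : P.edgeIso e * (P.edgeIso e)ᴴ * (P.edgeIso e * (P.edgeIso e)ᴴ) =
        P.edgeIso e * (P.edgeIso e)ᴴ := by
      calc _ = P.edgeIso e * (((P.edgeIso e)ᴴ * P.edgeIso e) * (P.edgeIso e)ᴴ) := by
            simp only [Matrix.mul_assoc]
        _ = _ := by rw [edgeIso_conjTranspose_mul, Matrix.one_mul]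
    rw [Matrix.conjTranspose_sub, Matrix.conjTranspose_one, Matrix.conjTranspose_mul,
      Matrix.conjTranspose_conjTranspose, mul_sub, sub_mul, sub_mul, h1]
    simp
  rw [← h]
  exact Matrix.posSemidef_conjTranspose_mul_self _

theorem one_sub_two_mul_smul_Heff (Γ : ℝ) (e : G.edgeSet) :
    1 - (2 * Γ : ℂ) • P.Heff e =
      P.edgeIso e * (1 - Γ • P.pairRate e) * (P.edgeIso e)ᴴ +
        (1 - P.edgeIso e * (P.edgeIso e)ᴴ) := by
  rw [two_mul_smul_Heff, Matrix.mul_sub, Matrix.sub_mul, Matrix.mul_one]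
  abel

theorem one_sub_two_mul_smul_Heff_posSemidef {Γ : ℝ} {e : G.edgeSet}
    (h : (1 - Γ • P.pairRate e).PosSemidef) : (1 - (2 * Γ : ℂ) • P.Heff e).PosSemidef := by
  rw [one_sub_two_mul_smul_Heff]
  exact (h.mul_mul_conjTranspose_same _).add (P.one_sub_edgeIso_posSemidef e)

/-- The no-jump Kraus operator on the virtual qudits at the ends of an edge. -/
def pairKraus (Γ : ℝ) (e : G.edgeSet) :
    Matrix (Virt G D (P.src e) × Virt G D (P.tgt e))
      (Virt G D (P.src e) × Virt G D (P.tgt e)) ℂ :=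
  CFC.sqrt (1 - Γ • P.pairRate e)

theorem pairKraus_posSemidef (Γ : ℝ) (e : G.edgeSet) : (P.pairKraus Γ e).PosSemidef :=
  Matrix.nonneg_iff_posSemidef.1 (CFC.sqrt_nonneg _)

theorem pairKraus_mul_self {Γ : ℝ} {e : G.edgeSet} (h : (1 - Γ • P.pairRate e).PosSemidef) :
    P.pairKraus Γ e * P.pairKraus Γ e = 1 - Γ • P.pairRate e :=
  CFC.sqrt_mul_sqrt_self _ (Matrix.nonneg_iff_posSemidef.2 h)

/-- The no-jump Kraus operator acts as `pairKraus` on the image of `edgeIso` and as the identity on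
its complement. -/
theorem kraus₀_eq {Γ : ℝ} {e : G.edgeSet} (h : (1 - Γ • P.pairRate e).PosSemidef) :
    P.kraus₀ Γ e = P.edgeIso e * P.pairKraus Γ e * (P.edgeIso e)ᴴ +
      (1 - P.edgeIso e * (P.edgeIso e)ᴴ) := by
  have hV := P.edgeIso_conjTranspose_mul e
  apply CFC.sqrt_unique
  · rw [one_sub_two_mul_smul_Heff, ← P.pairKraus_mul_self h]
    generalize P.edgeIso e = V at *
    generalize P.pairKraus Γ e = s at *
    have h1 : V * s * Vᴴ * (V * s * Vᴴ) = V * (s * s) * Vᴴ := by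
      calc _ = V * (s * ((Vᴴ * V) * s)) * Vᴴ := by simp only [Matrix.mul_assoc]
        _ = _ := by rw [hV, Matrix.one_mul]
    have h2 : V * s * Vᴴ * (V * Vᴴ) = V * s * Vᴴ := by
      calc _ = V * s * ((Vᴴ * V) * Vᴴ) := by simp only [Matrix.mul_assoc]
        _ = _ := by rw [hV, Matrix.one_mul]
    have h3 : V * Vᴴ * (V * s * Vᴴ) = V * s * Vᴴ := by
      calc _ = V * ((Vᴴ * V) * s) * Vᴴ := by simp only [Matrix.mul_assoc]
        _ = _ := by rw [hV, Matrix.one_mul]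
    have h4 : V * Vᴴ * (V * Vᴴ) = V * Vᴴ := by
      calc _ = V * ((Vᴴ * V) * Vᴴ) := by simp only [Matrix.mul_assoc]
        _ = _ := by rw [hV, Matrix.one_mul]
    simp only [add_mul, mul_add, mul_sub, sub_mul, h1, h2, h3, h4, mul_one, one_mul]
    abel
  · rw [Matrix.nonneg_iff_posSemidef]
    exact ((P.pairKraus_posSemidef Γ e).mul_mul_conjTranspose_same _).add
      (P.one_sub_edgeIso_posSemidef e)

/-- The deformed jump operators on the virtual space. -/
def vJump (e : G.edgeSet) (α : Fin (D ^ 2 - 1)) : P.VOp := P.vpair e (P.pairJump e α)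

/-- The no-jump Kraus operator on the virtual space. -/
def vKraus₀ (Γ : ℝ) (e : G.edgeSet) : P.VOp := P.vpair e (P.pairKraus Γ e)

/-- All Kraus operators of an edge channel, on the virtual space. -/
def vKraus (Γ : ℝ) (e : G.edgeSet) (o : Option (Fin (D ^ 2 - 1))) : P.VOp :=
  o.elim (P.vKraus₀ Γ e) fun α => (Real.sqrt Γ : ℂ) • P.vJump e α

/-- The edge channel on the virtual space. -/
def vEdgeChannel (Γ : ℝ) (e : G.edgeSet) : Module.End ℂ P.VOp := krausMap (P.vKraus Γ e)

/-- The map `σ ↦ W σ W†` from the virtual to the physical space. -/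
def lift (σ : P.VOp) : Op N d := P.globalIso * σ * P.globalIsoᴴ

theorem lift_add (σ τ : P.VOp) : P.lift (σ + τ) = P.lift σ + P.lift τ := by
  simp [lift, Matrix.mul_add, Matrix.add_mul]

theorem lift_sum {κ : Type*} (s : Finset κ) (σ : κ → P.VOp) :
    P.lift (∑ a ∈ s, σ a) = ∑ a ∈ s, P.lift (σ a) := by
  simp [lift, Matrix.mul_sum, Matrix.sum_mul]

theorem lift_smul (c : ℂ) (σ : P.VOp) : P.lift (c • σ) = c • P.lift σ := by
  simp [lift]

theorem pairOp_kraus₀_mul {Γ : ℝ} {e : G.edgeSet} (h : (1 - Γ • P.pairRate e).PosSemidef) :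
    pairOp (P.src e) (P.tgt e) (P.kraus₀ Γ e) * P.globalIso = P.globalIso * P.vKraus₀ Γ e := by
  have h1 := P.pairOp_mul_globalIso e 1
  rw [Matrix.mul_one, map_one, Matrix.mul_one] at h1
  rw [P.kraus₀_eq h, pairOp_eq_pair (P.src_ne_tgt e), map_add, map_sub, map_one, Matrix.add_mul,
    Matrix.sub_mul, ← pairOp_eq_pair, ← pairOp_eq_pair, pairOp_mul_globalIso, h1, Matrix.one_mul,
    sub_self, add_zero]
  rfl

theorem pairOp_kraus_mul (Γ : ℝ) (e : G.edgeSet) (α : Fin (D ^ 2 - 1)) :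
    pairOp (P.src e) (P.tgt e) (P.kraus Γ e α) * P.globalIso =
      P.globalIso * ((Real.sqrt Γ : ℂ) • P.vJump e α) := by
  rw [kraus, jump_eq, pairOp_eq_pair (P.src_ne_tgt e), map_smul, Matrix.smul_mul,
    ← pairOp_eq_pair, pairOp_mul_globalIso, Matrix.mul_smul]
  rfl

theorem sandwich_lift {e : G.edgeSet} {K : Matrix (Fin d × Fin d) (Fin d × Fin d) ℂ} {k : P.VOp}
    (h : pairOp (P.src e) (P.tgt e) K * P.globalIso = P.globalIso * k) (σ : P.VOp) :
    P.sandwich e K (P.lift σ) = P.lift (k * σ * kᴴ) := by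
  have h' := congrArg Matrix.conjTranspose h
  rw [Matrix.conjTranspose_mul, Matrix.conjTranspose_mul] at h'
  rw [sandwich, LinearMap.mulLeftRight_apply, lift, lift]
  calc _ = (pairOp (P.src e) (P.tgt e) K * P.globalIso) * σ *
        (P.globalIsoᴴ * (pairOp (P.src e) (P.tgt e) K)ᴴ) := by simp only [Matrix.mul_assoc]
    _ = _ := by rw [h, h']; simp only [Matrix.mul_assoc]

/-- The edge channel maps operators in the image of `globalIso` to such operators, and acts there as
the virtual edge channel. -/
theorem edgeChannel_lift {Γ : ℝ} {e : G.edgeSet} (h : (1 - Γ • P.pairRate e).PosSemidef)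
    (σ : P.VOp) : P.edgeChannel Γ e (P.lift σ) = P.lift (P.vEdgeChannel Γ e σ) := by
  rw [edgeChannel, LinearMap.add_apply, LinearMap.sum_apply,
    P.sandwich_lift (P.pairOp_kraus₀_mul h), vEdgeChannel, krausMap_apply, Fintype.sum_option,
    lift_add, lift_sum]
  congr 1
  exact Finset.sum_congr rfl fun α _ => P.sandwich_lift (P.pairOp_kraus_mul Γ e α) σ

/-- The product of the edge channels of one class, on the virtual space. -/
def vClassChannel (Γ : ℝ) {k : ℕ} (c : EdgePartition G k) (q : Fin k) : Module.End ℂ P.VOp :=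
  (((Finset.univ.filter fun e : G.edgeSet => c.cls e = q).toList).map (P.vEdgeChannel Γ)).prod

/-- The average of the channels of all classes, on the virtual space. -/
def vChannel (Γ : ℝ) {k : ℕ} (c : EdgePartition G k) : Module.End ℂ P.VOp :=
  (k : ℂ)⁻¹ • ∑ q, P.vClassChannel Γ c q

theorem list_prod_lift {Γ : ℝ} (h : ∀ e, (1 - Γ • P.pairRate e).PosSemidef) (l : List G.edgeSet)
    (σ : P.VOp) :
    (l.map (P.edgeChannel Γ)).prod (P.lift σ) = P.lift ((l.map (P.vEdgeChannel Γ)).prod σ) := by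
  induction l with
  | nil => simp
  | cons e l ih =>
    rw [List.map_cons, List.prod_cons, Module.End.mul_apply, ih, P.edgeChannel_lift (h e),
      List.map_cons, List.prod_cons, Module.End.mul_apply]

theorem average_lift {Γ : ℝ} (h : ∀ e, (1 - Γ • P.pairRate e).PosSemidef) {k : ℕ}
    (c : EdgePartition G k) (σ : P.VOp) :
    ((k : ℂ)⁻¹ • ∑ q, P.classChannel Γ c q) (P.lift σ) = P.lift (P.vChannel Γ c σ) := by
  rw [vChannel, LinearMap.smul_apply, LinearMap.smul_apply, lift_smul, LinearMap.sum_apply,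
    LinearMap.sum_apply, lift_sum]
  congr 1
  exact Finset.sum_congr rfl fun q _ => P.list_prod_lift h _ σ

end InjectivePEPS

/-! ### The energy of the bonds and its evolution -/

section LocalEnergy

open scoped Matrix.Norms.L2Operator

theorem NearOne.map {A B : Type*} [CStarAlgebra A] [CStarAlgebra B] {q p : A} {ε : ℝ}
    (h : NearOne q p ε) (f : A →⋆ₐ[ℂ] B) : NearOne (f q) (f p) ε where
  left_sa := by rw [IsSelfAdjoint, ← map_star, h.left_sa.star_eq]
  right_sa := by rw [IsSelfAdjoint, ← map_star, h.right_sa.star_eq]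
  mul_inv := by rw [← map_mul, h.mul_inv, map_one]
  inv_mul := by rw [← map_mul, h.inv_mul, map_one]
  norm_sq_sub_one := by
    rw [← map_mul, ← map_one f, ← map_sub]
    exact (NonUnitalStarAlgHom.norm_apply_le f _).trans h.norm_sq_sub_one
  norm_inv_sq_sub_one := by
    rw [← map_mul, ← map_one f, ← map_sub]
    exact (NonUnitalStarAlgHom.norm_apply_le f _).trans h.norm_inv_sq_sub_one

/-- The inverse of an element `δ`-close to `1` is `2δ`-close to `1`. -/
theorem norm_inv_sub_one_le {A : Type*} [NormedRing A] {x y : A} {δ : ℝ} (hδ : δ ≤ 1 / 2)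
    (hyx : y * x = 1) (hx : ‖x - 1‖ ≤ δ) : ‖y - 1‖ ≤ 2 * δ := by
  have e : y - 1 = -((y - 1) * (x - 1)) - (x - 1) := by
    have : (y - 1) * (x - 1) = y * x - y - x + 1 := by noncomm_ring
    rw [this, hyx]; abel
  have h2 : ‖y - 1‖ ≤ ‖y - 1‖ * ‖x - 1‖ + ‖x - 1‖ := by
    conv_lhs => rw [e]
    refine (norm_sub_le _ _).trans ?_
    rw [norm_neg]
    gcongr
    exact norm_mul_le _ _
  have h3 : ‖y - 1‖ * ‖x - 1‖ ≤ ‖y - 1‖ * (1 / 2) := by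
    gcongr; exact hx.trans hδ
  linarith

namespace InjectivePEPS

variable {N : ℕ} {G : SimpleGraph (Fin N)} [DecidableRel G.Adj] {d D : ℕ}
  (P : InjectivePEPS G d D) {δ Γ : ℝ}

theorem nonempty_vConf : Nonempty P.VConf := by
  obtain ⟨x⟩ := P.nonempty_fin
  exact ⟨fun _ _ => x⟩

theorem nearOne_root (hP : P.NearIsometric δ) (hδ : δ ≤ 1 / 2) (i : Fin N) :
    NearOne (P.root i) (P.rootInv i) (2 * δ) where
  left_sa := P.root_isHermitian i
  right_sa := P.rootInv_isHermitian i
  mul_inv := P.root_mul_rootInv i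
  inv_mul := P.rootInv_mul_root i
  norm_sq_sub_one := by
    have h : ‖P.root i * P.root i - 1‖ ≤ δ := by rw [root_mul_root]; exact hP i
    linarith [norm_nonneg (P.root i * P.root i - 1)]
  norm_inv_sq_sub_one := by
    have h : ‖P.root i * P.root i - 1‖ ≤ δ := by rw [root_mul_root]; exact hP i
    refine norm_inv_sub_one_le hδ ?_ h
    calc _ = P.rootInv i * (P.rootInv i * P.root i) * P.root i := by noncomm_ring
      _ = 1 := by rw [rootInv_mul_root, Matrix.mul_one, rootInv_mul_root]

theorem pairBondJumps (e : G.edgeSet) :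
    BondJumps (fun α => P.bondHom e (P.bareJump α)) (P.bondHom e P.bareProj) :=
  P.bareJumps.map _

theorem nearOne_pair (hP : P.NearIsometric δ) (hδ : δ ≤ 1 / 2) (e : G.edgeSet) :
    NearOne (P.root (P.src e) ⊗ₖ P.root (P.tgt e)) (P.rootInv (P.src e) ⊗ₖ P.rootInv (P.tgt e))
      (3 * (2 * δ)) := by
  obtain ⟨x⟩ := P.nonempty_fin
  have : Nonempty (Virt G D (P.src e)) := ⟨fun _ => x⟩
  have : Nonempty (Virt G D (P.tgt e)) := ⟨fun _ => x⟩
  rw [← kronLeft_mul_kronRight, ← kronLeft_mul_kronRight]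
  have h1 := (P.nearOne_root hP hδ (P.src e)).map (kronLeft (n := Virt G D (P.tgt e)))
  have h2 := (P.nearOne_root hP hδ (P.tgt e)).map (kronRight (m := Virt G D (P.src e)))
  exact NearOne.mul h1 h2 (by linarith) (kronLeft_commute_kronRight _ _)
    (kronLeft_commute_kronRight _ _)

theorem one_sub_pairRate_posSemidef (hP : P.NearIsometric δ) (hδ0 : 0 ≤ δ) (hδ : δ ≤ 1 / 24)
    (hΓ0 : 0 ≤ Γ) (hΓ : Γ ≤ 1 / 2) (e : G.edgeSet) : (1 - Γ • P.pairRate e).PosSemidef := by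
  have h : P.pairRate e ≤ (2 : ℝ) • 1 :=
    (P.pairBondJumps e).jumpRate_le_two (P.nearOne_pair hP (by linarith) e) (by linarith)
      (by linarith)
  have h1 := smul_le_smul_real hΓ0 h
  have h2 : (Γ * 2) • (1 : Matrix (Virt G D (P.src e) × Virt G D (P.tgt e))
      (Virt G D (P.src e) × Virt G D (P.tgt e)) ℂ) ≤ (1 : ℝ) • 1 :=
    smul_le_smul_coeff (by linarith) zero_le_one
  rw [smul_smul] at h1
  rw [one_smul] at h2
  exact Matrix.nonneg_iff_posSemidef.1 (sub_nonneg.2 (h1.trans h2))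

/-- The positive part of the tensor at `i` as an operator on the virtual space. -/
def vRoot (i : Fin N) : P.VOp := site (α := fun i => Virt G D i) i (P.root i)

/-- The inverse of `vRoot`. -/
def vRootInv (i : Fin N) : P.VOp := site (α := fun i => Virt G D i) i (P.rootInv i)

/-- The energy of a bond. Its kernel consists of the vectors annihilated by all jumps of the
edge. -/
def energy (e : G.edgeSet) : P.VOp :=
  bondEnergy (P.vRootInv (P.src e) * P.vRootInv (P.tgt e)) (P.bond e P.bareProj)

theorem nearOne_vRoot (hP : P.NearIsometric δ) (hδ : δ ≤ 1 / 2) (i : Fin N) :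
    NearOne (P.vRoot i) (P.vRootInv i) (2 * δ) := (P.nearOne_root hP hδ i).map _

theorem vRoot_commute {i j : Fin N} (h : i ≠ j) : Commute (P.vRoot i) (P.vRoot j) :=
  site_commute h _ _

theorem vRootInv_commute {i j : Fin N} (h : i ≠ j) : Commute (P.vRootInv i) (P.vRootInv j) :=
  site_commute h _ _

theorem vRootInv_commute_vRoot {i j : Fin N} (h : i ≠ j) :
    Commute (P.vRootInv i) (P.vRoot j) :=
  site_commute h _ _

theorem vBondJumps (e : G.edgeSet) :
    BondJumps (fun α => P.bond e (P.bareJump α)) (P.bond e P.bareProj) :=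
  P.bareJumps.map _

theorem vpair_kronecker (e : G.edgeSet) (X : Matrix (Virt G D (P.src e)) (Virt G D (P.src e)) ℂ)
    (Y : Matrix (Virt G D (P.tgt e)) (Virt G D (P.tgt e)) ℂ) :
    P.vpair e (X ⊗ₖ Y) = site (α := fun i => Virt G D i) (P.src e) X *
      site (α := fun i => Virt G D i) (P.tgt e) Y :=
  pair_kronecker _ _ _

theorem vJump_eq (e : G.edgeSet) :
    P.vJump e = conjJump (P.vRoot (P.src e) * P.vRoot (P.tgt e))
      (P.vRootInv (P.src e) * P.vRootInv (P.tgt e)) (fun α => P.bond e (P.bareJump α)) := by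
  funext α
  rw [vJump, pairJump, conjJump, map_mul, map_mul, vpair_kronecker, vpair_kronecker]
  rfl

theorem vpair_pairRate (e : G.edgeSet) :
    P.vpair e (P.pairRate e) = jumpRate (P.vRoot (P.src e) * P.vRoot (P.tgt e))
      (P.vRootInv (P.src e) * P.vRootInv (P.tgt e)) (fun α => P.bond e (P.bareJump α)) := by
  rw [jumpRate, ← vJump_eq, pairRate_eq, map_sum]
  refine Finset.sum_congr rfl fun α _ => ?_
  rw [map_mul, ← Matrix.star_eq_conjTranspose, map_star]
  rfl

theorem vKraus₀_nonneg (e : G.edgeSet) : 0 ≤ P.vKraus₀ Γ e :=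
  map_nonneg (P.vpair e) (Matrix.nonneg_iff_posSemidef.2 (P.pairKraus_posSemidef Γ e))

theorem vKraus₀_mul_self {e : G.edgeSet} (h : (1 - Γ • P.pairRate e).PosSemidef) :
    P.vKraus₀ Γ e * P.vKraus₀ Γ e = 1 - Γ • jumpRate (P.vRoot (P.src e) * P.vRoot (P.tgt e))
      (P.vRootInv (P.src e) * P.vRootInv (P.tgt e)) (fun α => P.bond e (P.bareJump α)) := by
  rw [← vpair_pairRate, vKraus₀, ← map_mul, P.pairKraus_mul_self h, map_sub, map_one]
  have h1 := map_smul (P.vpair e) (Γ : ℂ) (P.pairRate e)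
  rw [Complex.coe_smul, Complex.coe_smul] at h1
  exact congrArg (1 - ·) h1

theorem sum_vKraus (hΓ : 0 ≤ Γ) (e : G.edgeSet) (a : P.VOp) :
    ∑ o, (P.vKraus Γ e o)ᴴ * a * P.vKraus Γ e o = krausDual Γ (P.vKraus₀ Γ e) (P.vJump e) a := by
  have hk : (P.vKraus₀ Γ e)ᴴ = P.vKraus₀ Γ e := (P.vKraus₀_nonneg e).isSelfAdjoint.star_eq
  have hα : ∀ α, (P.vKraus Γ e (some α))ᴴ * a * P.vKraus Γ e (some α) =
      (Γ : ℂ) • (star (P.vJump e α) * a * P.vJump e α) := by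
    intro α
    have h1 : star (Real.sqrt Γ : ℂ) * (Real.sqrt Γ : ℂ) = (Γ : ℂ) := by
      rw [RCLike.star_def, Complex.conj_ofReal, ← Complex.ofReal_mul, Real.mul_self_sqrt hΓ]
    rw [vKraus, Option.elim_some, Matrix.conjTranspose_smul, Matrix.smul_mul, Matrix.smul_mul,
      Matrix.mul_smul, smul_smul, h1]
    rfl
  have h0 : (P.vKraus Γ e none)ᴴ * a * P.vKraus Γ e none =
      P.vKraus₀ Γ e * a * P.vKraus₀ Γ e := by
    rw [vKraus, Option.elim_none, hk]
  rw [Fintype.sum_option, h0, Finset.sum_congr rfl fun α _ => hα α, ← Finset.smul_sum, krausDual,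
    jumpDual, Complex.coe_smul]

end InjectivePEPS

end LocalEnergy

/-! ### Energies of neighbouring bonds -/

section LocalEnergy

open scoped Matrix.Norms.L2Operator

namespace InjectivePEPS

variable {N : ℕ} {G : SimpleGraph (Fin N)} [DecidableRel G.Adj] {d D : ℕ}
  (P : InjectivePEPS G d D) {δ Γ : ℝ}

/-- Two different edges with a common vertex. -/
def Touches (e f : G.edgeSet) : Prop := e ≠ f ∧ ∃ v, v ∈ e.1 ∧ v ∈ f.1

theorem Touches.symm {e f : G.edgeSet} (h : Touches e f) : Touches f e :=
  ⟨h.1.symm, h.2.imp fun _ hv => ⟨hv.2, hv.1⟩⟩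

theorem mem_edge_iff (e : G.edgeSet) (v : Fin N) : v ∈ e.1 ↔ v = P.src e ∨ v = P.tgt e := by
  rw [← P.srcBond_edge e, Sym2.mem_iff]; rfl

theorem energy_nonneg (hP : P.NearIsometric δ) (hδ : δ ≤ 1 / 2) (e : G.edgeSet) :
    0 ≤ P.energy e := by
  have h := (IsSelfAdjoint.commute_iff (P.nearOne_vRoot hP hδ (P.src e)).right_sa
    (P.nearOne_vRoot hP hδ (P.tgt e)).right_sa).1 (P.vRootInv_commute (P.src_ne_tgt e))
  exact h.conjugate_nonneg
    (projection_nonneg (P.vBondJumps e).isSelfAdjoint (P.vBondJumps e).idem)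

theorem nearOne_ends (hP : P.NearIsometric δ) (hδ : δ ≤ 1 / 2) (e : G.edgeSet) :
    NearOne (P.vRoot (P.src e) * P.vRoot (P.tgt e)) (P.vRootInv (P.src e) * P.vRootInv (P.tgt e))
      (3 * (2 * δ)) := by
  have := P.nonempty_vConf
  exact (P.nearOne_vRoot hP hδ _).mul (P.nearOne_vRoot hP hδ _) (by linarith)
    (P.vRoot_commute (P.src_ne_tgt e)) (P.vRootInv_commute (P.src_ne_tgt e))

/-- An edge channel lowers the energy of its own bond. -/
theorem krausDual_energy_self_le (hP : P.NearIsometric δ) (hδ0 : 0 < δ) (hδ : δ ≤ 1 / 72)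
    (hΓ0 : 0 < Γ) (hΓ : Γ ≤ 1 / 40) (e : G.edgeSet) :
    krausDual Γ (P.vKraus₀ Γ e) (P.vJump e) (P.energy e) ≤ (1 - Γ / 2) • P.energy e := by
  rw [vJump_eq]
  exact (P.vBondJumps e).krausDual_bondEnergy_le (P.nearOne_ends hP (by linarith) e)
    (by linarith) (by linarith) hΓ0 hΓ (P.vKraus₀_nonneg e)
    (P.vKraus₀_mul_self (P.one_sub_pairRate_posSemidef hP hδ0.le (by linarith) hΓ0.le
      (by linarith) e))

theorem bond_commute_vRootInv {e : G.edgeSet} {l : Fin N} (hs : P.src e ≠ l) (ht : P.tgt e ≠ l)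
    (M : Matrix (Fin D × Fin D) (Fin D × Fin D) ℂ) : Commute (P.bond e M) (P.vRootInv l) :=
  P.bond_commute_site hs ht _ _

theorem bond_commute_vRoot {e : G.edgeSet} {l : Fin N} (hs : P.src e ≠ l) (ht : P.tgt e ≠ l)
    (M : Matrix (Fin D × Fin D) (Fin D × Fin D) ℂ) : Commute (P.bond e M) (P.vRoot l) :=
  P.bond_commute_site hs ht _ _

/-- The ends of the edge `e` are `i` and `j`, in either order. -/
def Ends (e : G.edgeSet) (i j : Fin N) : Prop :=
  (P.src e = i ∧ P.tgt e = j) ∨ (P.src e = j ∧ P.tgt e = i)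

theorem Ends.vRootInv_eq {P : InjectivePEPS G d D} {e : G.edgeSet} {i j : Fin N}
    (h : P.Ends e i j) :
    P.vRootInv (P.src e) * P.vRootInv (P.tgt e) = P.vRootInv i * P.vRootInv j := by
  rcases h with ⟨rfl, rfl⟩ | ⟨rfl, rfl⟩
  · rfl
  · exact P.vRootInv_commute (P.src_ne_tgt e)

theorem Ends.vRoot_eq {P : InjectivePEPS G d D} {e : G.edgeSet} {i j : Fin N}
    (h : P.Ends e i j) : P.vRoot (P.src e) * P.vRoot (P.tgt e) = P.vRoot i * P.vRoot j := by
  rcases h with ⟨rfl, rfl⟩ | ⟨rfl, rfl⟩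
  · rfl
  · exact P.vRoot_commute (P.src_ne_tgt e)

theorem Ends.ne {P : InjectivePEPS G d D} {e : G.edgeSet} {i j : Fin N} (h : P.Ends e i j) :
    i ≠ j := by
  rcases h with ⟨rfl, rfl⟩ | ⟨rfl, rfl⟩
  · exact P.src_ne_tgt e
  · exact (P.src_ne_tgt e).symm

theorem Ends.edge_eq {P : InjectivePEPS G d D} {e : G.edgeSet} {i j : Fin N} (h : P.Ends e i j) :
    e.1 = s(i, j) := by
  rcases h with ⟨rfl, rfl⟩ | ⟨rfl, rfl⟩
  · exact (P.srcBond_edge e).symm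
  · exact (P.tgtBond_edge e).symm

theorem Ends.avoids {P : InjectivePEPS G d D} {e : G.edgeSet} {i j l : Fin N} (h : P.Ends e i j)
    (hi : i ≠ l) (hj : j ≠ l) : P.src e ≠ l ∧ P.tgt e ≠ l := by
  rcases h with ⟨rfl, rfl⟩ | ⟨rfl, rfl⟩
  · exact ⟨hi, hj⟩
  · exact ⟨hj, hi⟩

theorem exists_ends {e : G.edgeSet} {v : Fin N} (h : v ∈ e.1) : ∃ w, P.Ends e w v := by
  rcases (P.mem_edge_iff e v).1 h with rfl | rfl
  · exact ⟨P.tgt e, Or.inr ⟨rfl, rfl⟩⟩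
  · exact ⟨P.src e, Or.inl ⟨rfl, rfl⟩⟩

theorem Ends.symm {P : InjectivePEPS G d D} {e : G.edgeSet} {i j : Fin N} (h : P.Ends e i j) :
    P.Ends e j i := Or.symm h

/-- Two edges with a common vertex `j` fit the abstract setting of two adjacent bonds. -/
theorem adjacentBonds (hP : P.NearIsometric δ) (hδ : δ ≤ 1 / 2) {e f : G.edgeSet} (hne : e ≠ f)
    {i j l : Fin N} (he : P.Ends e i j) (hf : P.Ends f j l) :
    AdjacentBonds (fun α => P.bond f (P.bareJump α)) (P.bond f P.bareProj)
      (P.bond e P.bareProj) (P.vRoot i) (P.vRootInv i) (P.vRoot j) (P.vRootInv j) (P.vRoot l)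
      (P.vRootInv l) (2 * δ) := by
  have hij := he.ne
  have hjl := hf.ne
  have hil : i ≠ l := by
    rintro rfl
    exact hne (Subtype.ext (by rw [he.edge_eq, hf.edge_eq, Sym2.eq_swap]))
  obtain ⟨hf1, hf2⟩ := hf.avoids hij.symm hil.symm
  obtain ⟨he1, he2⟩ := he.avoids hil hjl
  exact
    { jumps := P.vBondJumps f
      proj_sa := (P.vBondJumps e).isSelfAdjoint
      proj_idem := (P.vBondJumps e).idem
      site_i := P.nearOne_vRoot hP hδ i
      site_j := P.nearOne_vRoot hP hδ j
      site_l := P.nearOne_vRoot hP hδ l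
      comm_pi_pj := P.vRootInv_commute hij
      comm_pi_pl := P.vRootInv_commute hil
      comm_pj_pl := P.vRootInv_commute hjl
      comm_pi_qj := P.vRootInv_commute_vRoot hij
      comm_pi_ql := P.vRootInv_commute_vRoot hil
      comm_qj_ql := P.vRoot_commute hjl
      comm_jump_pi := fun α => P.bond_commute_vRootInv hf1 hf2 _
      comm_jump_proj := fun α => P.bond_commute_bond hne.symm _ _
      comm_proj_pl := P.bond_commute_vRootInv he1 he2 _
      comm_proj_ql := P.bond_commute_vRoot he1 he2 _ }

/-- An edge channel raises the energy of a neighbouring bond only by a small multiple of the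
energies of the two bonds. -/
theorem krausDual_energy_touches_le (hP : P.NearIsometric δ) (hδ0 : 0 < δ) (hδ : δ ≤ 1 / 72)
    (hΓ0 : 0 < Γ) (hΓ : Γ ≤ 1 / 40) {e f : G.edgeSet} (h : Touches e f) :
    krausDual Γ (P.vKraus₀ Γ f) (P.vJump f) (P.energy e) ≤
      P.energy e + (4 * δ * Γ + 12 * Γ ^ 2) • (P.energy e + P.energy f) := by
  obtain ⟨hne, j, hje, hjf⟩ := h
  obtain ⟨i, hi⟩ := P.exists_ends hje
  obtain ⟨l, hl⟩ := P.exists_ends hjf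
  have hl := hl.symm
  have := P.nonempty_vConf
  have S := P.adjacentBonds hP (by linarith) hne hi hl
  have hk := P.vKraus₀_mul_self (P.one_sub_pairRate_posSemidef hP hδ0.le (by linarith) hΓ0.le
      (by linarith) f)
  rw [hl.vRoot_eq, hl.vRootInv_eq] at hk
  have h1 := S.krausDual_bondEnergy_le (by linarith) (by linarith) hΓ0 (P.vKraus₀_nonneg f) hk
  rw [vJump_eq, energy, energy, hl.vRoot_eq, hl.vRootInv_eq, hi.vRootInv_eq]
  have e2 : 2 * (2 * δ) * Γ + 12 * Γ ^ 2 = 4 * δ * Γ + 12 * Γ ^ 2 := by ring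
  rw [e2] at h1
  exact h1

/-- The energies of touching bonds anticommute to a nearly nonnegative operator. -/
theorem anticommutator_touches_ge (hP : P.NearIsometric δ) (hδ0 : 0 < δ) (hδ : δ ≤ 1 / 72)
    {e f : G.edgeSet} (h : Touches e f) :
    -((4 * δ) • (P.energy e + P.energy f)) ≤
      P.energy e * P.energy f + P.energy f * P.energy e := by
  obtain ⟨hne, j, hje, hjf⟩ := h
  obtain ⟨i, hi⟩ := P.exists_ends hje
  obtain ⟨l, hl⟩ := P.exists_ends hjf
  have hl := hl.symm
  have S := P.adjacentBonds hP (by linarith) hne hi hl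
  have h1 := S.le_anticommutator (by linarith) (by linarith)
  rw [energy, energy, hl.vRootInv_eq, hi.vRootInv_eq]
  have e2 : 2 * (2 * δ) = 4 * δ := by ring
  rw [e2] at h1
  exact h1

theorem energy_eq_vpair (e : G.edgeSet) :
    P.energy e = P.vpair e (bondEnergy (P.rootInv (P.src e) ⊗ₖ P.rootInv (P.tgt e))
      (P.bondHom e P.bareProj)) := by
  rw [bondEnergy, map_mul, map_mul, vpair_kronecker]
  rfl

theorem vpair_commute {e f : G.edgeSet} (hne : e ≠ f) (h : ¬ Touches e f)
    (M : Matrix (Virt G D (P.src e) × Virt G D (P.tgt e))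
      (Virt G D (P.src e) × Virt G D (P.tgt e)) ℂ)
    (M' : Matrix (Virt G D (P.src f) × Virt G D (P.tgt f))
      (Virt G D (P.src f) × Virt G D (P.tgt f)) ℂ) :
    Commute (P.vpair e M) (P.vpair f M') := by
  have h' : ∀ v, v ∈ e.1 → v ∉ f.1 := fun v h1 h2 => h ⟨hne, v, h1, h2⟩
  simp only [P.mem_edge_iff, not_or] at h'
  have h1 := h' _ (Or.inl rfl)
  have h2 := h' _ (Or.inr rfl)
  exact pair_commute_pair (P.src_ne_tgt e) (P.src_ne_tgt f) h1.1 h1.2 h2.1 h2.2 M M'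

theorem sum_vKraus_one {e : G.edgeSet} (hΓ : 0 ≤ Γ) (h : (1 - Γ • P.pairRate e).PosSemidef) :
    ∑ o, (P.vKraus Γ e o)ᴴ * P.vKraus Γ e o = 1 := by
  have h1 := P.sum_vKraus hΓ e 1
  simp only [Matrix.mul_one] at h1
  rw [h1, krausDual, mul_one, P.vKraus₀_mul_self h, jumpDual, jumpRate, vJump_eq]
  simp only [mul_one, sub_add_cancel]

/-- An edge channel acts trivially on observables away from the ends of the edge. -/
theorem krausDual_energy_of_not_touches {e f : G.edgeSet} (hne : e ≠ f) (h : ¬ Touches e f)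
    (hΓ : 0 ≤ Γ) (hf : (1 - Γ • P.pairRate f).PosSemidef) :
    krausDual Γ (P.vKraus₀ Γ f) (P.vJump f) (P.energy e) = P.energy e := by
  rw [← P.sum_vKraus hΓ f]
  have hc : ∀ o, Commute (P.energy e) (P.vKraus Γ f o) := by
    intro o
    rw [energy_eq_vpair]
    cases o with
    | none => exact P.vpair_commute hne h _ _
    | some α => exact (P.vpair_commute hne h _ _).smul_right _
  have h1 := P.sum_vKraus_one hΓ hf
  calc _ = ∑ o, (P.vKraus Γ f o)ᴴ * P.vKraus Γ f o * P.energy e :=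
        Finset.sum_congr rfl fun o _ => by rw [mul_assoc, (hc o).eq, ← mul_assoc]
    _ = _ := by rw [← Finset.sum_mul, h1, one_mul]

theorem energy_mul_energy_nonneg (hP : P.NearIsometric δ) (hδ : δ ≤ 1 / 2) {e f : G.edgeSet}
    (hne : e ≠ f) (h : ¬ Touches e f) : 0 ≤ P.energy e * P.energy f := by
  have hc : Commute (P.energy e) (P.energy f) := by
    rw [energy_eq_vpair, energy_eq_vpair]; exact P.vpair_commute hne h _ _
  exact hc.mul_nonneg (P.energy_nonneg hP hδ e) (P.energy_nonneg hP hδ f)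

theorem le_energy_sq (hP : P.NearIsometric δ) (hδ : δ ≤ 1 / 2) (e : G.edgeSet) :
    (1 - 6 * δ) • P.energy e ≤ P.energy e * P.energy e := by
  have h := (P.vBondJumps e).le_bondEnergy_sq (P.nearOne_ends hP hδ e)
  have e2 : 3 * (2 * δ) = 6 * δ := by ring
  rw [e2] at h
  exact h

theorem energy_le_two (hP : P.NearIsometric δ) (hδ : δ ≤ 1 / 72) (e : G.edgeSet) :
    P.energy e ≤ (2 : ℝ) • 1 :=
  (P.vBondJumps e).bondEnergy_le_two (P.nearOne_ends hP (by linarith) e) (by linarith)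

end InjectivePEPS

end LocalEnergy

/-! ### The ground state of the total energy -/

section ProductVector

variable {ι : Type*} [Fintype ι] [DecidableEq ι] {β : Type*} [Fintype β] [DecidableEq β]

/-- A vector fixed by every factor is fixed by their product. -/
theorem tensorAll_mulVec_of_site_mulVec {α : ι → Type*} [∀ i, Fintype (α i)]
    [∀ i, DecidableEq (α i)] {M : ∀ i, Matrix (α i) (α i) ℂ} {w : (∀ i, α i) → ℂ}
    (h : ∀ i, site i (M i) *ᵥ w = w) : tensorAll M *ᵥ w = w := by
  have key : ∀ s : Finset ι, tensorAll (fun i => if i ∈ s then M i else 1) *ᵥ w = w := by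
    intro s
    induction s using Finset.induction_on with
    | empty =>
      simp only [Finset.notMem_empty, if_false]
      rw [tensorAll_one, Matrix.one_mulVec]
    | insert i s hi ih =>
      have : tensorAll (fun l => if l ∈ insert i s then M l else 1) =
          tensorAll (fun l => if l ∈ s then M l else 1) * site i (M i) := by
        rw [site_eq_tensorAll, tensorAll_mul]
        congr 1
        funext l
        rcases eq_or_ne l i with rfl | hl
        · simp [hi]
        · simp [hl]
      rw [this, ← Matrix.mulVec_mulVec, h, ih]
  simpa using key Finset.univ

/-- A vector fixed by the projector `|a⟩⟨a|` on every factor is a multiple of the product vector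
`⨂ a`. -/
theorem exists_eq_smul_prod {a : β → ℂ} {w : (ι → β) → ℂ}
    (h : ∀ i, site (α := fun _ => β) i (Matrix.vecMulVec a (star a)) *ᵥ w = w) :
    ∃ c : ℂ, w = c • fun x => ∏ i, a (x i) := by
  have h1 := tensorAll_mulVec_of_site_mulVec h
  have h2 : tensorAll (fun _ : ι => Matrix.vecMulVec a (star a)) =
      Matrix.vecMulVec (fun x : ι → β => ∏ i, a (x i)) (star fun x : ι → β => ∏ i, a (x i)) := by
    ext x y
    simp [tensorAll, Matrix.vecMulVec_apply, Finset.prod_mul_distrib]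
  rw [h2, Matrix.vecMulVec_mulVec] at h1
  exact ⟨_, h1.symm.trans (op_smul_eq_smul _ _)⟩

theorem site_mulVec_prod {a : β → ℂ} {M : Matrix β β ℂ} (h : M *ᵥ a = 0) (i : ι) :
    site (α := fun _ => β) i M *ᵥ (fun x : ι → β => ∏ i, a (x i)) = 0 := by
  have h1 : M * Matrix.replicateCol Unit a = Matrix.replicateCol Unit a *
      (0 : Matrix Unit Unit ℂ) := by
    rw [Matrix.mul_zero, ← Matrix.replicateCol_mulVec, h, Matrix.replicateCol_zero]
  have h2 := site_mul_tensorAll (α := fun _ : ι => β) (β := fun _ : ι => Unit)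
    (V := fun _ => Matrix.replicateCol Unit a) (i := i) h1
  rw [map_zero, Matrix.mul_zero] at h2
  funext x
  have := congrFun (congrFun h2 x) fun _ => ()
  simpa [Matrix.mul_apply, tensorAll, Matrix.mulVec, dotProduct] using this

end ProductVector

namespace InjectivePEPS

variable {N : ℕ} {G : SimpleGraph (Fin N)} [DecidableRel G.Adj] {d D : ℕ}
  (P : InjectivePEPS G d D) {δ Γ : ℝ}

/-- The edge to which a virtual qudit belongs. -/
def edgeOf (i : Fin N) (b : G.neighborSet i) : G.edgeSet := ⟨s(i, b.1), b.2⟩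

theorem edgeOf_srcBond (e : G.edgeSet) : edgeOf (P.src e) (P.srcBond e) = e :=
  Subtype.ext (P.srcBond_edge e)

theorem edgeOf_tgtBond (e : G.edgeSet) : edgeOf (P.tgt e) (P.tgtBond e) = e :=
  Subtype.ext (P.tgtBond_edge e)

theorem sigma_neighbor_ext {x y : Σ i, G.neighborSet i} (h1 : x.1 = y.1)
    (h2 : (x.2 : Fin N) = y.2) : x = y := by
  obtain ⟨i, b, hb⟩ := x
  obtain ⟨j, c, hc⟩ := y
  obtain rfl : i = j := h1
  obtain rfl : b = c := h2
  rfl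

/-- Every virtual qudit is one of the two qudits of its edge. -/
theorem bond_cases {p : ∀ i, G.neighborSet i → Prop} (hs : ∀ e, p (P.src e) (P.srcBond e))
    (ht : ∀ e, p (P.tgt e) (P.tgtBond e)) (i : Fin N) (b : G.neighborSet i) : p i b := by
  have h : s(P.src (edgeOf i b), P.tgt (edgeOf i b)) = s(i, b.1) := P.srcBond_edge (edgeOf i b)
  have key : ∀ x y : Σ i, G.neighborSet i, x = y → p x.1 x.2 → p y.1 y.2 := by
    rintro x y rfl h; exact h
  rcases Sym2.eq_iff.1 h with ⟨h1, h2⟩ | ⟨h1, h2⟩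
  · exact key ⟨_, P.srcBond (edgeOf i b)⟩ ⟨i, b⟩ (sigma_neighbor_ext h1 h2) (hs _)
  · exact key ⟨_, P.tgtBond (edgeOf i b)⟩ ⟨i, b⟩ (sigma_neighbor_ext h2 h1) (ht _)

/-- The labels of all virtual qudits, grouped by vertex or by edge. -/
def edgeConf : P.VConf ≃ (G.edgeSet → Fin D × Fin D) where
  toFun v e := (v (P.src e) (P.srcBond e), v (P.tgt e) (P.tgtBond e))
  invFun x i b := if P.src (edgeOf i b) = i then (x (edgeOf i b)).1 else (x (edgeOf i b)).2
  left_inv v := by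
    funext i b
    refine P.bond_cases (p := fun i b => (if P.src (edgeOf i b) = i then
      v (P.src (edgeOf i b)) (P.srcBond (edgeOf i b)) else
      v (P.tgt (edgeOf i b)) (P.tgtBond (edgeOf i b))) = v i b) (fun e => ?_) (fun e => ?_) i b
    · rw [edgeOf_srcBond, if_pos rfl]
    · rw [edgeOf_tgtBond, if_neg (P.src_ne_tgt e)]
  right_inv x := by
    funext e
    simp only
    rw [edgeOf_srcBond, edgeOf_tgtBond, if_pos rfl, if_neg (P.src_ne_tgt e)]

theorem edgeConf_apply (v : P.VConf) (e : G.edgeSet) :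
    P.edgeConf v e = (v (P.src e) (P.srcBond e), v (P.tgt e) (P.tgtBond e)) := rfl

/-- If the labels are grouped by edges instead of vertices, a bond operator acts on a single factor.
-/
theorem bond_eq_submatrix (e : G.edgeSet) (M : Matrix (Fin D × Fin D) (Fin D × Fin D) ℂ) :
    P.bond e M =
      (site (α := fun _ : G.edgeSet => Fin D × Fin D) e M).submatrix P.edgeConf P.edgeConf := by
  ext v w
  -- Two labels agree outside of the two qudits of `e` if and only if they agree on all other edges.
  have hiff : ((∀ l, l ≠ P.src e → l ≠ P.tgt e → v l = w l) ∧
      (∀ b, b ≠ P.srcBond e → v (P.src e) b = w (P.src e) b) ∧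
      (∀ b, b ≠ P.tgtBond e → v (P.tgt e) b = w (P.tgt e) b)) ↔
      ∀ f, f ≠ e → P.edgeConf v f = P.edgeConf w f := by
    constructor
    · rintro ⟨h1, h2, h3⟩ f hf
      have key : ∀ i (b : G.neighborSet i), edgeOf i b ≠ e → v i b = w i b := by
        intro i b hb
        by_cases hs : i = P.src e
        · subst hs
          exact h2 b (by rintro rfl; exact hb (P.edgeOf_srcBond e))
        by_cases ht : i = P.tgt e
        · subst ht
          exact h3 b (by rintro rfl; exact hb (P.edgeOf_tgtBond e))
        rw [h1 i hs ht]
      rw [edgeConf_apply, edgeConf_apply, key _ _ (by rwa [edgeOf_srcBond]),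
        key _ _ (by rwa [edgeOf_tgtBond])]
    · intro h
      have key : ∀ i (b : G.neighborSet i), edgeOf i b ≠ e → v i b = w i b := by
        refine P.bond_cases (fun f hf => ?_) (fun f hf => ?_)
        · rw [edgeOf_srcBond] at hf
          exact congrArg Prod.fst (h f hf)
        · rw [edgeOf_tgtBond] at hf
          exact congrArg Prod.snd (h f hf)
      have hmem : ∀ i (b : G.neighborSet i), edgeOf i b = e →
          (⟨i, b⟩ : Σ i, G.neighborSet i) = ⟨P.src e, P.srcBond e⟩ ∨
          (⟨i, b⟩ : Σ i, G.neighborSet i) = ⟨P.tgt e, P.tgtBond e⟩ := by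
        refine P.bond_cases (fun f hf => ?_) (fun f hf => ?_)
        · rw [edgeOf_srcBond] at hf; subst hf; exact Or.inl rfl
        · rw [edgeOf_tgtBond] at hf; subst hf; exact Or.inr rfl
      refine ⟨fun l hs ht => funext fun b => key l b fun hb => ?_,
        fun b hb => key _ b fun hb' => ?_, fun b hb => key _ b fun hb' => ?_⟩
      · rcases hmem l b hb with h' | h'
        · exact hs (congrArg Sigma.fst h')
        · exact ht (congrArg Sigma.fst h')
      · rcases hmem _ b hb' with h' | h'
        · exact hb (eq_of_heq (Sigma.mk.inj h').2)
        · exact P.src_ne_tgt e (congrArg Sigma.fst h')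
      · rcases hmem _ b hb' with h' | h'
        · exact P.src_ne_tgt e (congrArg Sigma.fst h').symm
        · exact hb (eq_of_heq (Sigma.mk.inj h').2)
  rw [Matrix.submatrix_apply, site_apply]
  rw [bond, StarAlgHom.comp_apply, vpair, pair, kronHom_apply]
  simp only [pairLin, LinearMap.coe_mk, AddHom.coe_mk, Matrix.of_apply, bondHom_apply, bondOp]
  by_cases h : ∀ f, f ≠ e → P.edgeConf v f = P.edgeConf w f
  · obtain ⟨h1, h2⟩ := hiff.2 h
    rw [if_pos h, if_pos h1, if_pos h2]
    rfl
  · rw [if_neg h]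
    by_cases h1 : ∀ l, l ≠ P.src e → l ≠ P.tgt e → v l = w l
    · rw [if_pos h1, if_neg fun h2 => h (hiff.1 ⟨h1, h2⟩)]
    · rw [if_neg h1]

/-- The product `⨂_e |φ₀⟩_e` of bond states. -/
def bondVec : P.VConf → ℂ := fun v => ∏ e : G.edgeSet, P.φ₀ (P.edgeConf v e)

/-- The PEPS vector in the virtual picture, not normalized. -/
def vVec : P.VConf → ℂ := tensorAll P.root *ᵥ P.bondVec

theorem globalIso_mulVec_vVec : P.globalIso *ᵥ P.vVec = P.vec := by
  rw [vVec, Matrix.mulVec_mulVec, globalIso, tensorAll_mul]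
  simp only [iso_mul_root]
  rfl

theorem bond_mulVec (e : G.edgeSet) (M : Matrix (Fin D × Fin D) (Fin D × Fin D) ℂ)
    (w : P.VConf → ℂ) :
    P.bond e M *ᵥ w = (site (α := fun _ : G.edgeSet => Fin D × Fin D) e M *ᵥ
      (w ∘ P.edgeConf.symm)) ∘ P.edgeConf := by
  rw [bond_eq_submatrix, Matrix.submatrix_mulVec_equiv]

theorem bond_bareProj_mulVec_bondVec (e : G.edgeSet) :
    P.bond e P.bareProj *ᵥ P.bondVec = 0 := by
  rw [bond_mulVec]
  have : P.bondVec ∘ P.edgeConf.symm = fun x => ∏ e : G.edgeSet, P.φ₀ (x e) := by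
    funext x; simp [bondVec]
  rw [this, site_mulVec_prod P.bareProj_mul_φ₀]
  rfl

theorem exists_eq_smul_bondVec {w : P.VConf → ℂ} (h : ∀ e, P.bond e P.bareProj *ᵥ w = 0) :
    ∃ c : ℂ, w = c • P.bondVec := by
  obtain ⟨c, hc⟩ := exists_eq_smul_prod (ι := G.edgeSet) (a := (P.φ₀ : Fin D × Fin D → ℂ))
    (w := w ∘ P.edgeConf.symm) (fun e => by
      have h1 : P.bond e (Matrix.vecMulVec (P.φ₀ : Fin D × Fin D → ℂ)
          (star (P.φ₀ : Fin D × Fin D → ℂ))) *ᵥ w = w := by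
        have : Matrix.vecMulVec (P.φ₀ : Fin D × Fin D → ℂ)
          (star (P.φ₀ : Fin D × Fin D → ℂ)) = 1 - P.bareProj := by
          rw [← P.vecMulVec_add_bareProj]; abel
        rw [this, map_sub, map_one, Matrix.sub_mulVec, h e, Matrix.one_mulVec, sub_zero]
      rw [bond_mulVec] at h1
      have h2 := congrArg (· ∘ P.edgeConf.symm) h1
      simpa [Function.comp_assoc] using h2)
  refine ⟨c, ?_⟩
  have := congrArg (· ∘ P.edgeConf) hc
  simp only [Function.comp_assoc, Equiv.symm_comp_self, Function.comp_id] at this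
  rw [this]
  rfl

/-- A product of operators on all vertices splits into those at the ends of `e` and an operator that
commutes with everything at these ends. -/
theorem exists_tensorAll_eq (e : G.edgeSet) (X : ∀ i, Matrix (Virt G D i) (Virt G D i) ℂ) :
    ∃ Y : P.VOp, (∀ M, Commute (P.vpair e M) Y) ∧
      tensorAll X = Y * (site (α := fun i => Virt G D i) (P.src e) (X (P.src e)) *
        site (α := fun i => Virt G D i) (P.tgt e) (X (P.tgt e))) := by
  let Z : ∀ i, Matrix (Virt G D i) (Virt G D i) ℂ :=
    fun i => if i = P.src e ∨ i = P.tgt e then 1 else X i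
  have hs : Z (P.src e) = 1 := if_pos (Or.inl rfl)
  have ht : Z (P.tgt e) = 1 := if_pos (Or.inr rfl)
  have hne := P.src_ne_tgt e
  refine ⟨tensorAll Z, fun M => commute_pair hne (fun A => ?_) (fun A => ?_) M, ?_⟩
  · exact site_mul_tensorAll (by rw [hs, mul_one, one_mul])
  · exact site_mul_tensorAll (by rw [ht, mul_one, one_mul])
  · rw [site_eq_tensorAll, site_eq_tensorAll, tensorAll_mul, tensorAll_mul]
    congr 1
    funext l
    by_cases h1 : l = P.src e
    · subst h1
      rw [Pi.mulSingle_eq_same, Pi.mulSingle_eq_of_ne hne, hs, one_mul, mul_one]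
    by_cases h2 : l = P.tgt e
    · subst h2
      rw [Pi.mulSingle_eq_same, Pi.mulSingle_eq_of_ne hne.symm, ht, one_mul, one_mul]
    · rw [Pi.mulSingle_eq_of_ne h1, Pi.mulSingle_eq_of_ne h2, one_mul, mul_one]
      exact (if_neg (by tauto)).symm

theorem vRootInv_mul_vRoot (i : Fin N) : P.vRootInv i * P.vRoot i = 1 := by
  rw [vRootInv, vRoot, ← map_mul, rootInv_mul_root, map_one]

theorem vRoot_mul_vRootInv (i : Fin N) : P.vRoot i * P.vRootInv i = 1 := by
  rw [vRootInv, vRoot, ← map_mul, root_mul_rootInv, map_one]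

/-- The PEPS vector has no energy. -/
theorem energy_mulVec_vVec (e : G.edgeSet) : P.energy e *ᵥ P.vVec = 0 := by
  obtain ⟨Y, hY, hY'⟩ := P.exists_tensorAll_eq e P.root
  have hc : Commute (P.bond e P.bareProj) Y := hY _
  have hst := P.vRootInv_commute_vRoot (P.src_ne_tgt e).symm
  have hcs : Commute (P.vRootInv (P.src e) * P.vRootInv (P.tgt e)) Y := by
    have := hY (P.rootInv (P.src e) ⊗ₖ P.rootInv (P.tgt e))
    rwa [vpair_kronecker] at this
  have h1 : P.vRootInv (P.src e) * P.vRootInv (P.tgt e) * tensorAll P.root = Y := by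
    rw [hY', ← mul_assoc, hcs.eq]
    change Y * (P.vRootInv (P.src e) * P.vRootInv (P.tgt e)) *
      (P.vRoot (P.src e) * P.vRoot (P.tgt e)) = Y
    calc _ = Y * (P.vRootInv (P.src e) * (P.vRootInv (P.tgt e) * P.vRoot (P.src e)) *
          P.vRoot (P.tgt e)) := by noncomm_ring
      _ = Y * ((P.vRootInv (P.src e) * P.vRoot (P.src e)) *
          (P.vRootInv (P.tgt e) * P.vRoot (P.tgt e))) := by rw [hst.eq]; noncomm_ring
      _ = Y := by rw [vRootInv_mul_vRoot, vRootInv_mul_vRoot, mul_one, mul_one]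
  rw [vVec, energy, bondEnergy, Matrix.mulVec_mulVec, mul_assoc, h1, mul_assoc, hc.eq, ← mul_assoc,
    ← Matrix.mulVec_mulVec, bond_bareProj_mulVec_bondVec, Matrix.mulVec_zero]

/-- A vector without energy is a multiple of the PEPS vector. -/
theorem exists_eq_smul_vVec {u : P.VConf → ℂ} (h : ∀ e, P.energy e *ᵥ u = 0) :
    ∃ c : ℂ, u = c • P.vVec := by
  have h1 : ∀ e, P.bond e P.bareProj *ᵥ (tensorAll P.rootInv *ᵥ u) = 0 := by
    intro e
    obtain ⟨Y, hY, hY'⟩ := P.exists_tensorAll_eq e P.rootInv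
    have hc : Commute (P.bond e P.bareProj) Y := hY _
    have hst := P.vRootInv_commute_vRoot (P.src_ne_tgt e).symm
    have hpq : (P.vRoot (P.src e) * P.vRoot (P.tgt e)) *
        (P.vRootInv (P.src e) * P.vRootInv (P.tgt e)) = 1 := by
      rw [P.vRoot_commute (P.src_ne_tgt e), mul_assoc, ← mul_assoc (P.vRoot (P.src e)),
        vRoot_mul_vRootInv, one_mul, vRoot_mul_vRootInv]
    have h2 : P.bond e P.bareProj * tensorAll P.rootInv =
        Y * (P.vRoot (P.src e) * P.vRoot (P.tgt e)) * P.energy e := by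
      rw [hY', ← mul_assoc, hc.eq, energy, bondEnergy]
      calc _ = Y * 1 * P.bond e P.bareProj *
            (P.vRootInv (P.src e) * P.vRootInv (P.tgt e)) := by rw [mul_one]; rfl
        _ = _ := by rw [← hpq]; noncomm_ring
    rw [Matrix.mulVec_mulVec, h2, ← Matrix.mulVec_mulVec, h e, Matrix.mulVec_zero]
  obtain ⟨c, hc⟩ := P.exists_eq_smul_bondVec h1
  refine ⟨c, ?_⟩
  have h3 : tensorAll P.root * tensorAll P.rootInv = 1 := by
    rw [tensorAll_mul]
    simp only [root_mul_rootInv]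
    exact tensorAll_one
  have h4 := congrArg (tensorAll P.root *ᵥ ·) hc
  simp only [Matrix.mulVec_mulVec, h3, Matrix.one_mulVec, Matrix.mulVec_smul] at h4
  exact h4

end InjectivePEPS

/-! ### The spectral gap -/

section Gap

/-- A frustration-free sum is bounded above by a multiple of its square as soon as every term is
and the anticommutators of different terms are not too negative. -/
theorem smul_sum_le_sum_mul_sum {A : Type*} [CStarAlgebra A] [PartialOrder A] [StarOrderedRing A]
    {ι : Type*} [Fintype ι] [DecidableEq ι] (h : ι → A) (R : ι → ι → Prop)
    [∀ e, DecidablePred (R e)] (hR : ∀ e f, R e f → R f e) (hne : ∀ e f, R e f → e ≠ f)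
    {a b : ℝ} {m : ℕ} (hb : 0 ≤ b) (hm : ∀ e, (Finset.univ.filter (R e)).card ≤ m)
    (h0 : ∀ e, 0 ≤ h e) (hsq : ∀ e, a • h e ≤ h e * h e)
    (hac : ∀ e f, R e f → -(b • (h e + h f)) ≤ h e * h f + h f * h e)
    (hdis : ∀ e f, e ≠ f → ¬ R e f → 0 ≤ h e * h f) :
    (a - b * m) • ∑ e, h e ≤ (∑ e, h e) * ∑ e, h e := by
  have hterm : ∀ e f, (if e = f then (2 * a) • h e else 0) -
      (if R e f then b • (h e + h f) else 0) ≤ h e * h f + h f * h e := by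
    intro e f
    by_cases hef : e = f
    · subst hef
      rw [if_pos rfl, if_neg fun h' => hne e e h' rfl, sub_zero, two_mul, add_smul]
      exact add_le_add (hsq e) (hsq e)
    · rw [if_neg hef]
      by_cases hr : R e f
      · rw [if_pos hr, zero_sub]; exact hac e f hr
      · rw [if_neg hr, sub_zero]
        exact add_nonneg (hdis e f hef hr) (hdis f e (Ne.symm hef) fun h' => hr (hR _ _ h'))
  have hsum := Finset.sum_le_sum fun e (_ : e ∈ Finset.univ) =>
    Finset.sum_le_sum fun f (_ : f ∈ Finset.univ) => hterm e f
  have hl : ∑ e, ∑ f, ((if e = f then (2 * a) • h e else 0) -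
      (if R e f then b • (h e + h f) else 0)) =
      (2 * a) • ∑ e, h e - (2 * b) • ∑ e, ((Finset.univ.filter (R e)).card : ℝ) • h e := by
    have h1 : ∑ e, ∑ f, (if R e f then h e else 0) =
        ∑ e, ((Finset.univ.filter (R e)).card : ℝ) • h e := by
      refine Finset.sum_congr rfl fun e _ => ?_
      rw [← Finset.sum_filter, Finset.sum_const, Nat.cast_smul_eq_nsmul]
    have h2 : ∑ e, ∑ f, (if R e f then h f else 0) =
        ∑ e, ((Finset.univ.filter (R e)).card : ℝ) • h e := by
      rw [Finset.sum_comm, ← h1]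
      refine Finset.sum_congr rfl fun e _ => Finset.sum_congr rfl fun f _ => ?_
      simp only [show R f e ↔ R e f from ⟨hR _ _, hR _ _⟩]
    have h3 : ∀ e f, (if R e f then b • (h e + h f) else 0) =
        b • (if R e f then h e else 0) + b • (if R e f then h f else 0) := by
      intro e f; split_ifs <;> simp
    simp only [h3, Finset.sum_sub_distrib, Finset.sum_add_distrib, ← Finset.smul_sum, h1, h2,
      Finset.sum_ite_eq, Finset.mem_univ, if_true]
    rw [two_mul b, add_smul]
  have hr : ∑ e, ∑ f, (h e * h f + h f * h e) = (2 : ℝ) • ((∑ e, h e) * ∑ e, h e) := by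
    have h1 : ∑ e, ∑ f, h e * h f = (∑ e, h e) * ∑ e, h e := by
      rw [Finset.sum_mul_sum]
    have h2 : ∑ e, ∑ f, h f * h e = (∑ e, h e) * ∑ e, h e := by
      rw [Finset.sum_comm, Finset.sum_mul_sum]
    simp only [Finset.sum_add_distrib, h1, h2, two_smul]
  rw [hl, hr] at hsum
  have hd : ∑ e, ((Finset.univ.filter (R e)).card : ℝ) • h e ≤ (m : ℝ) • ∑ e, h e := by
    rw [Finset.smul_sum]
    exact Finset.sum_le_sum fun e _ => smul_le_smul_coeff (Nat.cast_le.2 (hm e)) (h0 e)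
  have hd' := (sub_le_sub_left (smul_le_smul_real (by linarith : (0 : ℝ) ≤ 2 * b) hd) _).trans hsum
  have := smul_le_smul_real (by norm_num : (0 : ℝ) ≤ 1 / 2) hd'
  rw [smul_sub, smul_smul, smul_smul, smul_smul, smul_smul] at this
  rw [sub_smul]
  convert this using 2
  · congr 1; ring
  · congr 1; ring
  · rw [show (1 / 2 * 2 : ℝ) = 1 by norm_num, one_smul]

variable {n : Type*} [Fintype n] [DecidableEq n]

/-- The orthogonal projection onto the line spanned by `v`; it is `0` for `v = 0`. -/
def lineProj (v : n → ℂ) : Matrix n n ℂ := (star v ⬝ᵥ v)⁻¹ • Matrix.vecMulVec v (star v)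

theorem lineProj_mulVec_self (v : n → ℂ) : lineProj v *ᵥ v = v := by
  rw [lineProj, Matrix.smul_mulVec, Matrix.vecMulVec_mulVec]
  by_cases h : v = 0
  · subst h; simp
  · have : star v ⬝ᵥ v ≠ 0 := by rwa [Ne, dotProduct_star_self_eq_zero]
    ext i
    simp only [Pi.smul_apply, smul_eq_mul, MulOpposite.smul_eq_mul_unop, MulOpposite.unop_op]
    field_simp

theorem lineProj_posSemidef (v : n → ℂ) : (lineProj v).PosSemidef := by
  have h : (0 : ℂ) ≤ star v ⬝ᵥ v := dotProduct_star_self_nonneg v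
  exact (Matrix.posSemidef_vecMulVec_self_star v).smul (inv_nonneg_of_nonneg h)

theorem mul_lineProj {M : Matrix n n ℂ} {v : n → ℂ} (h : M *ᵥ v = 0) : M * lineProj v = 0 := by
  rw [lineProj, Matrix.mul_smul, Matrix.mul_vecMulVec, h, Matrix.zero_vecMulVec, smul_zero]

theorem lineProj_mul_self (v : n → ℂ) : lineProj v * lineProj v = lineProj v := by
  conv_lhs => rhs; rw [lineProj]
  rw [Matrix.mul_smul, Matrix.mul_vecMulVec, lineProj_mulVec_self]
  rfl

open scoped Matrix.Norms.L2Operator in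
/-- A positive semidefinite matrix with `H ≤ 2 H²` has no eigenvalue in `(0, ½)`. -/
theorem one_sub_lineProj_le {H : Matrix n n ℂ} (hH : 0 ≤ H) (hsq : (1 / 2 : ℝ) • H ≤ H * H)
    {v : n → ℂ} (hv : H *ᵥ v = 0) (hker : ∀ w, H *ᵥ w = 0 → ∃ c : ℂ, w = c • v) :
    1 - lineProj v ≤ (2 : ℝ) • H := by
  have hpsd := Matrix.nonneg_iff_posSemidef.1 hH
  have hp := lineProj_posSemidef v
  have hHp : H * lineProj v = 0 := mul_lineProj hv
  have hpH : lineProj v * H = 0 := by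
    have := congrArg Matrix.conjTranspose hHp
    rwa [Matrix.conjTranspose_mul, hp.isHermitian.eq, hpsd.isHermitian.eq,
      Matrix.conjTranspose_zero] at this
  set p := lineProj v with hpdef
  have hp2 : p * p = p := lineProj_mul_self v
  -- Lifting the ground state to the energy `½` gives an invertible `L` with `L² ≥ L/2`. Hence `L ≥
  -- ½`.
  set L := H + (1 / 2 : ℝ) • p with hL
  have hpc : ((1 / 2 : ℝ) • p).PosSemidef :=
    Matrix.nonneg_iff_posSemidef.1 (smul_nonneg (by norm_num) (Matrix.nonneg_iff_posSemidef.2 hp))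
  have hLs : L.PosSemidef := hpsd.add hpc
  have hLd : L.PosDef := by
    refine Matrix.PosDef.of_dotProduct_mulVec_pos hLs.isHermitian fun {x} hx => ?_
    refine lt_of_le_of_ne (hLs.dotProduct_mulVec_nonneg x) fun h => hx ?_
    have h1 := (hLs.dotProduct_mulVec_zero_iff x).1 h.symm
    have h2 : star x ⬝ᵥ H *ᵥ x + star x ⬝ᵥ ((1 / 2 : ℝ) • p) *ᵥ x = 0 := by
      rw [← dotProduct_add, ← Matrix.add_mulVec, ← hL, h1, dotProduct_zero]
    have h3 := (add_eq_zero_iff_of_nonneg (hpsd.dotProduct_mulVec_nonneg x)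
      (hpc.dotProduct_mulVec_nonneg x)).1 h2
    obtain ⟨c, hc⟩ := hker x ((hpsd.dotProduct_mulVec_zero_iff x).1 h3.1)
    have h4 := (hpc.dotProduct_mulVec_zero_iff x).1 h3.2
    rw [hc, Matrix.mulVec_smul, Matrix.smul_mulVec, hpdef, lineProj_mulVec_self] at h4
    rw [hc]
    have h5 := congrArg (fun w => (2 : ℝ) • w) h4
    simp only [smul_zero] at h5
    rw [smul_comm, smul_smul] at h5
    simpa using h5
  have hLL : (1 / 2 : ℝ) • L ≤ L * L := by
    have : L * L = H * H + (1 / 4 : ℝ) • p := by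
      rw [hL]
      simp only [add_mul, mul_add, Matrix.mul_smul, Matrix.smul_mul, hHp, hpH, hp2, smul_zero,
        add_zero, zero_add, smul_smul]
      norm_num
    rw [this, hL, smul_add, smul_smul, show (1 / 2 * (1 / 2) : ℝ) = 1 / 4 by norm_num]
    exact add_le_add hsq le_rfl
  have hinv : L * L⁻¹ = 1 :=
    Matrix.mul_nonsing_inv _ ((Matrix.isUnit_iff_isUnit_det _).1 hLd.isUnit)
  have hinv' : L⁻¹ * L = 1 :=
    Matrix.nonsing_inv_mul _ ((Matrix.isUnit_iff_isUnit_det _).1 hLd.isUnit)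
  have hcomm : Commute (L * L - (1 / 2 : ℝ) • L) L⁻¹ := by
    have : Commute L L⁻¹ := hinv.trans hinv'.symm
    exact (this.mul_left this).sub_left (this.smul_left _)
  have hfin := hcomm.mul_nonneg (sub_nonneg.2 hLL)
    (Matrix.nonneg_iff_posSemidef.2 hLd.inv.posSemidef)
  rw [sub_mul, mul_assoc, Matrix.smul_mul, hinv, mul_one, sub_nonneg, hL] at hfin
  have h2 := smul_le_smul_real (by norm_num : (0 : ℝ) ≤ 2) hfin
  rw [smul_add, smul_smul, smul_smul] at h2
  norm_num at h2
  exact sub_le_iff_le_add.2 h2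

end Gap

/-! ### Counting edges -/

section Count

variable {N : ℕ} {G : SimpleGraph (Fin N)} [DecidableRel G.Adj]

open Classical in
/-- An edge touching `e` is incident to one of the two ends of `e`. -/
theorem card_touches_le {d₀ : ℕ} (hG : ∀ i, G.degree i ≤ d₀) (e : G.edgeSet) :
    (Finset.univ.filter (InjectivePEPS.Touches e)).card ≤ 2 * d₀ := by
  obtain ⟨⟨v, w⟩, he⟩ := e
  change (Finset.univ.filter (InjectivePEPS.Touches ⟨s(v, w), he⟩)).card ≤ 2 * d₀
  have hsub : (Finset.univ.filter (InjectivePEPS.Touches ⟨s(v, w), he⟩)).map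
      (Function.Embedding.subtype _) ⊆ G.incidenceFinset v ∪ G.incidenceFinset w := by
    intro f hf
    rw [Finset.mem_map] at hf
    obtain ⟨f, hf, rfl⟩ := hf
    obtain ⟨-, u, hu, hu'⟩ := (Finset.mem_filter.1 hf).2
    rw [Finset.mem_union, SimpleGraph.mem_incidenceFinset, SimpleGraph.mem_incidenceFinset]
    rcases Sym2.mem_iff.1 hu with rfl | rfl
    · exact Or.inl ⟨f.2, hu'⟩
    · exact Or.inr ⟨f.2, hu'⟩
  have h1 := Finset.card_le_card hsub
  rw [Finset.card_map] at h1
  have h2 := Finset.card_union_le (G.incidenceFinset v) (G.incidenceFinset w)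
  rw [SimpleGraph.card_incidenceFinset_eq_degree, SimpleGraph.card_incidenceFinset_eq_degree] at h2
  have := hG v
  have := hG w
  omega

theorem card_edges_le {d₀ : ℕ} (hG : ∀ i, G.degree i ≤ d₀) :
    Fintype.card G.edgeSet ≤ N * d₀ := by
  have h := G.sum_degrees_eq_twice_card_edges
  have h2 : ∑ v, G.degree v ≤ N * d₀ := by
    simpa using Finset.sum_le_card_nsmul Finset.univ (fun v => G.degree v) d₀ fun i _ => hG i
  rw [SimpleGraph.edgeFinset_card] at h
  omega

end Count

namespace InjectivePEPS

variable {N : ℕ} {G : SimpleGraph (Fin N)} [DecidableRel G.Adj] {d D : ℕ}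
  (P : InjectivePEPS G d D) {δ Γ : ℝ}

/-- The total energy. -/
def hamiltonian : P.VOp := ∑ e, P.energy e

open scoped Matrix.Norms.L2Operator in
/-- The spectral gap: the total energy controls the distance to the ground state. -/
theorem one_sub_lineProj_vVec_le {d₀ : ℕ} (hG : ∀ i, G.degree i ≤ d₀)
    (hP : P.NearIsometric δ) (hδ0 : 0 < δ) (hδ : δ ≤ 1 / 72) (hδd : 6 * δ + 8 * δ * d₀ ≤ 1 / 2) :
    1 - lineProj P.vVec ≤ (2 : ℝ) • P.hamiltonian := by
  classical
  have hδ2 : δ ≤ 1 / 2 := by linarith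
  have h0 : 0 ≤ P.hamiltonian := Finset.sum_nonneg fun e _ => P.energy_nonneg hP hδ2 e
  refine one_sub_lineProj_le h0 ?_ ?_ ?_
  · have h := smul_sum_le_sum_mul_sum (A := P.VOp) P.energy Touches (fun e f h => h.symm)
      (fun e f h => h.1) (a := 1 - 6 * δ) (b := 4 * δ) (by linarith) (card_touches_le hG)
      (P.energy_nonneg hP hδ2) (P.le_energy_sq hP hδ2)
      (fun e f h => P.anticommutator_touches_ge hP hδ0 hδ h)
      (fun e f hne h => P.energy_mul_energy_nonneg hP hδ2 hne h)
    refine le_trans (smul_le_smul_coeff ?_ h0) h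
    push_cast; linarith
  · rw [hamiltonian, Matrix.sum_mulVec]
    exact Finset.sum_eq_zero fun e _ => P.energy_mulVec_vVec e
  · intro w hw
    refine P.exists_eq_smul_vVec fun e => ?_
    have hps : ∀ e, (P.energy e).PosSemidef := fun e =>
      Matrix.nonneg_iff_posSemidef.1 (P.energy_nonneg hP hδ2 e)
    have h1 : ∑ e, star w ⬝ᵥ P.energy e *ᵥ w = 0 := by
      rw [← dotProduct_sum, ← Matrix.sum_mulVec, ← hamiltonian, hw, dotProduct_zero]
    exact ((hps e).dotProduct_mulVec_zero_iff w).1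
      ((Finset.sum_eq_zero_iff_of_nonneg fun e _ => (hps e).dotProduct_mulVec_nonneg w).1 h1 e
        (Finset.mem_univ e))

/-- The state of the PEPS is the image of the ground state of the virtual energies. -/
theorem lift_lineProj_vVec : P.lift (lineProj P.vVec) = P.state := by
  have h : star P.vec ⬝ᵥ P.vec = star P.vVec ⬝ᵥ P.vVec := by
    rw [← globalIso_mulVec_vVec, Matrix.star_mulVec, Matrix.dotProduct_mulVec,
      Matrix.vecMul_vecMul, globalIso_conjTranspose_mul, Matrix.vecMul_one]
  rw [lift, lineProj, state, h, Matrix.mul_smul, Matrix.smul_mul, Matrix.mul_vecMulVec,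
    Matrix.vecMulVec_mul, globalIso_mulVec_vVec, ← Matrix.star_mulVec, globalIso_mulVec_vVec]

end InjectivePEPS

/-! ### Contraction of the energy -/

section Trace

variable {n : Type*} [Fintype n] [DecidableEq n]

open scoped Matrix.Norms.L2Operator in
theorem trace_mul_nonneg {A σ : Matrix n n ℂ} (hA : 0 ≤ A) (hσ : σ.PosSemidef) :
    0 ≤ (A * σ).trace := by
  obtain ⟨B, rfl⟩ := CStarAlgebra.nonneg_iff_eq_star_mul_self.1 (Matrix.nonneg_iff_posSemidef.2 hσ)
  rw [← Matrix.mul_assoc, Matrix.trace_mul_comm, ← Matrix.mul_assoc]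
  exact ((Matrix.nonneg_iff_posSemidef.1 hA).mul_mul_conjTranspose_same B).trace_nonneg

theorem re_trace_mul_mono {A B σ : Matrix n n ℂ} (h : A ≤ B) (hσ : σ.PosSemidef) :
    (A * σ).trace.re ≤ (B * σ).trace.re := by
  have := trace_mul_nonneg (sub_nonneg.2 h) hσ
  rw [Matrix.sub_mul, Matrix.trace_sub] at this
  have h2 := (Complex.le_def.1 this).1
  simp only [Complex.zero_re, Complex.sub_re] at h2
  linarith

theorem re_trace_smul_mul (r : ℝ) (A σ : Matrix n n ℂ) :
    ((r • A) * σ).trace.re = r * (A * σ).trace.re := by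
  rw [Matrix.smul_mul, Matrix.trace_smul, Complex.real_smul, Complex.re_ofReal_mul]

end Trace

theorem one_add_pow_le {η : ℝ} (hη : 0 ≤ η) {m : ℕ} (h : 2 * η * m ≤ 1) :
    (1 + η) ^ m ≤ 1 + 2 * η * m := by
  induction m with
  | zero => simp
  | succ m ih =>
    push_cast at h ⊢
    have h1 : 2 * η * m ≤ 1 := by nlinarith
    have := ih h1
    rw [pow_succ]
    nlinarith [mul_le_mul_of_nonneg_right this (by linarith : (0 : ℝ) ≤ 1 + η)]

namespace InjectivePEPS

section L2

open scoped Matrix.Norms.L2Operator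

variable {N : ℕ} {G : SimpleGraph (Fin N)} [DecidableRel G.Adj] {d D : ℕ}
  (P : InjectivePEPS G d D) {δ Γ : ℝ}

/-- The expected energy of a bond. -/
def bondWeight (e : G.edgeSet) (σ : P.VOp) : ℝ := (P.energy e * σ).trace.re

theorem bondWeight_nonneg (hP : P.NearIsometric δ) (hδ : δ ≤ 1 / 2) (e : G.edgeSet) {σ : P.VOp}
    (hσ : σ.PosSemidef) : 0 ≤ P.bondWeight e σ :=
  (Complex.le_def.1 (trace_mul_nonneg (P.energy_nonneg hP hδ e) hσ)).1

theorem bondWeight_vEdgeChannel (hΓ : 0 ≤ Γ) (e f : G.edgeSet) (σ : P.VOp) :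
    P.bondWeight e (P.vEdgeChannel Γ f σ) =
      (krausDual Γ (P.vKraus₀ Γ f) (P.vJump f) (P.energy e) * σ).trace.re := by
  rw [bondWeight, vEdgeChannel, trace_mul_krausMap, sum_vKraus P hΓ]

/-- The parameters are in the range where the energy estimates hold. -/
structure Admissible (δ Γ : ℝ) : Prop where
  near : P.NearIsometric δ
  pos : 0 < δ
  le : δ ≤ 1 / 72
  rate_pos : 0 < Γ
  rate_le : Γ ≤ 1 / 40

variable {P}

namespace Admissible

theorem one_sub_pairRate (h : P.Admissible δ Γ) (e : G.edgeSet) :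
    (1 - Γ • P.pairRate e).PosSemidef :=
  P.one_sub_pairRate_posSemidef h.near h.pos.le (by linarith [h.le]) h.rate_pos.le
    (by linarith [h.rate_le]) e

theorem weight_nonneg (h : P.Admissible δ Γ) (e : G.edgeSet) {σ : P.VOp} (hσ : σ.PosSemidef) :
    0 ≤ P.bondWeight e σ :=
  P.bondWeight_nonneg h.near (by linarith [h.le]) e hσ

theorem weight_self_le (h : P.Admissible δ Γ) (e : G.edgeSet) {σ : P.VOp} (hσ : σ.PosSemidef) :
    P.bondWeight e (P.vEdgeChannel Γ e σ) ≤ (1 - Γ / 2) * P.bondWeight e σ := by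
  rw [P.bondWeight_vEdgeChannel h.rate_pos.le, bondWeight, ← re_trace_smul_mul]
  exact re_trace_mul_mono
    (P.krausDual_energy_self_le h.near h.pos h.le h.rate_pos h.rate_le e) hσ

theorem weight_touches_le (h : P.Admissible δ Γ) {e f : G.edgeSet} (hef : Touches e f) {σ : P.VOp}
    (hσ : σ.PosSemidef) :
    P.bondWeight e (P.vEdgeChannel Γ f σ) ≤ P.bondWeight e σ +
      (4 * δ * Γ + 12 * Γ ^ 2) * (P.bondWeight e σ + P.bondWeight f σ) := by
  rw [P.bondWeight_vEdgeChannel h.rate_pos.le]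
  refine (re_trace_mul_mono
    (P.krausDual_energy_touches_le h.near h.pos h.le h.rate_pos h.rate_le hef) hσ).trans_eq ?_
  rw [Matrix.add_mul, Matrix.trace_add, Complex.add_re, re_trace_smul_mul, Matrix.add_mul,
    Matrix.trace_add, Complex.add_re]
  rfl

theorem weight_of_not_touches (h : P.Admissible δ Γ) {e f : G.edgeSet} (hne : e ≠ f)
    (hef : ¬ Touches e f) (σ : P.VOp) :
    P.bondWeight e (P.vEdgeChannel Γ f σ) = P.bondWeight e σ := by
  rw [P.bondWeight_vEdgeChannel h.rate_pos.le, P.krausDual_energy_of_not_touches hne hef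
    h.rate_pos.le (h.one_sub_pairRate f)]
  rfl

end Admissible

variable (P) in
/-- The product of the virtual channels of a list of edges. -/
def vListChannel (Γ : ℝ) (l : List G.edgeSet) : Module.End ℂ P.VOp :=
  (l.map (P.vEdgeChannel Γ)).prod

theorem vListChannel_cons (f : G.edgeSet) (l : List G.edgeSet) (σ : P.VOp) :
    P.vListChannel Γ (f :: l) σ = P.vEdgeChannel Γ f (P.vListChannel Γ l σ) := by
  rw [vListChannel, List.map_cons, List.prod_cons]; rfl

theorem vListChannel_posSemidef (l : List G.edgeSet) {σ : P.VOp} (hσ : σ.PosSemidef) :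
    (P.vListChannel Γ l σ).PosSemidef := by
  induction l with
  | nil => exact hσ
  | cons f l ih => rw [vListChannel_cons]; exact krausMap_posSemidef _ ih

namespace Admissible

theorem trace_vListChannel (h : P.Admissible δ Γ) (l : List G.edgeSet) (σ : P.VOp) :
    (P.vListChannel Γ l σ).trace = σ.trace := by
  induction l with
  | nil => rfl
  | cons f l ih =>
    rw [vListChannel_cons, vEdgeChannel,
      trace_krausMap _ (P.sum_vKraus_one h.rate_pos.le (h.one_sub_pairRate f)), ih]

/-- The energy of `e` is not changed by edges away from `e`. -/
theorem weight_list_of_not_touches (h : P.Admissible δ Γ) {e : G.edgeSet} {l : List G.edgeSet}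
    (hl : ∀ f ∈ l, e ≠ f ∧ ¬ Touches e f) (σ : P.VOp) :
    P.bondWeight e (P.vListChannel Γ l σ) = P.bondWeight e σ := by
  induction l with
  | nil => rfl
  | cons f l ih =>
    rw [List.forall_mem_cons] at hl
    rw [vListChannel_cons, h.weight_of_not_touches hl.1.1 hl.1.2, ih hl.2]

/-- In a product of channels of disjoint edges, the energy of `e` is lowered by the channel of `e`
and not affected by the others. -/
theorem weight_list_mem_le (h : P.Admissible δ Γ) {e : G.edgeSet} {l : List G.edgeSet}
    (hl : l.Pairwise fun e f => e ≠ f ∧ ¬ Touches e f) (he : e ∈ l) {σ : P.VOp}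
    (hσ : σ.PosSemidef) :
    P.bondWeight e (P.vListChannel Γ l σ) ≤ (1 - Γ / 2) * P.bondWeight e σ := by
  induction l with
  | nil => simp at he
  | cons f l ih =>
    rw [List.pairwise_cons] at hl
    rw [vListChannel_cons]
    rcases List.mem_cons.1 he with rfl | he
    · refine (h.weight_self_le e (vListChannel_posSemidef l hσ)).trans_eq ?_
      rw [h.weight_list_of_not_touches hl.1]
    · have hf := hl.1 e he
      rw [h.weight_of_not_touches hf.1.symm fun h' => hf.2 h'.symm]
      exact ih hl.2 he

open Classical in
/-- Each edge next to `e` multiplies the energy of `e` by at most `1 + η` and adds a fraction `η` of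
its own energy, which the other edges of the list have not changed because they are disjoint. -/
theorem weight_list_le (h : P.Admissible δ Γ) {e : G.edgeSet} {l : List G.edgeSet}
    (hl : l.Pairwise fun e f => e ≠ f ∧ ¬ Touches e f) (he : e ∉ l) {σ : P.VOp}
    (hσ : σ.PosSemidef) {η : ℝ} (hη : η = 4 * δ * Γ + 12 * Γ ^ 2) :
    P.bondWeight e (P.vListChannel Γ l σ) ≤
      (1 + η) ^ (l.map fun f => if Touches e f then 1 else 0).sum *
        (P.bondWeight e σ +
          η * (l.map fun f => if Touches e f then P.bondWeight f σ else 0).sum) := by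
  have hη0 : 0 ≤ η := by
    have := h.pos; have := h.rate_pos
    rw [hη]; positivity
  induction l with
  | nil => simp [vListChannel]
  | cons f l ih =>
    rw [List.pairwise_cons] at hl
    rw [List.mem_cons, not_or] at he
    have ih := ih hl.2 he.2
    have hτ := vListChannel_posSemidef (Γ := Γ) l hσ
    rw [vListChannel_cons, List.map_cons, List.map_cons, List.sum_cons, List.sum_cons]
    by_cases hf : Touches e f
    · rw [if_pos hf, if_pos hf, Nat.add_comm 1, pow_succ]
      have h1 := h.weight_touches_le hf hτ
      rw [← hη, h.weight_list_of_not_touches hl.1] at h1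
      have hwf := h.weight_nonneg f hσ
      have hpow : 1 ≤ (1 + η) ^ (l.map fun f => if Touches e f then 1 else 0).sum :=
        one_le_pow₀ (by linarith)
      set M := (1 + η) ^ (l.map fun f => if Touches e f then 1 else 0).sum
      have h2 := mul_le_mul_of_nonneg_left ih (by linarith : (0 : ℝ) ≤ 1 + η)
      have h3 : η * P.bondWeight f σ ≤ M * (1 + η) * (η * P.bondWeight f σ) := by
        refine le_mul_of_one_le_left (by positivity) ?_
        nlinarith
      nlinarith
    · rw [if_neg hf, if_neg hf, zero_add, zero_add, h.weight_of_not_touches he.1 hf]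
      exact ih

end Admissible

variable (P) in
/-- The total expected energy. -/
def excitation (σ : P.VOp) : ℝ := ∑ e, P.bondWeight e σ

theorem excitation_eq (σ : P.VOp) : P.excitation σ = (P.hamiltonian * σ).trace.re := by
  rw [hamiltonian, Finset.sum_mul, Matrix.trace_sum, Complex.re_sum]; rfl

theorem bondWeight_smul_sum {κ : Type*} [Fintype κ] (r : ℝ) (σ : κ → P.VOp) (e : G.edgeSet) :
    P.bondWeight e ((r : ℂ) • ∑ a, σ a) = r * ∑ a, P.bondWeight e (σ a) := by
  simp only [bondWeight]
  rw [Matrix.mul_smul, Matrix.trace_smul, smul_eq_mul, Complex.re_ofReal_mul, Finset.mul_sum,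
    Matrix.trace_sum, Complex.re_sum]

theorem vClassChannel_eq {k : ℕ} (c : EdgePartition G k) (q : Fin k) :
    P.vClassChannel Γ c q =
      P.vListChannel Γ (Finset.univ.filter fun e : G.edgeSet => c.cls e = q).toList := rfl

theorem pairwise_class {k : ℕ} (c : EdgePartition G k) (q : Fin k) :
    (Finset.univ.filter fun e : G.edgeSet => c.cls e = q).toList.Pairwise
      fun e f => e ≠ f ∧ ¬ Touches e f := by
  refine (Finset.nodup_toList _).imp_of_mem fun {e f} he hf hne => ⟨hne, fun ht => ?_⟩
  rw [Finset.mem_toList, Finset.mem_filter] at he hf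
  obtain ⟨-, v, hv⟩ := ht
  exact c.disjoint e f hne (he.2.trans hf.2.symm) v hv

namespace Admissible

open Classical in
/-- The effect of one class of edges on the energy of `e`: cooling if `e` belongs to the class, and
heating by the edges of the class that touch `e`. -/
theorem weight_vClassChannel_le (h : P.Admissible δ Γ) {k : ℕ} (c : EdgePartition G k) (q : Fin k)
    (e : G.edgeSet) {σ : P.VOp} (hσ : σ.PosSemidef) {η : ℝ} (hη : η = 4 * δ * Γ + 12 * Γ ^ 2)
    {d₀ : ℕ} (hG : ∀ i, G.degree i ≤ d₀) (hηd : 4 * η * d₀ ≤ 1) :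
    P.bondWeight e (P.vClassChannel Γ c q σ) ≤ P.bondWeight e σ -
      (if c.cls e = q then Γ / 2 * P.bondWeight e σ else 0) +
      2 * η * ∑ f ∈ Finset.univ.filter fun f : G.edgeSet => c.cls f = q,
        if Touches e f then P.bondWeight e σ + P.bondWeight f σ else 0 := by
  have hη0 : 0 ≤ η := by
    have := h.pos; have := h.rate_pos
    rw [hη]; positivity
  set s := Finset.univ.filter fun f : G.edgeSet => c.cls f = q with hs
  rw [vClassChannel_eq]
  have hw := h.weight_nonneg e hσ
  have hterm : ∀ f, 0 ≤ if Touches e f then P.bondWeight f σ else 0 := fun f => by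
    split_ifs
    · exact h.weight_nonneg f hσ
    · exact le_rfl
  by_cases hq : c.cls e = q
  · rw [if_pos hq]
    have h1 := h.weight_list_mem_le (pairwise_class c q)
      (Finset.mem_toList.2 (Finset.mem_filter.2 ⟨Finset.mem_univ _, hq⟩)) hσ
    have h2 : 0 ≤ ∑ f ∈ s, if Touches e f then P.bondWeight e σ + P.bondWeight f σ else 0 :=
      Finset.sum_nonneg fun f _ => by
        split_ifs
        · exact add_nonneg hw (h.weight_nonneg f hσ)
        · exact le_rfl
    have h3 := mul_nonneg (by linarith : (0 : ℝ) ≤ 2 * η) h2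
    linarith
  · rw [if_neg hq]
    have h1 := h.weight_list_le (pairwise_class c q)
      (e := e) (fun h' => hq (Finset.mem_filter.1 (Finset.mem_toList.1 h')).2) hσ hη
    rw [Finset.sum_map_toList, Finset.sum_map_toList, ← hs, ← Finset.card_filter] at h1
    set m := (s.filter (Touches e)).card with hm
    have hmd : m ≤ 2 * d₀ :=
      (Finset.card_le_card (Finset.filter_subset_filter _ (Finset.subset_univ _))).trans
        (card_touches_le hG e)
    have hmd' : (m : ℝ) ≤ 2 * d₀ := by exact_mod_cast hmd
    have h4 : 2 * η * m ≤ 1 := by nlinarith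
    have hpow := one_add_pow_le hη0 h4
    set S := ∑ f ∈ s, if Touches e f then P.bondWeight f σ else 0 with hS
    have hS0 : 0 ≤ S := Finset.sum_nonneg fun f _ => hterm f
    have hsum : (∑ f ∈ s, if Touches e f then P.bondWeight e σ + P.bondWeight f σ else 0) =
        m * P.bondWeight e σ + S := by
      rw [← Finset.sum_filter, Finset.sum_add_distrib, Finset.sum_const, nsmul_eq_mul, ← hm, hS,
        ← Finset.sum_filter]
    rw [hsum, sub_zero]
    have h5 := h1.trans (mul_le_mul_of_nonneg_right hpow
      (add_nonneg hw (mul_nonneg hη0 hS0)))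
    have h6 := mul_le_mul_of_nonneg_right h4 (mul_nonneg hη0 hS0)
    nlinarith

open Classical in
/-- One step of the dynamics contracts the total energy: each edge is cooled in one of the `k`
classes, which outweighs the heating by the neighbouring edges. -/
theorem excitation_vChannel_le (h : P.Admissible δ Γ) {k : ℕ} (hk : 1 ≤ k) (c : EdgePartition G k)
    {σ : P.VOp} (hσ : σ.PosSemidef) {η : ℝ} (hη : η = 4 * δ * Γ + 12 * Γ ^ 2)
    {d₀ : ℕ} (hG : ∀ i, G.degree i ≤ d₀) (hηd : 4 * η * d₀ ≤ 1) (hηΓ : 8 * η * d₀ ≤ Γ / 4) :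
    P.excitation (P.vChannel Γ c σ) ≤ (1 - Γ / (4 * k)) * P.excitation σ := by
  have hη0 : 0 ≤ η := by
    have := h.pos; have := h.rate_pos
    rw [hη]; positivity
  have hk0 : (0 : ℝ) < k := by exact_mod_cast hk
  have h1 : P.excitation (P.vChannel Γ c σ) =
      (k : ℝ)⁻¹ * ∑ e, ∑ q, P.bondWeight e (P.vClassChannel Γ c q σ) := by
    rw [excitation, Finset.mul_sum]
    refine Finset.sum_congr rfl fun e _ => ?_
    rw [← bondWeight_smul_sum, vChannel, LinearMap.smul_apply, LinearMap.sum_apply]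
    simp
  have h2 : ∀ e, ∑ q, P.bondWeight e (P.vClassChannel Γ c q σ) ≤
      (k - Γ / 2) * P.bondWeight e σ + 2 * η *
        ∑ f, if Touches e f then P.bondWeight e σ + P.bondWeight f σ else 0 := by
    intro e
    refine (Finset.sum_le_sum fun q _ =>
      h.weight_vClassChannel_le c q e hσ hη hG hηd).trans_eq ?_
    rw [Finset.sum_add_distrib, Finset.sum_sub_distrib, Finset.sum_const, Finset.card_univ,
      Fintype.card_fin, nsmul_eq_mul, Finset.sum_ite_eq, if_pos (Finset.mem_univ _),
      ← Finset.mul_sum, Finset.sum_fiberwise]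
    ring
  have h3 : ∑ e, ∑ f, (if Touches e f then P.bondWeight e σ + P.bondWeight f σ else 0) ≤
      4 * d₀ * P.excitation σ := by
    have ha : ∑ e, ∑ f, (if Touches e f then P.bondWeight e σ else 0) ≤
        2 * d₀ * P.excitation σ := by
      rw [excitation, Finset.mul_sum]
      refine Finset.sum_le_sum fun e _ => ?_
      rw [← Finset.sum_filter, Finset.sum_const, nsmul_eq_mul]
      refine mul_le_mul_of_nonneg_right ?_ (h.weight_nonneg e hσ)
      exact_mod_cast card_touches_le hG e
    have hb : ∑ e, ∑ f, (if Touches e f then P.bondWeight f σ else 0) =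
        ∑ e, ∑ f, (if Touches e f then P.bondWeight e σ else 0) := by
      rw [Finset.sum_comm]
      refine Finset.sum_congr rfl fun e _ => Finset.sum_congr rfl fun f _ => ?_
      simp only [show Touches f e ↔ Touches e f from ⟨Touches.symm, Touches.symm⟩]
    have hc : ∀ e f, (if Touches e f then P.bondWeight e σ + P.bondWeight f σ else 0) =
        (if Touches e f then P.bondWeight e σ else 0) +
          (if Touches e f then P.bondWeight f σ else 0) := by
      intro e f; split_ifs <;> simp
    simp only [hc, Finset.sum_add_distrib, hb]
    linarith
  have h4 : ∑ e, ∑ q, P.bondWeight e (P.vClassChannel Γ c q σ) ≤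
      (k - Γ / 4) * P.excitation σ := by
    refine (Finset.sum_le_sum fun e _ => h2 e).trans ?_
    rw [Finset.sum_add_distrib, ← Finset.mul_sum, ← Finset.mul_sum]
    have hΦ : 0 ≤ P.excitation σ := Finset.sum_nonneg fun e _ => h.weight_nonneg e hσ
    have h5 := mul_le_mul_of_nonneg_left h3 (by linarith : (0 : ℝ) ≤ 2 * η)
    have h6 := mul_le_mul_of_nonneg_right hηΓ hΦ
    rw [← excitation]
    nlinarith
  rw [h1]
  refine (mul_le_mul_of_nonneg_left h4 (inv_nonneg.2 hk0.le)).trans_eq ?_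
  field_simp

theorem trace_vChannel (h : P.Admissible δ Γ) {k : ℕ} (hk : 1 ≤ k) (c : EdgePartition G k)
    (σ : P.VOp) : (P.vChannel Γ c σ).trace = σ.trace := by
  have hk0 : (k : ℂ) ≠ 0 := by exact_mod_cast (by omega : k ≠ 0)
  rw [vChannel, LinearMap.smul_apply, LinearMap.sum_apply, Matrix.trace_smul, Matrix.trace_sum]
  simp only [vClassChannel_eq, h.trace_vListChannel]
  rw [Finset.sum_const, Finset.card_univ, Fintype.card_fin, nsmul_eq_mul, smul_eq_mul,
    inv_mul_cancel_left₀ hk0]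

end Admissible

theorem vChannel_posSemidef {k : ℕ} (c : EdgePartition G k) {σ : P.VOp} (hσ : σ.PosSemidef) :
    (P.vChannel Γ c σ).PosSemidef := by
  rw [vChannel, LinearMap.smul_apply, LinearMap.sum_apply]
  refine Matrix.PosSemidef.smul (Matrix.posSemidef_sum _ fun q _ => ?_) (by positivity)
  rw [vClassChannel_eq]
  exact vListChannel_posSemidef _ hσ

theorem vChannel_pow_posSemidef {k : ℕ} (c : EdgePartition G k) {σ : P.VOp} (hσ : σ.PosSemidef)
    (T : ℕ) : ((P.vChannel Γ c ^ T) σ).PosSemidef := by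
  induction T with
  | zero => simpa using hσ
  | succ T ih => rw [pow_succ', Module.End.mul_apply]; exact vChannel_posSemidef c ih

namespace Admissible

theorem trace_vChannel_pow (h : P.Admissible δ Γ) {k : ℕ} (hk : 1 ≤ k) (c : EdgePartition G k)
    (σ : P.VOp) (T : ℕ) : ((P.vChannel Γ c ^ T) σ).trace = σ.trace := by
  induction T with
  | zero => simp
  | succ T ih => rw [pow_succ', Module.End.mul_apply, h.trace_vChannel hk, ih]

/-- Each bond has energy at most `2`, and there are at most `N d₀` bonds. -/
theorem excitation_le (h : P.Admissible δ Γ) {d₀ : ℕ} (hG : ∀ i, G.degree i ≤ d₀) {σ : P.VOp}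
    (hσ : σ.PosSemidef) : P.excitation σ ≤ 2 * (N * d₀) * σ.trace.re := by
  have hσ0 : 0 ≤ σ.trace.re := (Complex.le_def.1 hσ.trace_nonneg).1
  have h1 : ∀ e, P.bondWeight e σ ≤ 2 * σ.trace.re := fun e => by
    have := re_trace_mul_mono (P.energy_le_two h.near h.le e) hσ
    rwa [re_trace_smul_mul, Matrix.one_mul] at this
  have hcard : (Fintype.card G.edgeSet : ℝ) ≤ N * d₀ := by exact_mod_cast card_edges_le hG
  calc P.excitation σ ≤ ∑ _e : G.edgeSet, 2 * σ.trace.re := Finset.sum_le_sum fun e _ => h1 e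
    _ = Fintype.card G.edgeSet * (2 * σ.trace.re) := by simp
    _ ≤ N * d₀ * (2 * σ.trace.re) := mul_le_mul_of_nonneg_right hcard (by linarith)
    _ = _ := by ring

/-- After `T` steps a state of the virtual system is close to the ground state. -/
theorem infidelity_le (h : P.Admissible δ Γ) {k : ℕ} (hk : 1 ≤ k) (c : EdgePartition G k)
    {σ : P.VOp} (hσ : σ.PosSemidef) {d₀ : ℕ} (hd : 1 ≤ d₀) (hG : ∀ i, G.degree i ≤ d₀)
    (hδd : δ * d₀ ≤ 1 / 1000) (hΓ1 : δ / 2 ≤ Γ) (hΓ2 : Γ ≤ 2 * δ) (T : ℕ) :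
    ((1 - lineProj P.vVec) * (P.vChannel Γ c ^ T) σ).trace.re ≤
      4 * (N * d₀ * Real.exp (-(1 / 8 * (δ / k) * T))) * σ.trace.re := by
  have hδ0 := h.pos
  have hΓ0 := h.rate_pos
  have hd' : (1 : ℝ) ≤ d₀ := by exact_mod_cast hd
  have hk0 : (0 : ℝ) < k := by exact_mod_cast hk
  have hδ : δ ≤ 1 / 1000 := by nlinarith
  -- This uses `Γ ≤ 2 δ`.
  have hηle : 4 * δ * Γ + 12 * Γ ^ 2 ≤ 28 * δ * Γ := by nlinarith
  have hηd : (4 * δ * Γ + 12 * Γ ^ 2) * d₀ ≤ 28 / 1000 * Γ := by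
    have := mul_le_mul_of_nonneg_right hηle (by linarith : (0 : ℝ) ≤ d₀)
    nlinarith [mul_le_mul_of_nonneg_right hδd hΓ0.le]
  have hps : ∀ T : ℕ, ((P.vChannel Γ c ^ T) σ).PosSemidef := vChannel_pow_posSemidef c hσ
  have hrate : 0 ≤ 1 - Γ / (4 * k) := by
    have h1k : (1 : ℝ) ≤ k := by exact_mod_cast hk
    rw [sub_nonneg, div_le_one (by positivity)]
    linarith
  have hiter : P.excitation ((P.vChannel Γ c ^ T) σ) ≤
      (1 - Γ / (4 * k)) ^ T * P.excitation σ := by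
    induction T with
    | zero => simp
    | succ T ih =>
      rw [pow_succ', Module.End.mul_apply, pow_succ', mul_assoc]
      exact (h.excitation_vChannel_le hk c (hps T) rfl hG (by linarith) (by linarith)).trans
        (mul_le_mul_of_nonneg_left ih hrate)
  have hexp : (1 - Γ / (4 * k)) ^ T ≤ Real.exp (-(1 / 8 * (δ / k) * T)) := by
    -- This uses `δ / 2 ≤ Γ`.
    have h1 : 1 - Γ / (4 * k) ≤ Real.exp (-(1 / 8 * (δ / k))) := by
      refine le_trans ?_ (Real.add_one_le_exp _)
      have : 1 / 8 * (δ / k) ≤ Γ / (4 * k) := by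
        rw [show 1 / 8 * (δ / k) = (δ / 2) / (4 * k) by field_simp; ring]
        gcongr
      linarith
    calc _ ≤ Real.exp (-(1 / 8 * (δ / k))) ^ T := pow_le_pow_left₀ hrate h1 T
      _ = _ := by rw [← Real.exp_nat_mul]; congr 1; ring
  have hgap := re_trace_mul_mono
    (P.one_sub_lineProj_vVec_le hG h.near h.pos h.le (by nlinarith)) (hps T)
  rw [re_trace_smul_mul, ← excitation_eq] at hgap
  have hσ0 : 0 ≤ σ.trace.re := (Complex.le_def.1 hσ.trace_nonneg).1
  have h0 : 0 ≤ P.excitation σ := Finset.sum_nonneg fun e _ => h.weight_nonneg e hσ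
  calc _ ≤ 2 * P.excitation ((P.vChannel Γ c ^ T) σ) := hgap
    _ ≤ 2 * (Real.exp (-(1 / 8 * (δ / k) * T)) * (2 * (N * d₀) * σ.trace.re)) := by
      refine mul_le_mul_of_nonneg_left (hiter.trans ?_) (by norm_num)
      exact mul_le_mul hexp (h.excitation_le hG hσ) h0 (Real.exp_pos _).le
    _ = _ := by ring

end Admissible

end L2

end InjectivePEPS

/-! ### The single-site channels -/

section ReplaceSite

variable {N d : ℕ}

theorem siteOp_mul_apply (i : Fin N) (M : Matrix (Fin d) (Fin d) ℂ) (X : Op N d)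
    (x y : Conf N d) :
    (siteOp i M * X) x y = ∑ c, M (x i) c * X (Function.update x i c) y := by
  have hinj : Function.Injective fun c => Function.update x i c := Function.update_injective x i
  rw [Matrix.mul_apply, ← Finset.sum_subset (Finset.subset_univ (Finset.univ.map ⟨_, hinj⟩)),
    Finset.sum_map]
  · refine Finset.sum_congr rfl fun c _ => ?_
    simp only [Function.Embedding.coeFn_mk, siteOp, Function.update_self]
    rw [if_pos fun l hl => by rw [Function.update_of_ne hl]]
  · intro z _ hz
    rw [siteOp, if_neg, zero_mul]
    intro h
    refine hz (Finset.mem_map.2 ⟨z i, Finset.mem_univ _, funext fun l => ?_⟩)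
    simp only [Function.Embedding.coeFn_mk]
    rcases eq_or_ne l i with rfl | hl
    · simp
    · rw [Function.update_of_ne hl, h l hl]

theorem siteOp_conjTranspose (i : Fin N) (M : Matrix (Fin d) (Fin d) ℂ) :
    (siteOp i M)ᴴ = siteOp i Mᴴ := by
  rw [siteOp_eq_site, siteOp_eq_site]
  exact (map_star (site (α := fun _ : Fin N => Fin d) i) M).symm

theorem siteOp_mul (i : Fin N) (M M' : Matrix (Fin d) (Fin d) ℂ) :
    siteOp i (M * M') = siteOp i M * siteOp i M' := by
  rw [siteOp_eq_site, siteOp_eq_site, siteOp_eq_site, map_mul]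

theorem siteOp_commute {i j : Fin N} (h : i ≠ j) (M M' : Matrix (Fin d) (Fin d) ℂ) :
    Commute (siteOp i M) (siteOp j M') := by
  rw [siteOp_eq_site, siteOp_eq_site]
  exact site_commute h _ _

theorem mul_siteOp_apply (i : Fin N) (M : Matrix (Fin d) (Fin d) ℂ) (X : Op N d)
    (x y : Conf N d) :
    (X * siteOp i M) x y = ∑ c, X x (Function.update y i c) * M c (y i) := by
  have h : (X * siteOp i M) x y = star ((siteOp i Mᴴ * Xᴴ) y x) := by
    rw [← siteOp_conjTranspose, ← Matrix.conjTranspose_mul, Matrix.conjTranspose_apply, star_star]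
  rw [h, siteOp_mul_apply, star_sum]
  refine Finset.sum_congr rfl fun c _ => ?_
  rw [star_mul', Matrix.conjTranspose_apply, Matrix.conjTranspose_apply, star_star, star_star,
    mul_comm]

/-- Measuring `M† M` on a qudit and preparing `B B†` in its place has Kraus operators
`B |b⟩⟨a| M`. -/
theorem replaceSite_eq_sum (i : Fin N) (B M : Matrix (Fin d) (Fin d) ℂ) (X : Op N d) :
    replaceSite i (B * Bᴴ) (siteOp i (Mᴴ * M) * X) =
      ∑ ab : Fin d × Fin d, siteOp i (Matrix.vecMulVec (fun s => B s ab.2) (M ab.1)) * X *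
        (siteOp i (Matrix.vecMulVec (fun s => B s ab.2) (M ab.1)))ᴴ := by
  ext x y
  simp only [Matrix.sum_apply, siteOp_conjTranspose, mul_siteOp_apply, siteOp_mul_apply,
    Matrix.conjTranspose_apply, Matrix.vecMulVec_apply, Fintype.sum_prod_type]
  change (B * Bᴴ) (x i) (y i) * ∑ a, (siteOp i (Mᴴ * M) * X) (Function.update x i a)
    (Function.update y i a) = _
  simp only [siteOp_mul_apply, Function.update_self, Function.update_idem]
  simp only [Matrix.mul_apply, Matrix.conjTranspose_apply]
  conv_rhs => rw [Finset.sum_comm]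
  rw [Finset.sum_mul]
  refine Finset.sum_congr rfl fun b _ => ?_
  simp only [Finset.sum_mul, Finset.mul_sum, star_mul']
  conv_rhs => rw [Finset.sum_comm]
  refine Finset.sum_congr rfl fun a _ => ?_
  rw [Finset.sum_comm]
  refine Finset.sum_congr rfl fun r _ => Finset.sum_congr rfl fun c _ => ?_
  ring

/-- The total rate of the Kraus operators of `replaceSite_eq_sum`. -/
theorem sum_siteOp_rankOne (i : Fin N) (B M : Matrix (Fin d) (Fin d) ℂ) :
    ∑ ab : Fin d × Fin d, (siteOp i (Matrix.vecMulVec (fun s => B s ab.2) (M ab.1)))ᴴ *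
      siteOp i (Matrix.vecMulVec (fun s => B s ab.2) (M ab.1)) =
      (B * Bᴴ).trace • siteOp i (Mᴴ * M) := by
  simp only [siteOp_conjTranspose, ← siteOp_mul]
  simp only [siteOp_eq_site]
  rw [← map_sum, ← map_smul]
  congr 1
  ext c c'
  rw [Matrix.sum_apply, Matrix.smul_apply, Matrix.mul_apply, Matrix.trace_mul_comm]
  simp only [Matrix.trace, Matrix.diag, Matrix.mul_apply, Matrix.conjTranspose_apply,
    Matrix.vecMulVec_apply, Fintype.sum_prod_type, smul_eq_mul, star_mul']
  rw [Finset.sum_comm, Finset.sum_mul]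
  refine Finset.sum_congr rfl fun b _ => ?_
  rw [Finset.sum_mul_sum, Finset.sum_comm]
  refine Finset.sum_congr rfl fun s _ => Finset.sum_congr rfl fun a _ => ?_
  ring

end ReplaceSite

namespace InjectivePEPS

variable {N : ℕ} {G : SimpleGraph (Fin N)} [DecidableRel G.Adj] {d D : ℕ}
  (P : InjectivePEPS G d D)

theorem siteProj_isHermitian (i : Fin N) : (P.siteProj i)ᴴ = P.siteProj i :=
  (imProj_spec (P.A i) (P.injective_A i)).1

theorem siteProj_mul_self (i : Fin N) : P.siteProj i * P.siteProj i = P.siteProj i :=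
  (imProj_spec (P.A i) (P.injective_A i)).2.1

theorem rank_A (i : Fin N) : (P.A i).rank = Fintype.card (Virt G D i) := by
  have h : Function.Injective (P.A i).mulVecLin := P.injective_A i
  rw [Matrix.rank, LinearMap.finrank_range_of_inj h, Module.finrank_fintype_fun_eq_card]

theorem trace_siteProj (i : Fin N) : (P.siteProj i).trace = (P.A i).rank := by
  rw [siteProj, imProj, Matrix.trace_mul_comm, pinv_mul_self _ (P.injective_A i),
    Matrix.trace_one, rank_A]

theorem rank_A_ne_zero (i : Fin N) : ((P.A i).rank : ℂ) ≠ 0 := by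
  obtain ⟨x⟩ := P.nonempty_fin
  have : Nonempty (Virt G D i) := ⟨fun _ => x⟩
  rw [rank_A]
  exact_mod_cast Fintype.card_ne_zero

/-- A square root of the state prepared by the single-site channel. -/
def sitePrep (i : Fin N) : Matrix (Fin d) (Fin d) ℂ :=
  ((Real.sqrt (P.A i).rank : ℝ) : ℂ)⁻¹ • P.siteProj i

theorem sitePrep_mul (i : Fin N) :
    P.sitePrep i * (P.sitePrep i)ᴴ = ((P.A i).rank : ℂ)⁻¹ • P.siteProj i := by
  rw [sitePrep, Matrix.conjTranspose_smul, siteProj_isHermitian, Matrix.smul_mul, Matrix.mul_smul,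
    siteProj_mul_self, smul_smul, star_inv₀, ← mul_inv]
  congr 2
  rw [RCLike.star_def, Complex.conj_ofReal, ← Complex.ofReal_mul,
    Real.mul_self_sqrt (Nat.cast_nonneg _), Complex.ofReal_natCast]

/-- The Kraus operators of a single-site channel. -/
def siteKraus (i : Fin N) (o : Option (Fin d × Fin d)) : Op N d :=
  siteOp i (o.elim (P.siteProj i) fun ab =>
    Matrix.vecMulVec (fun s => P.sitePrep i s ab.2) ((1 - P.siteProj i) ab.1))

theorem one_sub_siteProj (i : Fin N) :
    (1 - P.siteProj i)ᴴ * (1 - P.siteProj i) = 1 - P.siteProj i := by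
  rw [Matrix.conjTranspose_sub, Matrix.conjTranspose_one, siteProj_isHermitian, mul_sub, sub_mul,
    sub_mul, siteProj_mul_self]
  simp

theorem siteChannel_eq (i : Fin N) : P.siteChannel i = krausMap (P.siteKraus i) := by
  refine LinearMap.ext fun X => ?_
  rw [krausMap_apply, Fintype.sum_option, siteChannel, LinearMap.add_apply, LinearMap.comp_apply,
    LinearMap.mulLeft_apply, ← sitePrep_mul, ← one_sub_siteProj, replaceSite_eq_sum,
    LinearMap.mulLeftRight_apply]
  congr 1
  rw [siteKraus, siteOp_conjTranspose]
  change _ = siteOp i (P.siteProj i) * X * siteOp i (P.siteProj i)ᴴ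
  rw [siteProj_isHermitian]

theorem sum_siteKraus (i : Fin N) : ∑ o, (P.siteKraus i o)ᴴ * P.siteKraus i o = 1 := by
  rw [Fintype.sum_option]
  have h1 := sum_siteOp_rankOne (N := N) i (P.sitePrep i) (1 - P.siteProj i)
  rw [sitePrep_mul, Matrix.trace_smul, trace_siteProj, smul_eq_mul,
    inv_mul_cancel₀ (P.rank_A_ne_zero i), one_smul, one_sub_siteProj] at h1
  have h2 : (P.siteKraus i none)ᴴ * P.siteKraus i none = siteOp i (P.siteProj i) := by
    rw [siteKraus, siteOp_conjTranspose, ← siteOp_mul]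
    change siteOp i ((P.siteProj i)ᴴ * P.siteProj i) = _
    rw [siteProj_isHermitian, siteProj_mul_self]
  rw [h2]
  refine (congrArg _ h1).trans ?_
  rw [siteOp_eq_site, siteOp_eq_site, map_sub, map_one]
  abel

theorem siteProj_mul_siteKraus (i : Fin N) (o : Option (Fin d × Fin d)) :
    siteOp i (P.siteProj i) * P.siteKraus i o = P.siteKraus i o := by
  rw [siteKraus, ← siteOp_mul]
  congr 1
  cases o with
  | none => exact P.siteProj_mul_self i
  | some ab =>
    change P.siteProj i * Matrix.vecMulVec _ _ = Matrix.vecMulVec _ _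
    rw [Matrix.mul_vecMulVec]
    congr 1
    have h : P.siteProj i * P.sitePrep i = P.sitePrep i := by
      rw [sitePrep, Matrix.mul_smul, siteProj_mul_self]
    funext s
    exact congrFun (congrFun h s) ab.2

/-- The product of the single-site channels. -/
def allSites : SuperOp N d := ((List.finRange N).map P.siteChannel).prod

theorem siteList_cons (i : Fin N) (l : List (Fin N)) (X : Op N d) :
    ((i :: l).map P.siteChannel).prod X =
      krausMap (P.siteKraus i) ((l.map P.siteChannel).prod X) := by
  rw [List.map_cons, List.prod_cons, Module.End.mul_apply, siteChannel_eq]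

theorem siteList_posSemidef (l : List (Fin N)) {X : Op N d} (hX : X.PosSemidef) :
    ((l.map P.siteChannel).prod X).PosSemidef := by
  induction l with
  | nil => exact hX
  | cons i l ih => rw [siteList_cons]; exact krausMap_posSemidef _ ih

theorem trace_siteList (l : List (Fin N)) (X : Op N d) :
    ((l.map P.siteChannel).prod X).trace = X.trace := by
  induction l with
  | nil => rfl
  | cons i l ih => rw [siteList_cons, trace_krausMap _ (P.sum_siteKraus i), ih]

/-- Once the channel of a site has acted, the operator stays supported on the image of the tensor at
that site. -/
theorem siteProj_mul_siteList (l : List (Fin N)) (X : Op N d) {j : Fin N} (hj : j ∈ l) :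
    siteOp j (P.siteProj j) * (l.map P.siteChannel).prod X = (l.map P.siteChannel).prod X ∧
      (l.map P.siteChannel).prod X * siteOp j (P.siteProj j) = (l.map P.siteChannel).prod X := by
  have hsa : (siteOp j (P.siteProj j) : Op N d)ᴴ = siteOp j (P.siteProj j) := by
    rw [siteOp_conjTranspose, siteProj_isHermitian]
  induction l with
  | nil => simp at hj
  | cons i l ih =>
    rw [siteList_cons, krausMap_apply, Finset.mul_sum, Finset.sum_mul]
    rcases eq_or_ne j i with rfl | hne
    · have h1 := P.siteProj_mul_siteKraus j
      have h2 : ∀ o, (P.siteKraus j o)ᴴ * siteOp j (P.siteProj j) = (P.siteKraus j o)ᴴ := by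
        intro o
        have := congrArg Matrix.conjTranspose (h1 o)
        rwa [Matrix.conjTranspose_mul, hsa] at this
      refine ⟨Finset.sum_congr rfl fun o _ => ?_, Finset.sum_congr rfl fun o _ => ?_⟩
      · rw [← mul_assoc, ← mul_assoc, h1]
      · rw [mul_assoc, h2]
    · have ih := ih ((List.mem_cons.1 hj).resolve_left hne)
      have hc : ∀ o, Commute (siteOp j (P.siteProj j)) (P.siteKraus i o) :=
        fun o => siteOp_commute hne _ _
      have hc' : ∀ o, Commute (siteOp j (P.siteProj j)) (P.siteKraus i o)ᴴ := fun o => by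
        rw [siteKraus, siteOp_conjTranspose]; exact siteOp_commute hne _ _
      refine ⟨Finset.sum_congr rfl fun o _ => ?_, Finset.sum_congr rfl fun o _ => ?_⟩
      · rw [← mul_assoc, ← mul_assoc, (hc o).eq, mul_assoc (P.siteKraus i o), ih.1]
      · rw [mul_assoc, ← (hc' o).eq, ← mul_assoc, mul_assoc (P.siteKraus i o), ih.2]

theorem siteProj_mul_globalIso (i : Fin N) :
    siteOp i (P.siteProj i) * P.globalIso = P.globalIso := by
  rw [siteOp_eq_site, globalIso, site_mul_tensorAll (Y := 1), map_one, Matrix.mul_one]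
  rw [← iso_mul_conjTranspose, Matrix.mul_assoc, iso_conjTranspose_mul_iso]

/-- The single-site channels leave operators in the image of `globalIso` unchanged. -/
theorem allSites_lift (σ : P.VOp) : P.allSites (P.lift σ) = P.lift σ := by
  have h : ∀ i, P.siteChannel i (P.lift σ) = P.lift σ := by
    intro i
    have h1 : siteOp i (P.siteProj i) * P.lift σ = P.lift σ := by
      rw [lift, ← Matrix.mul_assoc, ← Matrix.mul_assoc, siteProj_mul_globalIso]
    have h2 : P.lift σ * siteOp i (P.siteProj i) = P.lift σ := by
      have h3 := congrArg Matrix.conjTranspose (P.siteProj_mul_globalIso i)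
      rw [Matrix.conjTranspose_mul, siteOp_conjTranspose, siteProj_isHermitian] at h3
      rw [lift, Matrix.mul_assoc, h3]
    have h4 : (siteOp i (1 - P.siteProj i) : Op N d) * P.lift σ = 0 := by
      rw [siteOp_eq_site, map_sub, map_one, sub_mul, ← siteOp_eq_site, h1, one_mul, sub_self]
    rw [siteChannel, LinearMap.add_apply, LinearMap.comp_apply, LinearMap.mulLeft_apply, h4,
      map_zero, add_zero, LinearMap.mulLeftRight_apply, h1, h2]
  have h' : ∀ l : List (Fin N), (l.map P.siteChannel).prod (P.lift σ) = P.lift σ := by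
    intro l
    induction l with
    | nil => rfl
    | cons i l ih => rw [List.map_cons, List.prod_cons, Module.End.mul_apply, ih, h]
  exact h' _

/-- The operator on the virtual space that corresponds to `X` after the single-site channels have
been applied. -/
def initial (X : Op N d) : P.VOp := P.globalIsoᴴ * P.allSites X * P.globalIso

theorem globalIso_mul_conjTranspose_mul_allSites (X : Op N d) :
    P.globalIso * P.globalIsoᴴ * P.allSites X = P.allSites X ∧
      P.allSites X * (P.globalIso * P.globalIsoᴴ) = P.allSites X := by
  -- The projector `W W†` is the product of the projectors of all sites.
  have hW : P.globalIso * P.globalIsoᴴ = tensorAll P.siteProj := by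
    rw [globalIso, tensorAll_conjTranspose, tensorAll_mul]
    simp only [iso_mul_conjTranspose]
  have key : ∀ Y : Op N d, (∀ j, siteOp j (P.siteProj j) * Y = Y) →
      P.globalIso * P.globalIsoᴴ * Y = Y := by
    intro Y hY
    rw [hW]
    ext x y
    refine congrFun (tensorAll_mulVec_of_site_mulVec (M := P.siteProj) (w := fun x => Y x y)
      fun i => ?_) x
    funext z
    have := congrFun (congrFun (hY i) z) y
    rw [siteOp_eq_site] at this
    exact this
  have hl := fun j => P.siteProj_mul_siteList (j := j) (List.finRange N) X
  refine ⟨key _ fun j => (hl j (List.mem_finRange j)).1, ?_⟩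
  have h2 := key (P.allSites X)ᴴ fun j => by
    have := congrArg Matrix.conjTranspose (hl j (List.mem_finRange j)).2
    rwa [Matrix.conjTranspose_mul, siteOp_conjTranspose, siteProj_isHermitian] at this
  have h3 := congrArg Matrix.conjTranspose h2
  rwa [Matrix.conjTranspose_mul, Matrix.conjTranspose_mul, Matrix.conjTranspose_conjTranspose,
    Matrix.conjTranspose_conjTranspose] at h3

/-- The single-site channels map into the image of `globalIso`. -/
theorem allSites_eq_lift (X : Op N d) : P.allSites X = P.lift (P.initial X) := by
  obtain ⟨h1, h2⟩ := P.globalIso_mul_conjTranspose_mul_allSites X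
  rw [lift, initial]
  calc P.allSites X = P.globalIso * P.globalIsoᴴ * P.allSites X * (P.globalIso * P.globalIsoᴴ) := by
        rw [h1, h2]
    _ = _ := by simp only [Matrix.mul_assoc]

theorem trace_initial (X : Op N d) : (P.initial X).trace = X.trace := by
  rw [initial, Matrix.trace_mul_comm, ← Matrix.mul_assoc,
    (P.globalIso_mul_conjTranspose_mul_allSites X).1]
  exact P.trace_siteList _ X

theorem initial_posSemidef {X : Op N d} (hX : X.PosSemidef) : (P.initial X).PosSemidef :=
  (P.siteList_posSemidef _ hX).conjTranspose_mul_mul_same _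

/-- After the first application of the single-site channels, the dynamics takes place on the
virtual space. -/
theorem channel_pow_succ {Γ : ℝ} (h : ∀ e, (1 - Γ • P.pairRate e).PosSemidef) {k : ℕ}
    (c : EdgePartition G k) (T : ℕ) (X : Op N d) :
    (P.channel Γ c ^ (T + 1)) X = P.lift ((P.vChannel Γ c ^ (T + 1)) (P.initial X)) := by
  have h1 : ∀ X, P.channel Γ c X = P.lift (P.vChannel Γ c (P.initial X)) := by
    intro X
    rw [channel, Module.End.mul_apply]
    change ((k : ℂ)⁻¹ • ∑ q, P.classChannel Γ c q) (P.allSites X) = _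
    rw [allSites_eq_lift, P.average_lift h]
  have h2 : ∀ σ, P.channel Γ c (P.lift σ) = P.lift (P.vChannel Γ c σ) := by
    intro σ
    rw [channel, Module.End.mul_apply]
    change ((k : ℂ)⁻¹ • ∑ q, P.classChannel Γ c q) (P.allSites _) = _
    rw [allSites_lift, P.average_lift h]
  induction T with
  | zero => simpa using h1 X
  | succ T ih => rw [pow_succ', Module.End.mul_apply, ih, h2, pow_succ' _ (T + 1)]; rfl

end InjectivePEPS

/-! ### The trace norm -/

section TraceNorm

variable {n : Type*} [Fintype n] [DecidableEq n]

/-- The Moore–Penrose pseudo-inverse of a Hermitian matrix. The convention `0⁻¹ = 0` in the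
functional calculus is what is needed. -/
theorem exists_pseudoInverse {S : Matrix n n ℂ} (hS : S.IsHermitian) :
    ∃ G : Matrix n n ℂ, Gᴴ = G ∧ G * S = S * G ∧ S * G * S = S ∧ G * S * G = G := by
  have hS' : IsSelfAdjoint S := hS
  have hc : ∀ f : ℝ → ℝ, ContinuousOn f (spectrum ℝ S) := fun f =>
    (Matrix.finite_real_spectrum).continuousOn f
  have hid : cfc (fun x : ℝ => x) S = S := cfc_id' ℝ S
  have hm : ∀ f g : ℝ → ℝ, cfc f S * cfc g S = cfc (fun x => f x * g x) S := fun f g =>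
    (cfc_mul f g S (hc f) (hc g)).symm
  have h1 := hm (fun x => x⁻¹) fun x => x
  have h2 := hm (fun x => x) fun x => x⁻¹
  have h3 := hm (fun x => x * x⁻¹) fun x => x
  have h4 := hm (fun x => x⁻¹ * x) fun x => x⁻¹
  rw [hid] at h1 h2 h3
  refine ⟨cfc (fun x : ℝ => x⁻¹) S, (cfc_predicate _ S : IsSelfAdjoint _), ?_, ?_, ?_⟩
  · rw [h1, h2]
    simp only [mul_comm]
  · rw [h2, h3]
    simp only [mul_inv_mul_cancel]
    exact hid
  · rw [h1, h4]
    simp only [fun x : ℝ => (by simpa using mul_inv_mul_cancel x⁻¹ : x⁻¹ * x * x⁻¹ = x⁻¹)]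

/-- Polar decomposition with a partial isometry. -/
theorem exists_polar (X : Matrix n n ℂ) :
    ∃ U : Matrix n n ℂ, Uᴴ * U ≤ 1 ∧ U * Uᴴ ≤ 1 ∧ X = U * CFC.sqrt (Xᴴ * X) ∧
      CFC.sqrt (Xᴴ * X) = Uᴴ * X := by
  set S := CFC.sqrt (Xᴴ * X) with hS
  have hSS : S * S = Xᴴ * X := CFC.sqrt_mul_sqrt_self _
    (Matrix.nonneg_iff_posSemidef.2 (Matrix.posSemidef_conjTranspose_mul_self X))
  have hSp : S.PosSemidef := Matrix.nonneg_iff_posSemidef.1 (CFC.sqrt_nonneg _)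
  obtain ⟨G, hG, hc, h1, h2⟩ := exists_pseudoInverse hSp.isHermitian
  have hU : (X * G)ᴴ = G * Xᴴ := by rw [Matrix.conjTranspose_mul, hG]
  have hle : ∀ e : Matrix n n ℂ, eᴴ = e → e * e = e → e ≤ 1 := by
    intro e he he2
    have h : (1 - e)ᴴ * (1 - e) = 1 - e := by
      rw [Matrix.conjTranspose_sub, Matrix.conjTranspose_one, he, mul_sub, sub_mul, sub_mul, he2]
      simp
    rw [← sub_nonneg, ← h]
    exact Matrix.nonneg_iff_posSemidef.2 (Matrix.posSemidef_conjTranspose_mul_self _)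
  have hUU : (X * G)ᴴ * (X * G) = G * S := by
    rw [hU]
    calc G * Xᴴ * (X * G) = G * (Xᴴ * X) * G := by noncomm_ring
      _ = (G * S) * (S * G) := by rw [← hSS]; noncomm_ring
      _ = (G * S) * (G * S) := by rw [hc]
      _ = G * (S * G * S) := by noncomm_ring
      _ = _ := by rw [h1]
  have hXG : X * G * S = X := by
    have h : (X - X * G * S)ᴴ * (X - X * G * S) = 0 := by
      have h3 : (X * G * S)ᴴ = S * G * Xᴴ := by
        rw [Matrix.conjTranspose_mul, hU, hSp.isHermitian.eq, mul_assoc]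
      rw [Matrix.conjTranspose_sub, h3]
      calc (Xᴴ - S * G * Xᴴ) * (X - X * G * S)
          = Xᴴ * X - Xᴴ * X * G * S - S * G * (Xᴴ * X) + S * G * (Xᴴ * X) * G * S := by noncomm_ring
        _ = S * S - S * (S * G * S) - (S * G * S) * S + (S * G * S) * (S * G * S) := by
          rw [← hSS]; noncomm_ring
        _ = 0 := by rw [h1]; noncomm_ring
    exact (sub_eq_zero.1 (Matrix.conjTranspose_mul_self_eq_zero.1 h)).symm
  refine ⟨X * G, ?_, ?_, hXG.symm, ?_⟩
  · refine hle _ (by rw [Matrix.conjTranspose_mul, Matrix.conjTranspose_conjTranspose]) ?_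
    rw [hUU, ← mul_assoc, h2]
  · refine hle _ (by rw [Matrix.conjTranspose_mul, Matrix.conjTranspose_conjTranspose]) ?_
    calc X * G * (X * G)ᴴ * (X * G * (X * G)ᴴ) = X * G * ((X * G)ᴴ * (X * G)) * (X * G)ᴴ := by
          noncomm_ring
      _ = X * (G * (G * S)) * (X * G)ᴴ := by rw [hUU]; noncomm_ring
      _ = X * (G * S * G) * (X * G)ᴴ := by rw [mul_assoc G S G, ← hc]
      _ = _ := by rw [h2]
  · rw [hU, mul_assoc, ← hSS, ← mul_assoc, hc, h1]

theorem re_trace_self_mul_conjTranspose_nonneg (A : Matrix n n ℂ) : 0 ≤ (A * Aᴴ).trace.re :=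
  (Complex.le_def.1 (Matrix.posSemidef_self_mul_conjTranspose A).trace_nonneg).1

/-- Left multiplication with a contraction does not increase the Hilbert–Schmidt norm. -/
theorem re_trace_conj_le {W : Matrix n n ℂ} (hW : Wᴴ * W ≤ 1) (A : Matrix n n ℂ) :
    (W * A * (W * A)ᴴ).trace.re ≤ (A * Aᴴ).trace.re := by
  have h := re_trace_mul_mono hW (Matrix.posSemidef_self_mul_conjTranspose A)
  rw [Matrix.one_mul] at h
  refine le_trans (le_of_eq ?_) h
  rw [Matrix.conjTranspose_mul, ← Matrix.mul_assoc, Matrix.trace_mul_comm, ← Matrix.mul_assoc,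
    ← Matrix.mul_assoc, Matrix.mul_assoc (Wᴴ * W)]

/-- Cauchy–Schwarz inequality for the trace, with a weight `r`. -/
theorem two_mul_re_trace_le {W : Matrix n n ℂ} (hW : Wᴴ * W ≤ 1) (A B : Matrix n n ℂ) {r : ℝ}
    (hr : 0 < r) :
    2 * (W * A * Bᴴ).trace.re ≤ r * (A * Aᴴ).trace.re + r⁻¹ * (B * Bᴴ).trace.re := by
  have h1 := re_trace_self_mul_conjTranspose_nonneg ((r : ℂ) • (W * A) - B)
  have h2 : (B * (W * A)ᴴ).trace.re = (W * A * Bᴴ).trace.re := by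
    have : B * (W * A)ᴴ = (W * A * Bᴴ)ᴴ := by
      simp only [Matrix.conjTranspose_mul, Matrix.conjTranspose_conjTranspose, Matrix.mul_assoc]
    rw [this, Matrix.trace_conjTranspose]; simp
  have h3 : (((r : ℂ) • (W * A) - B) * ((r : ℂ) • (W * A) - B)ᴴ).trace.re =
      r ^ 2 * (W * A * (W * A)ᴴ).trace.re - 2 * r * (W * A * Bᴴ).trace.re +
        (B * Bᴴ).trace.re := by
    rw [Matrix.conjTranspose_sub, Matrix.conjTranspose_smul, RCLike.star_def, Complex.conj_ofReal,
      Matrix.mul_sub, Matrix.sub_mul, Matrix.sub_mul]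
    simp only [Matrix.smul_mul, Matrix.mul_smul, Matrix.trace_sub, Matrix.trace_smul, smul_eq_mul,
      Complex.sub_re, Complex.re_ofReal_mul, h2]
    ring
  rw [h3] at h1
  have h4 := mul_le_mul_of_nonneg_left (re_trace_conj_le hW A) (sq_nonneg r)
  have h5 : 0 ≤ r⁻¹ * (r ^ 2 * (A * Aᴴ).trace.re - 2 * r * (W * A * Bᴴ).trace.re +
      (B * Bᴴ).trace.re) := mul_nonneg (inv_nonneg.2 hr.le) (by linarith)
  have h6 : r⁻¹ * (r ^ 2 * (A * Aᴴ).trace.re - 2 * r * (W * A * Bᴴ).trace.re +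
      (B * Bᴴ).trace.re) = r * (A * Aᴴ).trace.re - 2 * (W * A * Bᴴ).trace.re +
      r⁻¹ * (B * Bᴴ).trace.re := by
    field_simp
  linarith

theorem two_mul_norm_trace_le {W : Matrix n n ℂ} (hW : Wᴴ * W ≤ 1) (A B : Matrix n n ℂ) {r : ℝ}
    (hr : 0 < r) :
    2 * ‖(W * A * Bᴴ).trace‖ ≤ r * (A * Aᴴ).trace.re + r⁻¹ * (B * Bᴴ).trace.re := by
  -- A phase can be absorbed into `W`.
  obtain ⟨z, hz, hzc⟩ : ∃ z : ℂ, ‖z‖ = 1 ∧ z * (W * A * Bᴴ).trace = ‖(W * A * Bᴴ).trace‖ := by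
    rcases eq_or_ne (W * A * Bᴴ).trace 0 with h0 | h0
    · exact ⟨1, by simp, by simp [h0]⟩
    · have hn : ‖(W * A * Bᴴ).trace‖ ≠ 0 := norm_ne_zero_iff.2 h0
      refine ⟨star (W * A * Bᴴ).trace / ‖(W * A * Bᴴ).trace‖, ?_, ?_⟩
      · rw [norm_div, norm_star, Complex.norm_real, norm_norm, div_self hn]
      · rw [div_mul_eq_mul_div, RCLike.star_def, mul_comm, Complex.mul_conj,
          Complex.normSq_eq_norm_sq]
        push_cast
        rw [sq, mul_div_assoc, div_self (by exact_mod_cast hn), mul_one]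
  have hzW : (z • W)ᴴ * (z • W) ≤ 1 := by
    rw [Matrix.conjTranspose_smul, Matrix.smul_mul, Matrix.mul_smul, smul_smul, RCLike.star_def,
      Complex.conj_mul', hz]
    simpa using hW
  have h := two_mul_re_trace_le hzW A B hr
  rwa [Matrix.smul_mul, Matrix.smul_mul, Matrix.trace_smul, smul_eq_mul, hzc,
    Complex.ofReal_re] at h

theorem exists_eq_mul_conjTranspose {ρ : Matrix n n ℂ} (hρ : ρ.PosSemidef) :
    ∃ B : Matrix n n ℂ, ρ = B * Bᴴ := by
  refine ⟨CFC.sqrt ρ, ?_⟩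
  have h : (CFC.sqrt ρ)ᴴ = CFC.sqrt ρ :=
    (Matrix.nonneg_iff_posSemidef.1 (CFC.sqrt_nonneg ρ)).isHermitian
  rw [h, CFC.sqrt_mul_sqrt_self _ (Matrix.nonneg_iff_posSemidef.2 hρ)]

theorem norm_trace_mul_le {W ρ : Matrix n n ℂ} (hW : Wᴴ * W ≤ 1) (hρ : ρ.PosSemidef) :
    ‖(W * ρ).trace‖ ≤ ρ.trace.re := by
  obtain ⟨B, rfl⟩ := exists_eq_mul_conjTranspose hρ
  have := two_mul_norm_trace_le hW B B one_pos
  rw [Matrix.mul_assoc] at this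
  linarith

/-- A superoperator that is small on positive semidefinite matrices, tested against contractions,
is small in the induced trace norm. -/
theorem norm11_le_of_posSemidef (F : Matrix n n ℂ →ₗ[ℂ] Matrix n n ℂ) {g : ℝ} (hg : 0 ≤ g)
    (h : ∀ W ρ : Matrix n n ℂ, Wᴴ * W ≤ 1 → ρ.PosSemidef →
      ‖(W * F ρ).trace‖ ≤ g * ρ.trace.re) : norm11 F ≤ ENNReal.ofReal (2 * g) := by
  refine iSup_le fun X => ENNReal.ofReal_le_ofReal ?_
  obtain ⟨X, hX⟩ := X
  obtain ⟨U, hU, -, hXU, -⟩ := exists_polar X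
  -- The trace norm of `F X` is attained at the contraction `V†`.
  obtain ⟨V, -, hV, -, hYV⟩ := exists_polar (F X)
  have hY : traceNorm (F X) = (Vᴴ * F X).trace.re := by rw [traceNorm, hYV]
  have hVc : (Vᴴ)ᴴ * Vᴴ ≤ 1 := by rwa [Matrix.conjTranspose_conjTranspose]
  set S := CFC.sqrt (Xᴴ * X) with hS
  have hSp : S.PosSemidef := Matrix.nonneg_iff_posSemidef.1 (CFC.sqrt_nonneg _)
  obtain ⟨B, hB⟩ := exists_eq_mul_conjTranspose hSp
  -- polarization of `X = (U B) B†`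
  let ρ : ℂ → Matrix n n ℂ := fun z => (U * B + z • B) * (U * B + z • B)ᴴ
  have hρ : ∀ z, (ρ z).PosSemidef := fun z => Matrix.posSemidef_self_mul_conjTranspose _
  have hρz : ∀ z, ρ z = U * B * (U * B)ᴴ + z • (B * (U * B)ᴴ) + star z • (U * B * Bᴴ) +
      (z * star z) • (B * Bᴴ) := by
    intro z
    simp only [ρ, Matrix.conjTranspose_add, Matrix.conjTranspose_smul, Matrix.mul_add,
      Matrix.add_mul, Matrix.smul_mul, Matrix.mul_smul]
    rw [smul_add, smul_smul, mul_comm (star z)]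
    abel
  have hX4 : (4 : ℂ) • X = ρ 1 + Complex.I • ρ Complex.I - ρ (-1) - Complex.I • ρ (-Complex.I) := by
    have hXB : X = U * B * Bᴴ := by rw [hXU, hB, Matrix.mul_assoc]
    rw [hρz, hρz, hρz, hρz, hXB]
    simp only [star_one, star_neg, RCLike.star_def, Complex.conj_I, smul_add, smul_smul, mul_neg,
      neg_mul, Complex.I_mul_I, neg_neg, mul_one, one_smul, neg_smul, smul_neg]
    module
  have htr : (ρ 1).trace.re + (ρ Complex.I).trace.re + (ρ (-1)).trace.re +
      (ρ (-Complex.I)).trace.re ≤ 8 * S.trace.re := by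
    have h1 : (ρ 1).trace.re + (ρ Complex.I).trace.re + (ρ (-1)).trace.re +
      (ρ (-Complex.I)).trace.re = 4 * (U * B * (U * B)ᴴ).trace.re + 4 * (B * Bᴴ).trace.re := by
      have : ρ 1 + ρ Complex.I + ρ (-1) + ρ (-Complex.I) =
          (4 : ℂ) • (U * B * (U * B)ᴴ) + (4 : ℂ) • (B * Bᴴ) := by
        rw [hρz, hρz, hρz, hρz]
        simp only [star_one, star_neg, RCLike.star_def, Complex.conj_I, mul_neg,
          neg_mul, Complex.I_mul_I, neg_neg, mul_one, one_smul, neg_smul]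
        module
      have := congrArg (fun M => M.trace.re) this
      simpa using this
    have h2 := re_trace_conj_le hU B
    rw [hB]; linarith
  have hS1 : S.trace.re = 1 := hX
  have hF : (4 : ℂ) * (Vᴴ * F X).trace = (Vᴴ * F (ρ 1)).trace +
      Complex.I * (Vᴴ * F (ρ Complex.I)).trace - (Vᴴ * F (ρ (-1))).trace -
      Complex.I * (Vᴴ * F (ρ (-Complex.I))).trace := by
    have := congrArg (fun M => (Vᴴ * F M).trace) hX4
    simpa only [map_smul, map_add, map_sub, Matrix.mul_smul, Matrix.mul_add, Matrix.mul_sub,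
      Matrix.trace_smul, Matrix.trace_add, Matrix.trace_sub, smul_eq_mul] using this
  have hn : 4 * ‖(Vᴴ * F X).trace‖ ≤ g * (8 * S.trace.re) := by
    have h4 : 4 * ‖(Vᴴ * F X).trace‖ = ‖(4 : ℂ) * (Vᴴ * F X).trace‖ := by simp
    rw [h4, hF]
    have hI : ∀ c : ℂ, ‖Complex.I * c‖ = ‖c‖ := by simp
    refine (norm_sub_le _ _).trans ?_
    have e1 := norm_sub_le ((Vᴴ * F (ρ 1)).trace + Complex.I * (Vᴴ * F (ρ Complex.I)).trace)
      (Vᴴ * F (ρ (-1))).trace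
    have e2 := norm_add_le (Vᴴ * F (ρ 1)).trace (Complex.I * (Vᴴ * F (ρ Complex.I)).trace)
    rw [hI] at e2 ⊢
    have := h _ _ hVc (hρ 1)
    have := h _ _ hVc (hρ Complex.I)
    have := h _ _ hVc (hρ (-1))
    have := h _ _ hVc (hρ (-Complex.I))
    have := mul_le_mul_of_nonneg_left htr hg
    linarith
  rw [hY]
  have := Complex.re_le_norm (Vᴴ * F X).trace
  rw [hS1] at hn
  linarith

theorem trace_lineProj_le (v : n → ℂ) : (lineProj v).trace.re ≤ 1 := by
  rw [lineProj, Matrix.trace_smul, Matrix.trace_vecMulVec, smul_eq_mul,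
    dotProduct_comm v (star v)]
  by_cases h : star v ⬝ᵥ v = 0
  · rw [h]; simp
  · rw [inv_mul_cancel₀ h]; simp

theorem lineProj_mul_mul (v : n → ℂ) (σ : Matrix n n ℂ) :
    lineProj v * σ * lineProj v = (lineProj v * σ).trace • lineProj v := by
  have h : lineProj v * σ = (star v ⬝ᵥ v)⁻¹ • Matrix.vecMulVec v (star v ᵥ* σ) := by
    rw [lineProj, Matrix.smul_mul, Matrix.vecMulVec_mul]
  rw [h]
  conv_lhs => rw [lineProj]
  rw [Matrix.smul_mul, Matrix.mul_smul, Matrix.vecMulVec_mul_vecMulVec, Matrix.trace_smul,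
    Matrix.trace_vecMulVec, Matrix.vecMulVec_smul, lineProj, dotProduct_comm v (star v ᵥ* σ),
    smul_eq_mul]
  module

/-- A state with a small component orthogonal to `v` is close to the projection onto `v`. -/
theorem norm_trace_mul_sub_lineProj_le {W σ : Matrix n n ℂ} (hW : Wᴴ * W ≤ 1)
    (hσ : σ.PosSemidef) (v : n → ℂ) {s : ℝ} (hs : 0 < s)
    (h : ((1 - lineProj v) * σ).trace.re ≤ s ^ 2 * σ.trace.re) :
    ‖(W * (σ - σ.trace • lineProj v)).trace‖ ≤ (2 * s ^ 2 + 2 * s) * σ.trace.re := by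
  have hp := lineProj_posSemidef v
  have hpp := lineProj_mul_self v
  have hph : (lineProj v)ᴴ = lineProj v := hp.isHermitian
  have hpσ := lineProj_mul_mul v σ
  have hpt := trace_lineProj_le v
  set p := lineProj v with hpdef
  set q := 1 - p with hq
  have hqh : qᴴ = q := by rw [hq, Matrix.conjTranspose_sub, hph, Matrix.conjTranspose_one]
  have hqq : q * q = q := by
    rw [hq, mul_sub, sub_mul, sub_mul, hpp]; simp
  obtain ⟨B, rfl⟩ := exists_eq_mul_conjTranspose hσ
  set σ := B * Bᴴ with hσB
  have htq : (q * B * (q * B)ᴴ).trace = (q * σ).trace := by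
    rw [Matrix.conjTranspose_mul, hqh, ← Matrix.mul_assoc, Matrix.trace_mul_comm,
      ← Matrix.mul_assoc, ← Matrix.mul_assoc, hqq, Matrix.mul_assoc]
  have htp : (p * B * (p * B)ᴴ).trace = (p * σ).trace := by
    rw [Matrix.conjTranspose_mul, hph, ← Matrix.mul_assoc, Matrix.trace_mul_comm,
      ← Matrix.mul_assoc, ← Matrix.mul_assoc, hpp, Matrix.mul_assoc]
  have hsum : (p * σ).trace + (q * σ).trace = σ.trace := by
    rw [← Matrix.trace_add, ← Matrix.add_mul, hq, add_sub_cancel, Matrix.one_mul]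
  have hdec : σ - σ.trace • p = p * B * (q * B)ᴴ + q * B * (p * B)ᴴ + q * B * (q * B)ᴴ -
      (q * σ).trace • p := by
    have h1 : σ = p * σ * p + p * B * (q * B)ᴴ + q * B * (p * B)ᴴ + q * B * (q * B)ᴴ := by
      rw [Matrix.conjTranspose_mul, Matrix.conjTranspose_mul, hqh, hph, hσB, hq]
      noncomm_ring
    conv_lhs => rw [← hsum]; lhs; rw [h1]
    rw [hpσ]
    module
  have hq0 : 0 ≤ (q * σ).trace.re := by rw [← htq]; exact re_trace_self_mul_conjTranspose_nonneg _
  have hq0' : (q * σ).trace = ((q * σ).trace.re : ℂ) := by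
    have h1 := (Matrix.posSemidef_self_mul_conjTranspose (q * B)).trace_nonneg
    rw [htq] at h1
    exact (Complex.eq_re_of_ofReal_le h1)
  have hp0 : 0 ≤ (p * σ).trace.re := by rw [← htp]; exact re_trace_self_mul_conjTranspose_nonneg _
  have hre : (p * σ).trace.re + (q * σ).trace.re = σ.trace.re := by
    rw [← Complex.add_re, hsum]
  have c1 := two_mul_norm_trace_le hW (p * B) (q * B) hs
  have c2 := two_mul_norm_trace_le hW (q * B) (p * B) (inv_pos.2 hs)
  rw [inv_inv, htp, htq] at c2
  rw [htp, htq] at c1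
  have c3 := norm_trace_mul_le hW (Matrix.posSemidef_self_mul_conjTranspose (q * B))
  rw [htq] at c3
  have c4 : ‖(W * ((q * σ).trace • p)).trace‖ ≤ (q * σ).trace.re := by
    rw [Matrix.mul_smul, Matrix.trace_smul, smul_eq_mul, norm_mul, hq0', Complex.norm_real,
      Real.norm_of_nonneg hq0]
    exact mul_le_of_le_one_right hq0 ((norm_trace_mul_le hW hp).trans hpt)
  have hsq : s⁻¹ * (q * σ).trace.re ≤ s * σ.trace.re := by
    refine (mul_le_mul_of_nonneg_left h (inv_nonneg.2 hs.le)).trans_eq ?_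
    field_simp
  have hsp : s * (p * σ).trace.re ≤ s * σ.trace.re :=
    mul_le_mul_of_nonneg_left (by linarith) hs.le
  rw [hdec, Matrix.mul_sub, Matrix.mul_add, Matrix.mul_add, Matrix.trace_sub, Matrix.trace_add,
    Matrix.trace_add]
  have t1 := norm_sub_le ((W * (p * B * (q * B)ᴴ)).trace + (W * (q * B * (p * B)ᴴ)).trace +
    (W * (q * B * (q * B)ᴴ)).trace) (W * ((q * σ).trace • p)).trace
  have t2 := norm_add_le ((W * (p * B * (q * B)ᴴ)).trace + (W * (q * B * (p * B)ᴴ)).trace)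
    (W * (q * B * (q * B)ᴴ)).trace
  have t3 := norm_add_le (W * (p * B * (q * B)ᴴ)).trace (W * (q * B * (p * B)ᴴ)).trace
  rw [Matrix.mul_assoc] at c1 c2
  linarith

end TraceNorm

/-! ### Mixing -/

namespace InjectivePEPS

variable {N : ℕ} {G : SimpleGraph (Fin N)} [DecidableRel G.Adj] {d D : ℕ}
  {P : InjectivePEPS G d D} {δ Γ : ℝ}

theorem trace_lift_mul_lift (σ τ : P.VOp) : (P.lift σ * P.lift τ).trace = (σ * τ).trace := by
  have h := P.globalIso_conjTranspose_mul
  have h1 : P.lift σ * P.lift τ = P.globalIso * (σ * τ) * P.globalIsoᴴ := by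
    calc P.lift σ * P.lift τ =
          P.globalIso * σ * (P.globalIsoᴴ * P.globalIso) * τ * P.globalIsoᴴ := by
          simp only [lift, Matrix.mul_assoc]
      _ = _ := by rw [h, Matrix.mul_one]; simp only [Matrix.mul_assoc]
  rw [h1, Matrix.trace_mul_comm, ← Matrix.mul_assoc, h, Matrix.one_mul]

theorem trace_lift (σ : P.VOp) : (P.lift σ).trace = σ.trace := by
  rw [lift, Matrix.trace_mul_comm, ← Matrix.mul_assoc, globalIso_conjTranspose_mul, Matrix.one_mul]

theorem lift_posSemidef {σ : P.VOp} (hσ : σ.PosSemidef) : (P.lift σ).PosSemidef :=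
  hσ.mul_mul_conjTranspose_same _

/-- The infidelity with the PEPS can be computed on the virtual space. -/
theorem trace_one_sub_lineProj_mul_lift (σ : P.VOp) :
    ((1 - lineProj P.vec) * P.lift σ).trace = ((1 - lineProj P.vVec) * σ).trace := by
  have h : lineProj P.vec = P.lift (lineProj P.vVec) := P.lift_lineProj_vVec.symm
  rw [Matrix.sub_mul, Matrix.sub_mul, Matrix.trace_sub, Matrix.trace_sub, h, trace_lift_mul_lift,
    Matrix.one_mul, Matrix.one_mul, trace_lift]

theorem sub_target_apply (F : SuperOp N d) (X : Op N d) :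
    (F - P.target) X = F X - X.trace • lineProj P.vec := rfl

namespace Admissible

theorem channel_pow_posSemidef (h : P.Admissible δ Γ) {k : ℕ} (c : EdgePartition G k)
    {ρ : Op N d} (hρ : ρ.PosSemidef) (T : ℕ) : ((P.channel Γ c ^ T) ρ).PosSemidef := by
  cases T with
  | zero => simpa using hρ
  | succ T =>
    rw [P.channel_pow_succ h.one_sub_pairRate]
    exact lift_posSemidef (vChannel_pow_posSemidef c (P.initial_posSemidef hρ) _)

theorem trace_channel_pow (h : P.Admissible δ Γ) {k : ℕ} (hk : 1 ≤ k) (c : EdgePartition G k)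
    (X : Op N d) (T : ℕ) : ((P.channel Γ c ^ T) X).trace = X.trace := by
  cases T with
  | zero => simp
  | succ T =>
    rw [P.channel_pow_succ h.one_sub_pairRate, trace_lift, h.trace_vChannel_pow hk, trace_initial]

/-- The trivial bound, from positivity and trace preservation. -/
theorem norm_trace_sub_target_le_two (h : P.Admissible δ Γ) {k : ℕ} (hk : 1 ≤ k)
    (c : EdgePartition G k) {W ρ : Op N d} (hW : Wᴴ * W ≤ 1) (hρ : ρ.PosSemidef) (T : ℕ) :
    ‖(W * (P.channel Γ c ^ T - P.target) ρ).trace‖ ≤ 2 * ρ.trace.re := by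
  have h1 := norm_trace_mul_le hW (h.channel_pow_posSemidef c hρ T)
  rw [h.trace_channel_pow hk] at h1
  have h2 := (norm_trace_mul_le hW (lineProj_posSemidef P.vec)).trans (trace_lineProj_le P.vec)
  have h3 : ‖ρ.trace‖ = ρ.trace.re := by
    have h4 := hρ.trace_nonneg
    have h5 : ρ.trace = (ρ.trace.re : ℂ) := Complex.eq_re_of_ofReal_le h4
    rw [h5, Complex.norm_real, Complex.ofReal_re, Real.norm_of_nonneg (Complex.le_def.1 h4).1]
  rw [sub_target_apply, Matrix.mul_sub, Matrix.trace_sub, Matrix.mul_smul, Matrix.trace_smul,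
    smul_eq_mul]
  refine (norm_sub_le _ _).trans ?_
  rw [norm_mul, h3]
  have h6 : 0 ≤ ρ.trace.re := (Complex.le_def.1 hρ.trace_nonneg).1
  have := mul_le_mul_of_nonneg_left h2 h6
  linarith

theorem norm_trace_sub_target_le (h : P.Admissible δ Γ) {k : ℕ} (hk : 1 ≤ k)
    (c : EdgePartition G k) {d₀ : ℕ} (hd : 1 ≤ d₀) (hG : ∀ i, G.degree i ≤ d₀) (hN : 1 ≤ N)
    (hδd : δ * d₀ ≤ 1 / 1000) (hΓ1 : δ / 2 ≤ Γ) (hΓ2 : Γ ≤ 2 * δ) {W ρ : Op N d}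
    (hW : Wᴴ * W ≤ 1) (hρ : ρ.PosSemidef) (T : ℕ) :
    ‖(W * (P.channel Γ c ^ T - P.target) ρ).trace‖ ≤
      8 * (N * d₀ * Real.exp (-(1 / 16 * (δ / k) * T))) * ρ.trace.re := by
  have hρ0 : 0 ≤ ρ.trace.re := (Complex.le_def.1 hρ.trace_nonneg).1
  have hNd : (1 : ℝ) ≤ N * d₀ := by exact_mod_cast Nat.mul_pos hN hd
  set s := 2 * (N * d₀ * Real.exp (-(1 / 16 * (δ / k) * T))) with hs
  have hs0 : 0 < s := by positivity
  have htriv := h.norm_trace_sub_target_le_two hk c hW hρ T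
  suffices hmain : ‖(W * (P.channel Γ c ^ T - P.target) ρ).trace‖ ≤ 4 * s * ρ.trace.re by
    refine hmain.trans_eq ?_
    rw [hs]; ring
  -- For `s ≥ 1` the trivial bound suffices, which covers `T = 0`, where the single-site channels
  -- have not acted. For `s < 1` the infidelity is at most `s²`.
  by_cases hs1 : 1 ≤ s
  · nlinarith
  · cases T with
    | zero =>
      refine absurd ?_ hs1
      rw [hs]; simp only [Nat.cast_zero, mul_zero, neg_zero, Real.exp_zero]
      linarith
    | succ T =>
      have hσ := P.initial_posSemidef hρ
      have hinf := h.infidelity_le hk c hσ hd hG hδd hΓ1 hΓ2 (T + 1)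
      rw [trace_initial, ← trace_one_sub_lineProj_mul_lift,
        ← P.channel_pow_succ h.one_sub_pairRate] at hinf
      have hss : 4 * (N * d₀ * Real.exp (-(1 / 8 * (δ / k) * (T + 1 : ℕ)))) ≤ s ^ 2 := by
        have e1 : Real.exp (-(1 / 8 * (δ / k) * (T + 1 : ℕ))) =
            Real.exp (-(1 / 16 * (δ / k) * (T + 1 : ℕ))) ^ 2 := by
          rw [← Real.exp_nat_mul]; congr 1; push_cast; ring
        rw [e1, hs]
        have := mul_le_mul_of_nonneg_right hNd
          (by positivity : 0 ≤ 4 * (N * d₀ * Real.exp (-(1 / 16 * (δ / k) * (T + 1 : ℕ))) ^ 2))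
        nlinarith
      have hps := h.channel_pow_posSemidef c hρ (T + 1)
      have htr := h.trace_channel_pow hk c ρ (T + 1)
      have hfin := norm_trace_mul_sub_lineProj_le hW hps P.vec hs0 (by
        rw [htr]; exact hinf.trans (mul_le_mul_of_nonneg_right hss hρ0))
      rw [htr] at hfin
      rw [sub_target_apply]
      refine hfin.trans (mul_le_mul_of_nonneg_right ?_ hρ0)
      nlinarith

end Admissible

/-- Without vertices all operators are scalars, and the channel is the identity. -/
theorem channel_pow_eq_target {G : SimpleGraph (Fin 0)} [DecidableRel G.Adj]
    (P : InjectivePEPS G d D) {k : ℕ} (hk : 1 ≤ k) (c : EdgePartition G k) (T : ℕ) :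
    P.channel Γ c ^ T = P.target := by
  have hk0 : (k : ℂ) ≠ 0 := by exact_mod_cast (by omega : k ≠ 0)
  have hE : IsEmpty G.edgeSet := ⟨fun e => (P.src e).elim0⟩
  have h1 : P.channel Γ c = 1 := by
    have hq : ∀ q, P.classChannel Γ c q = 1 := fun q => by
      rw [classChannel, Finset.eq_empty_of_isEmpty (Finset.filter _ _)]; simp
    rw [channel]
    simp only [hq, Finset.sum_const, Finset.card_univ, Fintype.card_fin, List.finRange_zero,
      List.map_nil, List.prod_nil, mul_one]
    rw [← Nat.cast_smul_eq_nsmul ℂ, smul_smul, inv_mul_cancel₀ hk0, one_smul]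
  have hvec : P.vec = 1 := by
    funext x
    simp [vec]
  rw [h1, one_pow]
  refine LinearMap.ext fun X => ?_
  change X = X.trace • P.state
  ext x y
  rw [state, hvec, Subsingleton.elim x default, Subsingleton.elim y default]
  simp [Matrix.trace, dotProduct]

/-- Exponential convergence with explicit constants. -/
theorem mixingError_le (hP : P.NearIsometric δ) (hδ0 : 0 < δ) {d₀ k : ℕ} (hd : 1 ≤ d₀)
    (hk : 1 ≤ k) (hG : ∀ i, G.degree i ≤ d₀) (hδd : δ * d₀ ≤ 1 / 1000) (hΓ1 : δ / 2 ≤ Γ)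
    (hΓ2 : Γ ≤ 2 * δ) (c : EdgePartition G k) (T : ℕ) :
    P.mixingError Γ c T ≤
      ENNReal.ofReal (16 * (N * d₀ * Real.exp (-(1 / 16 * (δ / k) * T)))) := by
  have hd' : (1 : ℝ) ≤ d₀ := by exact_mod_cast hd
  have hδ : δ ≤ 1 / 1000 := by nlinarith
  have h : P.Admissible δ Γ := ⟨hP, hδ0, by linarith, by linarith, by linarith⟩
  rcases Nat.eq_zero_or_pos N with rfl | hN
  · have h0 : P.channel Γ c ^ T - P.target = 0 := by
      rw [P.channel_pow_eq_target hk c T, sub_self]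
    rw [mixingError, h0]
    refine (norm11_le_of_posSemidef 0 le_rfl fun W ρ _ _ => ?_).trans ?_
    · simp
    · simp
  · refine (norm11_le_of_posSemidef _ (by positivity) fun W ρ hW hρ =>
      h.norm_trace_sub_target_le hk c hd hG hN hδd hΓ1 hΓ2 hW hρ T).trans_eq ?_
    congr 1
    ring

end InjectivePEPS

/-- The exponential bound is below `ε` after logarithmically many steps. -/
theorem exp_bound_le {M ε r T : ℝ} (hM : 1 ≤ M) (hε : 0 < ε) (hε2 : ε ≤ 1 / 2) (hr : 0 < r)
    (hT : 80 * r⁻¹ * Real.log (M / ε) ≤ T) :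
    16 * (M * Real.exp (-(1 / 16 * r * T))) ≤ ε := by
  have hx : 2 ≤ M / ε := by rw [le_div_iff₀ hε]; linarith
  have hx0 : 0 < M / ε := by linarith
  -- For `x = M / ε ≥ 2` the exponential is at most `x⁻⁵`, and `16 M x⁻⁵ ≤ M x⁻¹ = ε`.
  have h1 : Real.log (M / ε) * 5 ≤ 1 / 16 * r * T := by
    have := mul_le_mul_of_nonneg_left hT (by positivity : 0 ≤ 1 / 16 * r)
    refine le_trans (le_of_eq ?_) this
    field_simp; ring
  have h2 : Real.exp (-(1 / 16 * r * T)) ≤ ((M / ε) ^ 5)⁻¹ := by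
    rw [Real.exp_neg]
    refine inv_anti₀ (by positivity) ?_
    calc (M / ε) ^ 5 = Real.exp (Real.log (M / ε) * 5) := by
          rw [← Real.exp_log hx0, ← Real.exp_nat_mul, Real.log_exp]; congr 1; push_cast; ring
      _ ≤ _ := Real.exp_le_exp.2 h1
  have h3 : (16 : ℝ) ≤ (M / ε) ^ 4 := by
    calc (16 : ℝ) = 2 ^ 4 := by norm_num
      _ ≤ _ := pow_le_pow_left₀ (by norm_num) hx 4
  calc 16 * (M * Real.exp (-(1 / 16 * r * T))) ≤ (M / ε) ^ 4 * (M * ((M / ε) ^ 5)⁻¹) := by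
        have hM0 : 0 ≤ M := by linarith
        gcongr
    _ = ε := by
      have hM0 : M ≠ 0 := by linarith
      field_simp

end Dissipative

end

theorem theorem5 :
    ∃ (δth : ℕ → ℝ) (a b C κ K : ℝ),
      0 < a ∧ a ≤ b ∧ 0 < C ∧ 0 < κ ∧ 0 < K ∧
      (∀ d₀ : ℕ, 1 ≤ d₀ → 0 < δth d₀) ∧
      (δth =Θ[atTop] fun d₀ : ℕ => 1 / (d₀ : ℝ)) ∧
      ∀ d₀ : ℕ, 1 ≤ d₀ →
      ∀ δ : ℝ, 0 < δ → δ ≤ δth d₀ →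
      ∀ Γ : ℝ, a * δ ≤ Γ → Γ ≤ b * δ →
      ∀ (N d D k : ℕ) (G : SimpleGraph (Fin N)) [DecidableRel G.Adj],
        (∀ i, G.degree i ≤ d₀) → 1 ≤ k →
      ∀ (P : Dissipative.InjectivePEPS G d D) (c : Dissipative.EdgePartition G k),
        P.NearIsometric δ →
        (∀ e, (1 - (2 * Γ : ℂ) • P.Heff e).PosSemidef) ∧
        (∀ T : ℕ, P.mixingError Γ c T ≤
          ENNReal.ofReal (C * (N * d₀ * Real.exp (-(κ * (δ / k) * T))))) ∧
        (∀ ε : ℝ, 0 < ε → ε ≤ 1 / 2 → ∀ T : ℕ,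
          K * (k / δ) * Real.log (N * d₀ / ε) ≤ T →
          P.mixingError Γ c T ≤ ENNReal.ofReal ε) := by
  -- The threshold `1 / (1000 d₀)` makes the heating rate `8 η d₀`, where `η ≤ 28 δ Γ` for
  -- `Γ ≤ 2 δ`, smaller than half the cooling rate `Γ / 2`. The decay rate `1 / 16` is half of the
  -- rate `1 / 8` of the energy, as the trace distance is bounded by the square root of the
  -- infidelity, and `80 = 5 * 16` yields the fifth power in `exp_bound_le`.
  refine ⟨fun d₀ => 1 / 1000 * (1 / (d₀ : ℝ)), 1 / 2, 2, 16, 1 / 16, 80, by norm_num, by norm_num,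
    by norm_num, by norm_num, by norm_num, fun d₀ hd => ?_, ?_, ?_⟩
  · have : (0 : ℝ) < d₀ := by exact_mod_cast hd
    positivity
  · exact (isTheta_refl (fun d₀ : ℕ => 1 / (d₀ : ℝ)) atTop).const_mul_left (by norm_num)
  · intro d₀ hd δ hδ0 hδth Γ hΓ1 hΓ2 N d D k G _ hG hk P c hP
    have hd0 : (1 : ℝ) ≤ d₀ := by exact_mod_cast hd
    have hk0 : (0 : ℝ) < k := by exact_mod_cast hk
    have hδd : δ * d₀ ≤ 1 / 1000 := by
      refine (mul_le_mul_of_nonneg_right hδth (by linarith)).trans_eq ?_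
      field_simp
    have hδ : δ ≤ 1 / 1000 := by nlinarith
    have hmix := P.mixingError_le hP hδ0 hd hk hG hδd (by linarith) hΓ2 c
    refine ⟨fun e => P.one_sub_two_mul_smul_Heff_posSemidef
      (P.one_sub_pairRate_posSemidef hP hδ0.le (by linarith) (by linarith) (by linarith) e),
      hmix, fun ε hε hε2 T hT => (hmix T).trans (ENNReal.ofReal_le_ofReal ?_)⟩
    rcases Nat.eq_zero_or_pos N with rfl | hN
    · simpa using hε.le
    · refine Dissipative.exp_bound_le ?_ hε hε2 (by positivity) ?_
      · exact_mod_cast Nat.mul_pos hN hd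
      · rwa [inv_div]
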